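/- **Setting.** All logarithms are to base $2$. Let $G=(V,E)$ be a finite connected simple graph with a set $V_\partial\subseteq V$ of boundary vertices, $V_b=V\setminus V_\partial$ and $A\subseteq V_\partial$. For every $n$ in a strictly increasing sequence of positive integers let a family of link states be given: dimensions $D_e$ and unit vectors $|\phi_e\rangle=\sum_{i=1}^{D_e}\sqrt{\lambda_{e,i}}\,|ii\rangle\in\mathcal H_{e,x}\otimes\mathcal H_{e,y}$, $\mathcal H_{e,x}=\mathcal H_{e,y}=\mathbb C^{D_e}$, $\lambda_{e,i}\ge 0$, $\sum_i\lambda_{e,i}=1$, for $e=(xy)\in E$ (all depending on $n$), and $|\phi\rangle=\bigotimes_e|\phi_e\rangle$. Put $\mathcal H_x=\bigotimes_{e\ni x}\mathcal H_{e,x}$ and $\mathcal H_S=\bigotimes_{x\in S}\mathcal H_x$ for $S\subseteq V$; $\phi_S$ is the reduced density matrix of $|\phi\rangle\langle\phi|$ on $\mathcal H_S$. For each $x\in V_b$ let $|\psi_x\rangle\in\mathcal H_x$ be a random vector, where all coefficients of all $|\psi_x\rangle$ are independent standard circularly symmetric complex Gaussians (distributed as $(X+iY)/\sqrt2$ with $X,Y$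 independent real standard Gaussians). The random tensor network state is $|\rho\rangle=(I_{V_\partial}\otimes\bigotimes_{x\in V_b}\langle\psi_x|)|\phi\rangle\in\mathcal H_{V_\partial}$, and $\rho_A$ is the reduced density matrix of $|\rho\rangle\langle\rho|$ on $\mathcal H_A$. **Entropies.** For positive semidefinite $\rho,\sigma$ of trace at most $1$ let $P(\rho,\sigma)=\sqrt{1-F_*(\rho,\sigma)^2}$, where $F_*(\rho,\sigma)=\|\sqrt\rho\sqrt\sigma\|_1+\sqrt{(1-\operatorname{tr}\rho)(1-\operatorname{tr}\sigma)}$. Let $$H_{\min}(S|T)_\rho=\sup_{\sigma_T\ge 0,\ \operatorname{tr}\sigma_T\le 1}\bigl(-\inf\{r\in\mathbb R:\rho_{ST}\le 2^r I_S\otimes\sigma_T\}\bigr),\qquad H^\varepsilon_{\min}(S|T)_\rho=\sup_{\rho'}H_{\min}(S|T)_{\rho'},$$ the second supremum being over the positive semidefinite $\rho'$ on $\mathcal H_S\otimes\mathcal H_T$ with $\operatorname{tr}\rho'\le 1$ and $P(\rho',\rho_{ST})\le\varepsilon$; values are in $[-\infty,\infty]$. **Cuts.** A cut for $A$ is a set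 $\Gamma\subseteq V$ with $\Gamma\cap V_\partial=A$; $\Gamma^c=V\setminus\Gamma$. Two cuts $\Gamma_{A,1}\subsetneq\Gamma_{A,2}$ for $A$ are non-intersecting if no edge of $G$ crosses both of them (an edge crosses $\Gamma$ if it joins $\Gamma$ to $\Gamma^c$). They are a pair of $(\varepsilon,K)$-minimal cuts if for all cuts $\Delta$ for $A$: * $H^\varepsilon_{\min}(\Gamma_{A,1}\setminus\Delta\,|\,\Gamma_{A,1}^c)_\phi\ge K$ if $\Delta\subsetneq\Gamma_{A,1}$; * $H^\varepsilon_{\min}(\Delta\setminus\Gamma_{A,2}\,|\,\Gamma_{A,2})_\phi\ge K$ if $\Gamma_{A,2}\subsetneq\Delta$; * $H^\varepsilon_{\min}(\Delta\setminus\Gamma_{A,1}\,|\,\Gamma_{A,1})_\phi\ge K$ and $H^\varepsilon_{\min}(\Gamma_{A,2}\setminus\Delta\,|\,\Gamma_{A,2}^c)_\phi\ge K$ if $\Gamma_{A,1}\subsetneq\Delta\subsetneq\Gamma_{A,2}$. **Theorem.** Let $\Gamma_{A,1}\subsetneq\Gamma_{A,2}$ be fixed non-intersecting cuts for $A$ which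 for every $n$ of the sequence are a pair of $(\varepsilon(n),K(n))$-minimal cuts, where, as $n\to\infty$, $\varepsilon(n)=\mathcal O(n^{-\gamma})$ for some $\gamma>4$ and $K(n)=\Omega(\log(n)^2)$ (that is, $K(n)\ge c\log(n)^2$ for some $c>0$ and all large $n$). Let $H:\mathbb N\to\mathbb R$, and for a positive semidefinite $\tau$ let $$\nu_\tau=\sum_{\lambda\in\operatorname{spec}(\tau)}\lambda\,\delta_{\frac1{\sqrt n}[\log(1/\lambda)-H(n)]}$$ (eigenvalues counted with multiplicity; $\lambda=0$ contributes nothing). Assume that $\nu_{\phi_{\Gamma_{A,i}}}$ converges weakly to $\nu_i$ for $i=1,2$, where $\nu_1,\nu_2$ are probability measures on $\mathbb R$ with continuous cumulative distribution functions. Then $\nu_{\rho_A}$ converges weakly, in probability, to the pushforward $\min_*(\nu_1,\nu_2)$ of $\nu_1\times\nu_2$ under $\min:\mathbb R\times\mathbb R\to\mathbb R$; that is, for every bounded continuous $f:\mathbb R\to\mathbb R$ and every $\delta>0$, $$\lim_{n\to\infty}\Pr\Bigl(\Bigl|\int f\,d\nu_{\rho_A}-\int f\,d\min{}_*(\nu_1,\nu_2)\Bigr|\ge\delta\Bigr)=0.$$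 -/

import Mathlib

open MeasureTheory ProbabilityTheory Filter Topology
open scoped ComplexOrder MatrixOrder Kronecker ENNReal ComplexConjugate

namespace RTN

/-! ### States, purified distance, smooth conditional min-entropy -/

section Entropy

variable {a b : Type*} [Fintype a] [DecidableEq a] [Fintype b] [DecidableEq b]

/-- Subnormalized states: positive semidefinite matrices of trace at most one. -/
def IsSubnormalized (ρ : Matrix a a ℂ) : Prop :=
  ρ.PosSemidef ∧ ρ.trace.re ≤ 1

/-- The Schatten 1-norm `‖M‖₁ = tr √(Mᴴ M)`. -/
noncomputable def traceNorm (M : Matrix a a ℂ) : ℝ :=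
  (CFC.abs M).trace.re

/-- The fidelity `F(ρ, σ) = ‖√ρ √σ‖₁`. -/
noncomputable def fidelity (ρ σ : Matrix a a ℂ) : ℝ :=
  traceNorm (CFC.sqrt ρ * CFC.sqrt σ)

/-- The generalized fidelity of subnormalized states. -/
noncomputable def genFidelity (ρ σ : Matrix a a ℂ) : ℝ :=
  fidelity ρ σ + √((1 - ρ.trace.re) * (1 - σ.trace.re))

/-- The purified distance of subnormalized states. -/
noncomputable def purifiedDistance (ρ σ : Matrix a a ℂ) : ℝ :=
  √(1 - genFidelity ρ σ ^ 2)

/-- `H_min(A|B)_{ρ|σ} = - inf {r : ρ ≤ 2 ^ r (I ⊗ σ)}`, the order being the Loewner order; the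
value is `-∞` if there is no such `r`. -/
noncomputable def condMinEntropyRel (ρ : Matrix (a × b) (a × b) ℂ) (σ : Matrix b b ℂ) : EReal :=
  -⨅ (r : ℝ) (_ : (((2 : ℝ) ^ r) • ((1 : Matrix a a ℂ) ⊗ₖ σ) - ρ).PosSemidef), (r : EReal)

/-- `H_min(A|B)_ρ`, the supremum over all subnormalized `σ` on `B`. -/
noncomputable def condMinEntropy (ρ : Matrix (a × b) (a × b) ℂ) : EReal :=
  ⨆ (σ : Matrix b b ℂ) (_ : IsSubnormalized σ), condMinEntropyRel ρ σ

/-- `H_min^ε(A|B)_ρ`, the supremum over the subnormalized states within purified distance `ε`. -/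
noncomputable def smoothCondMinEntropy (ε : ℝ) (ρ : Matrix (a × b) (a × b) ℂ) : EReal :=
  ⨆ (ρ' : Matrix (a × b) (a × b) ℂ) (_ : IsSubnormalized ρ' ∧ purifiedDistance ρ' ρ ≤ ε),
    condMinEntropy ρ'

end Entropy

/-! ### Link states and their reduced states -/

section Network

variable {V : Type*}

/-- The half-edges of a graph: pairs `(e, x)` of an edge and one of its end points. -/
abbrev HalfEdge (G : SimpleGraph V) : Type _ :=
  {h : G.edgeSet × V // h.2 ∈ (h.1 : Sym2 V)}

/-- The labels of the standard basis of `H_S = ⨂_{(e,x), x ∈ S} ℂ^{D_e}`, for a set `S` of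
vertices. -/
abbrev Cfg {G : SimpleGraph V} (D : G.edgeSet → ℕ) (S : Finset V) : Type _ :=
  (h : {h : HalfEdge G // h.1.2 ∈ S}) → Fin (D h.1.1.1)

/-- A family of link states `|φ_e⟩ = ∑ i, √λ_{e,i} |ii⟩` on `ℂ^{D_e} ⊗ ℂ^{D_e}`, one for each
edge `e`, each of unit norm. -/
structure LinkState (G : SimpleGraph V) where
  dim : G.edgeSet → ℕ
  coeff : (e : G.edgeSet) → Fin (dim e) → ℝ
  coeff_nonneg : ∀ e i, 0 ≤ coeff e i
  sum_coeff : ∀ e, ∑ i, coeff e i = 1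

variable [Fintype V] [DecidableEq V] {G : SimpleGraph V} [DecidableRel G.Adj]

/-- The standard basis label of `H_W` made of a label of `H_S` and a label of `H_T`, where
`W ⊆ S ∪ T`; it is used for disjoint `S` and `T`. -/
def Cfg.join {D : G.edgeSet → ℕ} {S T W : Finset V} (hW : W ⊆ S ∪ T)
    (i : Cfg D S) (j : Cfg D T) : Cfg D W := fun h =>
  if hS : h.1.1.2 ∈ S then i ⟨h.1, hS⟩
  else j ⟨h.1, (Finset.mem_union.1 (hW h.2)).resolve_left hS⟩

/-- The restriction of a basis label of `H_W` to the tensor factor `H_S`, where `S ⊆ W`. -/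
def Cfg.restrict {D : G.edgeSet → ℕ} {S W : Finset V} (hS : S ⊆ W) (i : Cfg D W) : Cfg D S :=
  fun h => i ⟨h.1, hS h.2⟩

/-- The full state on edges `|φ⟩ = ⨂_e |φ_e⟩`, by its coefficients in the standard basis. -/
noncomputable def LinkState.vector (φ : LinkState G) : Cfg φ.dim Finset.univ → ℂ := fun I =>
  ∏ e : G.edgeSet, ∑ i : Fin (φ.dim e),
    if ∀ x : {x : V // x ∈ (e : Sym2 V)}, I ⟨⟨(e, x.1), x.2⟩, Finset.mem_univ _⟩ = i
    then ((√(φ.coeff e i) : ℝ) : ℂ) else 0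

/-- The reduced density matrix on `H_S` of the pure state `|v⟩⟨v|`, `v ∈ H_W`, where `S ⊆ W`:
the partial trace over `H_{W \ S}`. -/
noncomputable def reducedState {D : G.edgeSet → ℕ} {W : Finset V} (v : Cfg D W → ℂ)
    (S : Finset V) : Matrix (Cfg D S) (Cfg D S) ℂ := fun i i' =>
  ∑ k : Cfg D (W \ S),
    v (Cfg.join (by intro x; simp; tauto) i k) * conj (v (Cfg.join (by intro x; simp; tauto) i' k))

lemma reducedState_isHermitian {D : G.edgeSet → ℕ} {W : Finset V} (v : Cfg D W → ℂ)
    (S : Finset V) : (reducedState v S).IsHermitian := by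
  ext i i'
  simp [reducedState, Matrix.conjTranspose_apply, mul_comm]

/-- The reduced density matrix of `|v⟩⟨v|` on the bipartite system `H_S ⊗ H_T`, for disjoint sets
`S` and `T` of vertices. -/
noncomputable def bipartiteState {D : G.edgeSet → ℕ} {W : Finset V} (v : Cfg D W → ℂ)
    (S T : Finset V) : Matrix (Cfg D S × Cfg D T) (Cfg D S × Cfg D T) ℂ :=
  (reducedState v (S ∪ T)).submatrix
    (fun p => Cfg.join (Finset.Subset.refl _) p.1 p.2)
    (fun p => Cfg.join (Finset.Subset.refl _) p.1 p.2)

/-- `H_min^ε(S|T)_φ` for disjoint sets `S` and `T` of vertices. -/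
noncomputable def LinkState.smoothMinEntropy (φ : LinkState G) (ε : ℝ) (S T : Finset V) : EReal :=
  smoothCondMinEntropy ε (bipartiteState φ.vector S T)

/-! ### Cuts -/

/-- `Γ` is a cut for the set `A` of boundary vertices. -/
def IsCut (bdry A Γ : Finset V) : Prop := Γ ∩ bdry = A

/-- The edges which cross a cut. -/
def cutEdges (G : SimpleGraph V) (Γ : Finset V) : Set (Sym2 V) :=
  {e | e ∈ G.edgeSet ∧ (∃ x ∈ e, x ∈ Γ) ∧ ∃ y ∈ e, y ∉ Γ}

/-- The nested cuts `Γ₁ ⊊ Γ₂` for `A` are a pair of `(ε, K)`-minimal cuts. -/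
def IsMinimalCutPair (φ : LinkState G) (bdry A Γ₁ Γ₂ : Finset V) (ε K : ℝ) : Prop :=
  (∀ Δ, IsCut bdry A Δ → Δ ⊂ Γ₁ → (K : EReal) ≤ φ.smoothMinEntropy ε (Γ₁ \ Δ) Γ₁ᶜ) ∧
  (∀ Δ, IsCut bdry A Δ → Γ₂ ⊂ Δ → (K : EReal) ≤ φ.smoothMinEntropy ε (Δ \ Γ₂) Γ₂) ∧
  (∀ Δ, IsCut bdry A Δ → Γ₁ ⊂ Δ → Δ ⊂ Γ₂ →
    (K : EReal) ≤ φ.smoothMinEntropy ε (Δ \ Γ₁) Γ₁ ∧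
    (K : EReal) ≤ φ.smoothMinEntropy ε (Γ₂ \ Δ) Γ₂ᶜ)

/-! ### Random tensor network states -/

/-- A choice of a vector `|ψ_x⟩ ∈ H_x` for every bulk vertex `x`, by its coefficients in the
standard basis. -/
abbrev BulkTensors (D : G.edgeSet → ℕ) (bdry : Finset V) : Type _ :=
  (Σ x : {x : V // x ∈ bdryᶜ}, Cfg D {x.1}) → ℂ

/-- The law of `(X + i Y) / √2`, where `X` and `Y` are independent standard real Gaussians. -/
noncomputable def stdComplexGaussian : Measure ℂ :=
  ((gaussianReal 0 1).prod (gaussianReal 0 1)).map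
    (fun p : ℝ × ℝ => ((p.1 : ℂ) + (p.2 : ℂ) * Complex.I) / ((√2 : ℝ) : ℂ))

/-- The law of the random tensors: all coefficients are independent standard complex Gaussians. -/
noncomputable def bulkLaw (D : G.edgeSet → ℕ) (bdry : Finset V) : Measure (BulkTensors D bdry) :=
  Measure.pi fun _ => stdComplexGaussian

/-- The tensor network state `|ρ⟩ = (I ⊗ ⟨ψ|) |φ⟩` on the boundary, where `|ψ⟩ = ⨂_x |ψ_x⟩`, the
tensor product being over the bulk vertices. -/
noncomputable def LinkState.networkVector (φ : LinkState G) (bdry : Finset V)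
    (ψ : BulkTensors φ.dim bdry) : Cfg φ.dim bdry → ℂ := fun i =>
  ∑ k : Cfg φ.dim bdryᶜ,
    conj (∏ x : {x : V // x ∈ bdryᶜ},
      ψ ⟨x, Cfg.restrict (Finset.singleton_subset_iff.2 x.2) k⟩) *
    φ.vector (Cfg.join (by simp) i k)

end Network

/-! ### Spectral measures and convergence -/

/-- The measure `∑ λ, λ δ_{(log₂(1/λ) - h) / √n}`, the sum being over the eigenvalues of `M` with
multiplicity. -/
noncomputable def spectralLogMeasure {a : Type*} [Fintype a] [DecidableEq a] {M : Matrix a a ℂ}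
    (hM : M.IsHermitian) (n : ℕ) (h : ℝ) : Measure ℝ :=
  ∑ i, ENNReal.ofReal (hM.eigenvalues i) •
    Measure.dirac ((1 / √(n : ℝ)) * (Real.logb 2 (1 / hM.eigenvalues i) - h))

/-- The measure of the state `φ_Γ`. -/
noncomputable def cutMeasure {V : Type*} [Fintype V] [DecidableEq V] {G : SimpleGraph V}
    [DecidableRel G.Adj] (φ : LinkState G) (Γ : Finset V) (n : ℕ) (h : ℝ) : Measure ℝ :=
  spectralLogMeasure (reducedState_isHermitian φ.vector Γ) n h

/-- The random measure of the boundary state `ρ_A`, as a function of the bulk tensors. -/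
noncomputable def boundaryMeasure {V : Type*} [Fintype V] [DecidableEq V] {G : SimpleGraph V}
    [DecidableRel G.Adj] (φ : LinkState G) (bdry A : Finset V) (n : ℕ) (h : ℝ)
    (ψ : BulkTensors φ.dim bdry) : Measure ℝ :=
  spectralLogMeasure (reducedState_isHermitian (φ.networkVector bdry ψ) A) n h

/-- Weak convergence of finite measures on `ℝ`. -/
def WeaklyConverges (μ : ℕ → Measure ℝ) (ν : Measure ℝ) : Prop :=
  ∀ f : BoundedContinuousFunction ℝ ℝ,
    Tendsto (fun k => ∫ x, f x ∂(μ k)) atTop (𝓝 (∫ x, f x ∂ν))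

/-- Weak convergence in probability of random finite measures on `ℝ`; the `k`-th random measure
lives on the space `Ω k` with law `P k`. -/
def WeaklyConvergesInProbability {Ω : ℕ → Type*} [∀ k, MeasurableSpace (Ω k)]
    (P : ∀ k, Measure (Ω k)) (μ : ∀ k, Ω k → Measure ℝ) (ν : Measure ℝ) : Prop :=
  ∀ f : BoundedContinuousFunction ℝ ℝ, ∀ δ : ℝ, 0 < δ →
    Tendsto (fun k => P k {ω | δ ≤ |(∫ x, f x ∂(μ k ω)) - ∫ x, f x ∂ν|}) atTop (𝓝 0)

/-- The pushforward of `ν₁ × ν₂` under `min : ℝ × ℝ → ℝ`. -/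
noncomputable def minPushforward (ν₁ ν₂ : Measure ℝ) : Measure ℝ :=
  (ν₁.prod ν₂).map fun p => min p.1 p.2

end RTN

/-!
The proof is an elementary second moment argument. The link states are diagonal, so `|φ⟩` is a sum
over labels `a` of the edges, with weights `w a = ∏ λ_e (a_e)` which form a probability
distribution. The boundary state is `ρ_A = R Rᴴ`, where `R` is a matrix with one random term for
each label, and `R_T` denotes the part of `R` with the labels in `T`. The nonzero eigenvalues of
`φ_Γ` are the values of the cut weight `λ_∂Γ a = ∏ λ_e (a_e)`, over the edges `e` across `Γ`
(`LinkState.sum_eigenvalues_reducedState`). Hence the distribution function of `cutMeasure φ Γ` at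
`x` is the probability that `λ_∂Γ a ≥ t_x`, with `t_x = 2 ^ (-(H + x √n))`. The cuts share no edge,
so `λ_∂Γ₁` and `λ_∂Γ₂` are independent (`LinkState.sum_low_low`), and the probability that one of
them is at least `t_x` converges to the distribution function of `min_*(ν₁, ν₂)`. It remains to
show that this probability is close to the part of the spectrum of `ρ_A` above `t_x`
(`LinkState.boundary_spectrum_estimate`).

*Minimality.* If `H_min^ε(S|T) ≥ K` with `K` large and `ε` small, then with high probability
`λ_∂(S ∪ T)` is much smaller than `λ_∂T`: otherwise a projection onto suitable entangled vectors
of `S` and `T` would be a test whose success probability contradicts the entropy bound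
(`sum_le_of_le_smoothCondMinEntropy`, `LinkState.sum_le_of_le_smoothMinEntropy`). A union bound over
the competing cuts shows that most labels are good (`LinkState.sum_not_isGood_le`): all cut weights
of the cuts for `A` are then dominated by those of `Γ₁` and `Γ₂`.

*Moments.* The Gaussian moments turn `E ‖R_T‖⁴` and `E ‖R_T R_Tᴴ‖²` into sums over sets `Δ` of
vertices, which contain no boundary vertices or just those in `A`, of purities of the part of `|φ⟩`
with the labels in `T`, each bounded by `∑ a ∈ T, w a * λ_∂Δ a` (`LinkState.purity_le`). For good
labels, submodularity of the cut weights shows that `‖R_T‖²` concentrates around `∑ a ∈ T, w a`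
(`LinkState.integral_sq_sub_netMatrix_le`), and if both cut weights are at most `t` on `T`, the
Hilbert–Schmidt norm of `R_T R_Tᴴ` is at most of the order `√t`
(`LinkState.integral_purity_netMatrix_le`).

*Spectra.* The part of `R` with labels for which one of the cut weights is at least `t` has a rank
of at most `2 / t` (`LinkState.rank_netMatrix_not_isLow_mul_le`), so it contributes little to the
spectrum below `s ≪ t`; the part with both cut weights below `t` contributes little to the spectrum
above `s ≫ t`, by the bound on `‖R_T R_Tᴴ‖`. These two facts of linear algebra are
`hsSq_le_sum_large_eigenvalues` and `sum_large_eigenvalues_le`. On the scale `√n` of the logarithms,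
`s` and `t` may differ by any factor `2 ^ (κ √n)`, and the limits have continuous distribution
functions, so that the two bounds meet in the limit.
-/

namespace RTN

set_option linter.unusedSectionVars false

/-! ### Singular value estimates -/

section LinearAlgebra

variable {m n : Type*} [Fintype m] [Fintype n] [DecidableEq m] [DecidableEq n]

/-- The squared Hilbert–Schmidt norm `∑ |M i j|²`. -/
noncomputable def hsSq (M : Matrix m n ℂ) : ℝ := ∑ i, ∑ j, ‖M i j‖ ^ 2

lemma hsSq_nonneg (M : Matrix m n ℂ) : 0 ≤ hsSq M := by unfold hsSq; positivity

lemma mul_conjTranspose_diag_eq (M : Matrix m n ℂ) (i : m) :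
    (M * M.conjTranspose) i i = ((∑ j, ‖M i j‖ ^ 2 : ℝ) : ℂ) := by
  simp [Matrix.mul_apply, Matrix.conjTranspose_apply, Complex.mul_conj, Complex.normSq_eq_norm_sq]

lemma hsSq_eq_trace (M : Matrix m n ℂ) : (hsSq M : ℂ) = (M * M.conjTranspose).trace := by
  simp only [Matrix.trace, Matrix.diag, mul_conjTranspose_diag_eq, hsSq]
  push_cast; rfl

lemma hsSq_unitary_mul (U : Matrix.unitaryGroup m ℂ) (V : Matrix.unitaryGroup n ℂ)
    (M : Matrix m n ℂ) :
    hsSq ((U : Matrix m m ℂ).conjTranspose * M * (V : Matrix n n ℂ)) = hsSq M := by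
  have hU : (U : Matrix m m ℂ) * (U : Matrix m m ℂ).conjTranspose = 1 :=
    Unitary.coe_mul_star_self U
  have hV : (V : Matrix n n ℂ) * (V : Matrix n n ℂ).conjTranspose = 1 :=
    Unitary.coe_mul_star_self V
  have : (hsSq ((U : Matrix m m ℂ).conjTranspose * M * (V : Matrix n n ℂ)) : ℂ) = hsSq M := by
    rw [hsSq_eq_trace, hsSq_eq_trace]
    simp only [Matrix.conjTranspose_mul, Matrix.conjTranspose_conjTranspose]
    rw [show (U : Matrix m m ℂ).conjTranspose * M * (V : Matrix n n ℂ) *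
      ((V : Matrix n n ℂ).conjTranspose * (M.conjTranspose * (U : Matrix m m ℂ))) =
      (U : Matrix m m ℂ).conjTranspose * (M * ((V : Matrix n n ℂ) *
        (V : Matrix n n ℂ).conjTranspose) * M.conjTranspose * (U : Matrix m m ℂ)) by
          simp only [Matrix.mul_assoc], hV, Matrix.trace_mul_comm, Matrix.mul_one,
      Matrix.mul_assoc, hU, Matrix.mul_one]
  exact_mod_cast this

lemma norm_add_sq_le_weighted {E : Type*} [SeminormedAddCommGroup E] (x y : E) {τ : ℝ} (hτ : 0 < τ) :
    ‖x + y‖ ^ 2 ≤ (1 + τ) * ‖x‖ ^ 2 + (1 + 1 / τ) * ‖y‖ ^ 2 := by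
  have h1 : ‖x + y‖ ^ 2 ≤ (‖x‖ + ‖y‖) ^ 2 := by gcongr; exact norm_add_le x y
  have h2 : (1 + τ) * ‖x‖ ^ 2 + (1 + 1 / τ) * ‖y‖ ^ 2 - (‖x‖ + ‖y‖) ^ 2 =
      (τ * ‖x‖ - ‖y‖) ^ 2 / τ := by field_simp; ring
  have h3 : 0 ≤ (τ * ‖x‖ - ‖y‖) ^ 2 / τ := by positivity
  linarith

lemma hsSq_add_le (S N : Matrix m n ℂ) {τ : ℝ} (hτ : 0 < τ) :
    hsSq (S + N) ≤ (1 + τ) * hsSq S + (1 + 1 / τ) * hsSq N := by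
  simp only [hsSq, Finset.mul_sum, ← Finset.sum_add_distrib]
  refine Finset.sum_le_sum fun i _ => Finset.sum_le_sum fun j _ => ?_
  exact norm_add_sq_le_weighted _ _ hτ

/-- A matrix with orthogonal rows of squared norms `d i` has columns of squared norm at most `s`
once it is restricted to the rows with `d i ≤ s`. -/
lemma sum_col_le_of_orthogonal_rows (M : Matrix m n ℂ) (d : m → ℝ)
    (hM : M * M.conjTranspose = Matrix.diagonal fun i => (d i : ℂ)) {s : ℝ}
    (I : Finset m) (hI : ∀ i ∈ I, d i ≤ s) (j : n) : ∑ i ∈ I, ‖M i j‖ ^ 2 ≤ s ∨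
      ∑ i ∈ I, ‖M i j‖ ^ 2 = 0 := by
  set Y := ∑ i ∈ I, ‖M i j‖ ^ 2 with hY
  have hY0 : 0 ≤ Y := by positivity
  let v : n → ℂ := fun l => ∑ i ∈ I, conj (M i j) * M i l
  have hvj : v j = (Y : ℂ) := by
    simp only [v, hY, Complex.conj_mul', Complex.ofReal_sum, Complex.ofReal_pow]
  have hv : ((∑ l, ‖v l‖ ^ 2 : ℝ) : ℂ) = ((∑ i ∈ I, ‖M i j‖ ^ 2 * d i : ℝ) : ℂ) := by
    have h1 : ∀ l, ((‖v l‖ ^ 2 : ℝ) : ℂ) =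
        ∑ i ∈ I, ∑ i' ∈ I, conj (M i j) * M i' j * (M i l * conj (M i' l)) := by
      intro l
      rw [Complex.ofReal_pow, ← Complex.mul_conj']
      simp only [v, map_sum, map_mul, Complex.conj_conj, Finset.sum_mul_sum]
      exact Finset.sum_congr rfl fun i _ => Finset.sum_congr rfl fun i' _ => by ring
    rw [Complex.ofReal_sum, Finset.sum_congr rfl fun l _ => h1 l, Finset.sum_comm,
      Complex.ofReal_sum]
    refine Finset.sum_congr rfl fun i hi => ?_
    rw [Finset.sum_comm]
    have h2 : ∀ i', ∑ l, conj (M i j) * M i' j * (M i l * conj (M i' l)) =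
        if i = i' then conj (M i j) * M i' j * d i else 0 := by
      intro i'
      have := congrFun (congrFun hM i) i'
      rw [Matrix.mul_apply, Matrix.diagonal_apply] at this
      simp only [Matrix.conjTranspose_apply, RCLike.star_def] at this
      rw [← Finset.mul_sum, this]
      split_ifs <;> simp
    rw [Finset.sum_congr rfl fun i' _ => h2 i', Finset.sum_ite_eq, if_pos hi, Complex.conj_mul']
    push_cast; ring
  have hv' : ∑ l, ‖v l‖ ^ 2 = ∑ i ∈ I, ‖M i j‖ ^ 2 * d i := by exact_mod_cast hv
  have h3 : Y ^ 2 ≤ ∑ l, ‖v l‖ ^ 2 := by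
    calc Y ^ 2 = ‖v j‖ ^ 2 := by rw [hvj, Complex.norm_real, Real.norm_eq_abs, sq_abs]
      _ ≤ _ := Finset.single_le_sum (f := fun l => ‖v l‖ ^ 2) (fun l _ => by positivity)
        (Finset.mem_univ j)
  have h4 : ∑ i ∈ I, ‖M i j‖ ^ 2 * d i ≤ Y * s := by
    rw [hY, Finset.sum_mul]
    exact Finset.sum_le_sum fun i hi => by gcongr; exact hI i hi
  rcases hY0.eq_or_lt with h | h
  · exact Or.inr h.symm
  · left; nlinarith

lemma diagonal_of_eigenvectorUnitary (M : Matrix m n ℂ) (hM : (M * M.conjTranspose).IsHermitian)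
    (V : Matrix.unitaryGroup n ℂ) :
    ((hM.eigenvectorUnitary : Matrix m m ℂ).conjTranspose * M * (V : Matrix n n ℂ)) *
      ((hM.eigenvectorUnitary : Matrix m m ℂ).conjTranspose * M *
        (V : Matrix n n ℂ)).conjTranspose =
      Matrix.diagonal fun i => (hM.eigenvalues i : ℂ) := by
  have hU : (hM.eigenvectorUnitary : Matrix m m ℂ).conjTranspose *
      (hM.eigenvectorUnitary : Matrix m m ℂ) = 1 := Unitary.coe_star_mul_self _
  have hV : (V : Matrix n n ℂ) * (V : Matrix n n ℂ).conjTranspose = 1 :=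
    Unitary.coe_mul_star_self V
  have h := hM.spectral_theorem
  rw [Unitary.conjStarAlgAut_apply, Matrix.star_eq_conjTranspose] at h
  simp only [Matrix.conjTranspose_mul, Matrix.conjTranspose_conjTranspose]
  set U := (hM.eigenvectorUnitary : Matrix m m ℂ)
  rw [show U.conjTranspose * M * (V : Matrix n n ℂ) *
      ((V : Matrix n n ℂ).conjTranspose * (M.conjTranspose * U)) =
      U.conjTranspose * (M * ((V : Matrix n n ℂ) *
        (V : Matrix n n ℂ).conjTranspose) * M.conjTranspose) * U by
          simp only [Matrix.mul_assoc], hV, Matrix.mul_one]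
  refine (congrArg (fun X => U.conjTranspose * X * U) h).trans ?_
  rw [show U.conjTranspose * (U * Matrix.diagonal (RCLike.ofReal ∘ hM.eigenvalues) *
    U.conjTranspose) * U = (U.conjTranspose * U) * Matrix.diagonal (RCLike.ofReal ∘ hM.eigenvalues) *
    (U.conjTranspose * U) by simp only [Matrix.mul_assoc], hU, Matrix.one_mul, Matrix.mul_one]
  rfl

lemma eigenvalues_mul_conjTranspose_nonneg (M : Matrix m n ℂ)
    (hM : (M * M.conjTranspose).IsHermitian) (i : m) : 0 ≤ hM.eigenvalues i :=
  (Matrix.posSemidef_self_mul_conjTranspose M).eigenvalues_nonneg i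

lemma sum_eigenvalues_eq_hsSq (M : Matrix m n ℂ) (hM : (M * M.conjTranspose).IsHermitian) :
    ∑ i, hM.eigenvalues i = hsSq M := by
  have h := hM.trace_eq_sum_eigenvalues
  rw [← hsSq_eq_trace] at h
  apply Complex.ofReal_injective
  rw [h]; push_cast; rfl

/-- The number of nonzero columns after a rotation of the domain is the rank. -/
lemma exists_unitary_card_nonzero_cols (S : Matrix m n ℂ) :
    ∃ (V : Matrix.unitaryGroup n ℂ) (J : Finset n), J.card = S.rank ∧
      ∀ j ∉ J, ∀ i, (S * (V : Matrix n n ℂ)) i j = 0 := by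
  have hS : (S.conjTranspose * S.conjTranspose.conjTranspose).IsHermitian :=
    Matrix.isHermitian_mul_conjTranspose_self _
  refine ⟨hS.eigenvectorUnitary, Finset.univ.filter fun j => hS.eigenvalues j ≠ 0, ?_, ?_⟩
  · have := hS.rank_eq_card_non_zero_eigs
    rw [← Fintype.card_subtype, ← this, Matrix.rank_self_mul_conjTranspose,
      Matrix.rank_conjTranspose]
  · intro j hj i
    have h := congrFun (congrFun (diagonal_of_eigenvectorUnitary S.conjTranspose hS 1) j) j
    simp only [Finset.mem_filter, Finset.mem_univ, true_and, not_not] at hj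
    rw [mul_conjTranspose_diag_eq, Matrix.diagonal_apply_eq, hj] at h
    have h' := (Finset.sum_eq_zero_iff_of_nonneg (fun i _ => by positivity)).1
      (Complex.ofReal_injective h) i (Finset.mem_univ i)
    rw [sq_eq_zero_iff, norm_eq_zero] at h'
    have h2 : (S * (hS.eigenvectorUnitary : Matrix n n ℂ)) i j =
        star (((hS.eigenvectorUnitary : Matrix n n ℂ).conjTranspose * S.conjTranspose *
          ((1 : Matrix.unitaryGroup m ℂ) : Matrix m m ℂ)) j i) := by
      rw [← Matrix.conjTranspose_apply]
      simp only [Matrix.conjTranspose_mul, Matrix.conjTranspose_conjTranspose,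
        OneMemClass.coe_one, Matrix.conjTranspose_one, Matrix.one_mul]
    rw [h2, star_eq_zero]
    exact h'

/-- If `M` is the sum of a matrix of rank at most `k` and of `N`, then the eigenvalues of `M Mᴴ`
below `s` have total weight at most `k s + ‖N‖²`. -/
lemma hsSq_le_sum_large_eigenvalues (M S N : Matrix m n ℂ) (hMSN : M = S + N)
    (hM : (M * M.conjTranspose).IsHermitian) {s : ℝ} (hs : 0 ≤ s) :
    hsSq M ≤ ∑ i with s ≤ hM.eigenvalues i, hM.eigenvalues i + S.rank * s + hsSq N := by
  obtain ⟨V, J, hJ, hV⟩ := exists_unitary_card_nonzero_cols S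
  set U := hM.eigenvectorUnitary
  set M' := (U : Matrix m m ℂ).conjTranspose * M * (V : Matrix n n ℂ) with hM'
  set N' := (U : Matrix m m ℂ).conjTranspose * N * (V : Matrix n n ℂ) with hN'
  have hd := diagonal_of_eigenvectorUnitary M hM V
  have hrow : ∀ i, hM.eigenvalues i = ∑ j, ‖M' i j‖ ^ 2 := by
    intro i
    have h := congrFun (congrFun hd i) i
    rw [mul_conjTranspose_diag_eq, Matrix.diagonal_apply_eq] at h
    exact_mod_cast h.symm
  have hcol : ∀ j ∉ J, ∀ i, M' i j = N' i j := by
    intro j hj i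
    have : M' i j = ((U : Matrix m m ℂ).conjTranspose * (S * (V : Matrix n n ℂ))) i j + N' i j := by
      rw [hM', hN', ← Matrix.add_apply, ← Matrix.mul_assoc, ← Matrix.add_mul, ← Matrix.mul_add,
        hMSN]
    rw [this, Matrix.mul_apply, Finset.sum_eq_zero, zero_add]
    intro l _
    rw [hV j hj l, mul_zero]
  rw [← sum_eigenvalues_eq_hsSq M hM, ← Finset.sum_filter_add_sum_filter_not Finset.univ
    (fun i => s ≤ hM.eigenvalues i), add_assoc]
  gcongr
  simp_rw [hrow]
  rw [Finset.sum_comm, ← Finset.sum_add_sum_compl J]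
  gcongr
  · rw [← hJ, ← nsmul_eq_mul]
    refine Finset.sum_le_card_nsmul _ _ _ fun j _ => ?_
    rcases sum_col_le_of_orthogonal_rows M' hM.eigenvalues hd
      (Finset.univ.filter fun i => ¬ s ≤ ∑ j, ‖M' i j‖ ^ 2) (s := s) (by
        intro i hi
        rw [hrow]
        exact (not_le.1 (Finset.mem_filter.1 hi).2).le) j with h | h
    · exact h
    · rw [h]; exact hs
  · have hNsum : hsSq N = ∑ j, ∑ i, ‖N' i j‖ ^ 2 := by
      rw [← hsSq_unitary_mul U V N, hsSq, Finset.sum_comm]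
    rw [hNsum]
    calc _ ≤ ∑ j ∈ Jᶜ, ∑ i, ‖N' i j‖ ^ 2 := by
          refine Finset.sum_le_sum fun j hj => ?_
          simp_rw [hcol j (Finset.mem_compl.1 hj)]
          exact Finset.sum_le_sum_of_subset_of_nonneg (Finset.subset_univ _)
            fun _ _ _ => by positivity
      _ ≤ ∑ j, ∑ i, ‖N' i j‖ ^ 2 :=
          Finset.sum_le_sum_of_subset_of_nonneg (Finset.subset_univ _) fun _ _ _ => by positivity

/-- If `M = S + N`, then the eigenvalues of `M Mᴴ` above `s` have little more weight than `S`, once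
`N Nᴴ` has small purity. -/
lemma sum_large_eigenvalues_le (M S N : Matrix m n ℂ) (hMSN : M = S + N)
    (hM : (M * M.conjTranspose).IsHermitian) {s τ : ℝ} (hs : 0 < s) (hτ : 0 < τ) :
    ∑ i with s ≤ hM.eigenvalues i, hM.eigenvalues i ≤ (1 + τ) * hsSq S +
      (1 + 1 / τ) * √(hsSq M / s * hsSq (N * N.conjTranspose)) := by
  set U := hM.eigenvectorUnitary
  set M' := (U : Matrix m m ℂ).conjTranspose * M * ((1 : Matrix.unitaryGroup n ℂ) : Matrix n n ℂ)
    with hM'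
  set N' := (U : Matrix m m ℂ).conjTranspose * N * ((1 : Matrix.unitaryGroup n ℂ) : Matrix n n ℂ)
    with hN'
  set S' := (U : Matrix m m ℂ).conjTranspose * S * ((1 : Matrix.unitaryGroup n ℂ) : Matrix n n ℂ)
    with hS'
  have hadd : M' = S' + N' := by rw [hM', hS', hN', hMSN, Matrix.mul_add, Matrix.add_mul]
  have hd := diagonal_of_eigenvectorUnitary M hM 1
  have hrow : ∀ i, hM.eigenvalues i = ∑ j, ‖M' i j‖ ^ 2 := by
    intro i
    have h := congrFun (congrFun hd i) i
    rw [mul_conjTranspose_diag_eq, Matrix.diagonal_apply_eq] at h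
    exact_mod_cast h.symm
  set I := Finset.univ.filter fun i => s ≤ hM.eigenvalues i with hI
  have hcard : (I.card : ℝ) ≤ hsSq M / s := by
    rw [le_div_iff₀ hs, ← sum_eigenvalues_eq_hsSq M hM, ← nsmul_eq_mul]
    calc _ ≤ ∑ i ∈ I, hM.eigenvalues i :=
          Finset.card_nsmul_le_sum _ _ _ fun i hi => (Finset.mem_filter.1 hi).2
      _ ≤ _ := Finset.sum_le_sum_of_subset_of_nonneg (Finset.subset_univ _)
            fun i _ _ => eigenvalues_mul_conjTranspose_nonneg M hM i
  have hNN : hsSq (N' * N'.conjTranspose) = hsSq (N * N.conjTranspose) := by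
    rw [← hsSq_unitary_mul U U (N * N.conjTranspose), hN']
    simp [Matrix.conjTranspose_mul, Matrix.mul_assoc]
  have hN2 : ∑ i ∈ I, ∑ j, ‖N' i j‖ ^ 2 ≤ √(hsSq M / s * hsSq (N * N.conjTranspose)) := by
    refine Real.le_sqrt_of_sq_le ?_
    refine (sq_sum_le_card_mul_sum_sq).trans ?_
    refine mul_le_mul hcard ?_ (by positivity) (by have := hsSq_nonneg M; positivity)
    rw [← hNN, hsSq]
    calc _ ≤ ∑ i, (∑ j, ‖N' i j‖ ^ 2) ^ 2 :=
          Finset.sum_le_sum_of_subset_of_nonneg (Finset.subset_univ _) fun i _ _ => by positivity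
      _ ≤ _ := Finset.sum_le_sum fun i _ => by
          refine le_trans (le_of_eq ?_) (Finset.single_le_sum
            (f := fun j => ‖(N' * N'.conjTranspose) i j‖ ^ 2) (fun _ _ => by positivity)
            (Finset.mem_univ i))
          simp only [mul_conjTranspose_diag_eq, Complex.norm_real, Real.norm_eq_abs, sq_abs]
  have hS2 : ∑ i ∈ I, ∑ j, ‖S' i j‖ ^ 2 ≤ hsSq S := by
    rw [← hsSq_unitary_mul U 1 S]
    exact Finset.sum_le_sum_of_subset_of_nonneg (Finset.subset_univ _) fun i _ _ => by positivity
  calc ∑ i ∈ I, hM.eigenvalues i = ∑ i ∈ I, ∑ j, ‖S' i j + N' i j‖ ^ 2 := by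
        refine Finset.sum_congr rfl fun i _ => ?_
        rw [hrow, hadd]; rfl
    _ ≤ ∑ i ∈ I, ∑ j, ((1 + τ) * ‖S' i j‖ ^ 2 + (1 + 1 / τ) * ‖N' i j‖ ^ 2) :=
        Finset.sum_le_sum fun i _ => Finset.sum_le_sum fun j _ => norm_add_sq_le_weighted _ _ hτ
    _ = (1 + τ) * ∑ i ∈ I, ∑ j, ‖S' i j‖ ^ 2 + (1 + 1 / τ) * ∑ i ∈ I, ∑ j, ‖N' i j‖ ^ 2 := by
        simp only [Finset.mul_sum, Finset.sum_add_distrib]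
    _ ≤ _ := by gcongr

end LinearAlgebra

/-! ### Spectra of matrices given by an orthonormal family -/

section Spectrum

/-- The nonzero eigenvalues of `U D Uᴴ` are those of the diagonal matrix `D` if `U` is an
isometry. -/
lemma sum_eigenvalues_isometry {m c : Type*} [Fintype m] [DecidableEq m] [Fintype c]
    [DecidableEq c] {A : Matrix m m ℂ} (hA : A.IsHermitian) (U : Matrix m c ℂ) (d : c → ℝ)
    (hU : U.conjTranspose * U = 1)
    (hAU : A = U * Matrix.diagonal (fun i => (d i : ℂ)) * U.conjTranspose)
    {E : Type*} [AddCommMonoid E] (g : ℝ → E) (hg : g 0 = 0) :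
    ∑ i, g (hA.eigenvalues i) = ∑ i, g (d i) := by
  have h := Matrix.charpoly_mul_comm' U (Matrix.diagonal (fun i => (d i : ℂ)) * U.conjTranspose)
  rw [← Matrix.mul_assoc, ← hAU, Matrix.mul_assoc, hU, Matrix.mul_one,
    Matrix.charpoly_diagonal] at h
  have h2 := congrArg Polynomial.roots h
  rw [Polynomial.roots_mul (mul_ne_zero (by simp) (Matrix.charpoly_monic A).ne_zero),
    Polynomial.roots_mul (mul_ne_zero (by simp)
      (Polynomial.monic_prod_of_monic _ _ fun i _ => Polynomial.monic_X_sub_C _).ne_zero),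
    Polynomial.roots_X_pow, Polynomial.roots_X_pow, hA.roots_charpoly_eq_eigenvalues,
    Polynomial.roots_prod _ _ (Finset.prod_ne_zero_iff.2 fun i _ => Polynomial.X_sub_C_ne_zero _)]
    at h2
  have h3 := congrArg (fun s : Multiset ℂ => (s.map fun z => g z.re).sum) h2
  simpa [Multiset.map_nsmul, Multiset.sum_nsmul, hg, Multiset.bind_singleton, Multiset.map_map,
    Function.comp_def] using h3

end Spectrum

/-! ### Fidelity and measurements -/

section Fidelity

variable {a : Type*} [Fintype a] [DecidableEq a]

lemma abs_re_trace_conjTranspose_mul_le {b : Type*} [Fintype b] (X Y : Matrix a b ℂ) :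
    (X.conjTranspose * Y).trace.re ≤ √(hsSq X) * √(hsSq Y) := by
  have h1 : (X.conjTranspose * Y).trace.re ≤ ∑ p : b × a, ‖X p.2 p.1‖ * ‖Y p.2 p.1‖ := by
    rw [Fintype.sum_prod_type]
    simp only [Matrix.trace, Matrix.diag, Matrix.mul_apply, Matrix.conjTranspose_apply,
      Complex.re_sum]
    refine Finset.sum_le_sum fun i _ => Finset.sum_le_sum fun j _ => ?_
    refine (Complex.re_le_norm _).trans ?_
    simp
  refine h1.trans ((Real.sum_mul_le_sqrt_mul_sqrt _ _ _).trans (le_of_eq ?_))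
  simp only [hsSq, Fintype.sum_prod_type]
  congr 2 <;> exact Finset.sum_comm

/-- The adjoint of the partial isometry in the polar decomposition of `M`. -/
lemma exists_contraction_abs (M : Matrix a a ℂ) :
    ∃ G : Matrix a a ℂ, G.conjTranspose * M = CFC.abs M ∧ (1 - G.conjTranspose * G).PosSemidef := by
  set B := CFC.abs M with hB
  have hB0 : 0 ≤ B := CFC.abs_nonneg M
  have hBs : IsSelfAdjoint B := hB0.isSelfAdjoint
  have hBB : B * B = M.conjTranspose * M := CFC.abs_mul_abs M
  -- as `0⁻¹ = 0`, this is the pseudoinverse of `|M|`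
  set C := cfc (fun x : ℝ => x⁻¹) B with hC
  have hCs : C.conjTranspose = C := (cfc_predicate (fun x : ℝ => x⁻¹) B : IsSelfAdjoint C)
  have hcont : ∀ f : ℝ → ℝ, ContinuousOn f (spectrum ℝ B) := fun f =>
    (Matrix.finite_real_spectrum (A := B)).continuousOn f
  have hid : B = cfc (fun x : ℝ => x) B := (cfc_id' ℝ B).symm
  refine ⟨M * C, ?_, ?_⟩
  · rw [Matrix.conjTranspose_mul, hCs, Matrix.mul_assoc, ← hBB]
    rw [show C * (B * B) = cfc (fun x : ℝ => x⁻¹) B * (cfc (fun x : ℝ => x) B *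
      cfc (fun x : ℝ => x) B) by rw [← hid],
      ← cfc_mul _ _ B (hcont _) (hcont _), ← cfc_mul _ _ B (hcont _) (hcont _)]
    conv_rhs => rw [hid]
    congr 1
    funext x
    rcases eq_or_ne x 0 with rfl | hx
    · simp
    · field_simp
  · rw [Matrix.conjTranspose_mul, hCs, Matrix.mul_assoc, ← Matrix.mul_assoc M.conjTranspose,
      ← hBB, ← Matrix.nonneg_iff_posSemidef,
      show C * (B * B * C) = cfc (fun x : ℝ => x⁻¹) B * (cfc (fun x : ℝ => x) B *
        cfc (fun x : ℝ => x) B * cfc (fun x : ℝ => x⁻¹) B) by rw [← hid],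
      ← cfc_mul _ _ B (hcont _) (hcont _), ← cfc_mul _ _ B (hcont _) (hcont _),
      ← cfc_mul _ _ B (hcont _) (hcont _), ← cfc_const_one ℝ B,
      ← cfc_sub _ _ B (hcont _) (hcont _)]
    refine cfc_nonneg fun x _ => ?_
    rcases eq_or_ne x 0 with rfl | hx
    · simp
    · field_simp; simp

lemma hsSq_mul_conjTranspose_le (Y G : Matrix a a ℂ)
    (hG : (1 - G.conjTranspose * G).PosSemidef) : hsSq (Y * G.conjTranspose) ≤ hsSq Y := by
  have h : ((hsSq Y - hsSq (Y * G.conjTranspose) : ℝ) : ℂ) =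
      (Y * (1 - G.conjTranspose * G) * Y.conjTranspose).trace := by
    rw [Complex.ofReal_sub, hsSq_eq_trace, hsSq_eq_trace]
    simp only [Matrix.mul_sub, Matrix.sub_mul, Matrix.trace_sub, Matrix.conjTranspose_mul,
      Matrix.conjTranspose_conjTranspose, Matrix.mul_assoc, Matrix.mul_one]
  have h2 := (hG.mul_mul_conjTranspose_same Y).trace_nonneg
  rw [← h, Complex.zero_le_real] at h2
  linarith

/-- The fidelity does not decrease under the measurement with the outcomes `Q` and `1 - Q`. -/
lemma fidelity_le_of_projection {ρ σ Q : Matrix a a ℂ} (hρ : ρ.PosSemidef) (hσ : σ.PosSemidef)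
    (hQ : Q.conjTranspose = Q) (hQQ : Q * Q = Q) :
    fidelity ρ σ ≤ √(Q * ρ).trace.re * √(Q * σ).trace.re +
      √((1 - Q) * ρ).trace.re * √((1 - Q) * σ).trace.re := by
  obtain ⟨G, hG, hG1⟩ := exists_contraction_abs (CFC.sqrt ρ * CFC.sqrt σ)
  have hsr : ∀ {τ : Matrix a a ℂ}, (CFC.sqrt τ).conjTranspose = CFC.sqrt τ := fun {τ} =>
    (CFC.sqrt_nonneg τ).isSelfAdjoint
  have hss : ∀ {τ : Matrix a a ℂ}, τ.PosSemidef → CFC.sqrt τ * CFC.sqrt τ = τ := fun {τ} hτ =>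
    CFC.sqrt_mul_sqrt_self τ hτ.nonneg
  have key : ∀ R : Matrix a a ℂ, R.conjTranspose = R → R * R = R →
      (G.conjTranspose * (CFC.sqrt ρ * R * CFC.sqrt σ)).trace.re ≤
        √(R * ρ).trace.re * √(R * σ).trace.re := by
    intro R hR hRR
    have hs : ∀ {τ : Matrix a a ℂ}, τ.PosSemidef → hsSq (R * CFC.sqrt τ) = (R * τ).trace.re := by
      intro τ hτ
      have : (hsSq (R * CFC.sqrt τ) : ℂ) = (R * τ).trace := by
        rw [hsSq_eq_trace, Matrix.conjTranspose_mul, hsr, hR, Matrix.mul_assoc,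
          ← Matrix.mul_assoc (CFC.sqrt τ), hss hτ, ← Matrix.mul_assoc, Matrix.trace_mul_comm,
          ← Matrix.mul_assoc, hRR]
      rw [← this, Complex.ofReal_re]
    have h1 : (G.conjTranspose * (CFC.sqrt ρ * R * CFC.sqrt σ)).trace =
        ((R * CFC.sqrt ρ).conjTranspose * (R * CFC.sqrt σ * G.conjTranspose)).trace := by
      rw [Matrix.trace_mul_comm, Matrix.conjTranspose_mul, hsr, hR]
      congr 1
      nth_rewrite 1 [← hRR]
      simp only [Matrix.mul_assoc]
    rw [h1, ← hs hρ, ← hs hσ]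
    refine (abs_re_trace_conjTranspose_mul_le _ _).trans ?_
    gcongr
    exact hsSq_mul_conjTranspose_le _ _ hG1
  have hsplit : CFC.sqrt ρ * CFC.sqrt σ =
      CFC.sqrt ρ * Q * CFC.sqrt σ + CFC.sqrt ρ * (1 - Q) * CFC.sqrt σ := by
    rw [Matrix.mul_sub, Matrix.sub_mul, Matrix.mul_one]; abel
  rw [fidelity, traceNorm, ← hG, hsplit, Matrix.mul_add, Matrix.trace_add, Complex.add_re]
  refine add_le_add (key Q hQ hQQ) (key (1 - Q) ?_ ?_)
  · rw [Matrix.conjTranspose_sub, hQ, Matrix.conjTranspose_one]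
  · rw [Matrix.mul_sub, Matrix.sub_mul, Matrix.sub_mul, hQQ]; simp

/-- States within purified distance `ε` give a test `Q` similar probabilities. -/
lemma trace_le_of_purifiedDistance_le {ρ ρ' Q : Matrix a a ℂ} (hρ : ρ.PosSemidef)
    (hρ1 : ρ.trace = 1) (hρ' : IsSubnormalized ρ') (hQ : Q.conjTranspose = Q) (hQQ : Q * Q = Q)
    {ε : ℝ} (hε : purifiedDistance ρ' ρ ≤ ε) :
    (Q * ρ).trace.re ≤ ε ^ 2 + 3 * √(Q * ρ').trace.re := by
  have hnn : ∀ {R τ : Matrix a a ℂ}, R.conjTranspose = R → R * R = R → τ.PosSemidef →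
      0 ≤ (R * τ).trace.re := by
    intro R τ hR hRR hτ
    have h2 := (hτ.mul_mul_conjTranspose_same R).trace_nonneg
    rw [Matrix.trace_mul_comm, ← Matrix.mul_assoc, hR, hRR] at h2
    exact (Complex.le_def.1 h2).1
  have hQ' : (1 - Q).conjTranspose = 1 - Q := by
    rw [Matrix.conjTranspose_sub, hQ, Matrix.conjTranspose_one]
  have hQQ' : (1 - Q) * (1 - Q) = 1 - Q := by
    rw [Matrix.mul_sub, Matrix.sub_mul, Matrix.sub_mul, hQQ]; simp
  have hadd : ∀ τ : Matrix a a ℂ, (Q * τ).trace.re + ((1 - Q) * τ).trace.re = τ.trace.re := by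
    intro τ
    rw [Matrix.sub_mul, Matrix.trace_sub, Matrix.one_mul, Complex.sub_re]; ring
  have hF := fidelity_le_of_projection hρ'.1 hρ hQ hQQ
  have hx := hnn hQ hQQ hρ
  have hx' := hnn hQ' hQQ' hρ
  have hy := hnn hQ hQQ hρ'.1
  have hy' := hnn hQ' hQQ' hρ'.1
  have e1 := hadd ρ
  have e2 := hadd ρ'
  have h1 := hρ'.2
  rw [hρ1, Complex.one_re] at e1
  set x := (Q * ρ).trace.re
  set x' := ((1 - Q) * ρ).trace.re
  set y := (Q * ρ').trace.re
  set y' := ((1 - Q) * ρ').trace.re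
  have hF2 : genFidelity ρ' ρ ≤ √y + √x' := by
    rw [genFidelity, hρ1, Complex.one_re, sub_self, mul_zero, Real.sqrt_zero, add_zero]
    refine hF.trans ?_
    have a1 : √x ≤ 1 := Real.sqrt_le_one.2 (by linarith)
    have a2 : √y' ≤ 1 := Real.sqrt_le_one.2 (by linarith)
    nlinarith [Real.sqrt_nonneg y, Real.sqrt_nonneg x']
  have hF0 : 0 ≤ genFidelity ρ' ρ := by
    have : 0 ≤ (CFC.abs (CFC.sqrt ρ' * CFC.sqrt ρ)).trace :=
      (Matrix.nonneg_iff_posSemidef.1 (CFC.abs_nonneg _)).trace_nonneg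
    exact add_nonneg (Complex.le_def.1 this).1 (Real.sqrt_nonneg _)
  have hP : 1 - genFidelity ρ' ρ ^ 2 ≤ ε ^ 2 := by
    rw [purifiedDistance] at hε
    exact (Real.sqrt_le_left ((Real.sqrt_nonneg _).trans hε)).1 hε
  -- hence `x = 1 - x' ≤ ε² + y + 2 √y √x'`, where `y` and `√y √x'` are at most `√y`
  have hsq : genFidelity ρ' ρ ^ 2 ≤ (√y + √x') ^ 2 := by gcongr
  have b1 : √x' ≤ 1 := Real.sqrt_le_one.2 (by linarith)
  have b2 : √y ≤ 1 := Real.sqrt_le_one.2 (by linarith)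
  have b3 := Real.sq_sqrt hx'
  have b4 := Real.sq_sqrt hy
  have b5 : √y * √x' ≤ √y := mul_le_of_le_one_right (Real.sqrt_nonneg _) b1
  have b6 : √y ^ 2 ≤ √y := pow_le_of_le_one (Real.sqrt_nonneg _) b2 two_ne_zero
  linarith [add_sq (√y) (√x')]

end Fidelity

/-! ### Moments of complex Gaussians -/

section Gaussian

lemma deriv_mul_exp_half_sq {p p' : ℝ → ℝ} (hp : ∀ t, HasDerivAt p (p' t) t) :
    deriv (fun t : ℝ => p t * Real.exp (t ^ 2 / 2)) =
      (fun t => (p' t + p t * t) * Real.exp (t ^ 2 / 2)) := by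
  funext t
  have : HasDerivAt (fun t : ℝ => Real.exp (t ^ 2 / 2)) (Real.exp (t ^ 2 / 2) * (2 * t / 2)) t := by
    simpa using (((hasDerivAt_id t).pow 2).div_const 2).exp
  rw [show (fun t : ℝ => p t * Real.exp (t ^ 2 / 2)) = p * fun t => Real.exp (t ^ 2 / 2) from rfl,
    ((hp t).mul this).deriv]
  ring

lemma integral_pow_gaussianReal (j : ℕ) :
    ∫ x, x ^ j ∂(gaussianReal 0 1) = iteratedDeriv j (fun t : ℝ => Real.exp (t ^ 2 / 2)) 0 := by
  have h := iteratedDeriv_mgf (X := fun x : ℝ => x) (μ := gaussianReal 0 1) (t := 0)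
    (by simp [integrableExpSet_fun_id_gaussianReal]) j
  rw [mgf_fun_id_gaussianReal] at h
  simpa using h.symm

lemma integral_gaussianReal_moments :
    ∫ x, x ^ 2 ∂(gaussianReal 0 1) = 1 ∧
    ∫ x, x ^ 3 ∂(gaussianReal 0 1) = 0 ∧ ∫ x, x ^ 4 ∂(gaussianReal 0 1) = 3 := by
  have h1 := deriv_mul_exp_half_sq (p := fun _ => 1) (p' := fun _ => 0) fun t => hasDerivAt_const _ _
  have h2 := deriv_mul_exp_half_sq (p := fun t => t) (p' := fun _ => 1) fun t => hasDerivAt_id _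
  have h3 := deriv_mul_exp_half_sq (p := fun t => 1 + t * t) (p' := fun t => 2 * t) fun t => by
    have := ((hasDerivAt_id t).mul (hasDerivAt_id t)).const_add 1
    exact this.congr_deriv (by simp only [id]; ring)
  have h4 := deriv_mul_exp_half_sq (p := fun t => 2 * t + (1 + t * t) * t)
    (p' := fun t => 2 + (2 * t * t + (1 + t * t))) fun t => by
    have h := ((hasDerivAt_id t).mul (hasDerivAt_id t)).const_add 1
    have := ((hasDerivAt_id t).const_mul 2).add (h.mul (hasDerivAt_id t))
    exact this.congr_deriv (by simp only [Pi.mul_apply, id]; ring)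
  simp only [one_mul, zero_add] at h1 h2 h3 h4
  refine ⟨?_, ?_, ?_⟩ <;> rw [integral_pow_gaussianReal] <;>
    simp [iteratedDeriv_succ, h1, h2, h3, h4]
  norm_num

/-- The moment `E[conj z ^ p * z ^ q]` of a standard complex Gaussian `z`. -/
noncomputable def gaussMoment (p q : ℕ) : ℂ := ∫ z, conj z ^ p * z ^ q ∂stdComplexGaussian

lemma measurable_gaussMap : Measurable
    (fun p : ℝ × ℝ => ((p.1 : ℂ) + (p.2 : ℂ) * Complex.I) / ((√2 : ℝ) : ℂ)) := by fun_prop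

instance : IsProbabilityMeasure stdComplexGaussian :=
  Measure.isProbabilityMeasure_map measurable_gaussMap.aemeasurable

lemma integrable_pow_gaussianReal (j : ℕ) :
    Integrable (fun x : ℝ => (x : ℂ) ^ j) (gaussianReal 0 1) := by
  have h := (memLp_id_gaussianReal (μ := 0) (v := 1) j).integrable_norm_pow'
  have h2 : Integrable (fun x : ℝ => x ^ j) (gaussianReal 0 1) := by
    refine h.mono' (by fun_prop) (ae_of_all _ fun x => ?_)
    simp
  simpa using h2.ofReal (𝕜 := ℂ)

lemma integrable_conj_pow_mul_pow (p q : ℕ) :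
    Integrable (fun z : ℂ => conj z ^ p * z ^ q) stdComplexGaussian := by
  rw [stdComplexGaussian, integrable_map_measure (by fun_prop) measurable_gaussMap.aemeasurable]
  have hz : ∀ p : ℕ, MemLp (fun r : ℝ × ℝ => ((r.1 : ℂ) + (r.2 : ℂ) * Complex.I) / ((√2 : ℝ) : ℂ))
      p ((gaussianReal 0 1).prod (gaussianReal 0 1)) := by
    intro p
    have h1 : MemLp (fun x : ℝ => (x : ℂ)) p (gaussianReal 0 1) :=
      (memLp_id_gaussianReal (μ := 0) (v := 1) p).ofReal
    have h2 := (h1.comp_fst (gaussianReal 0 1)).add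
      ((h1.comp_snd (gaussianReal 0 1)).mul_const Complex.I)
    simpa [div_eq_mul_inv] using h2.mul_const (((√2 : ℝ) : ℂ)⁻¹)
  have h := (hz (p + q)).integrable_norm_pow'
  refine h.mono' (by simp only [Function.comp_def]; fun_prop) (ae_of_all _ fun x => ?_)
  rw [Function.comp_apply, norm_mul, norm_pow, norm_pow, RCLike.norm_conj, ← pow_add]

lemma gaussMoment_eq (p q : ℕ) (hp : p ≤ 2) (hq : q ≤ 2) :
    gaussMoment p q = if p = q then (p.factorial : ℂ) else 0 := by
  have hM : ∀ j, ∫ x : ℝ, (x : ℂ) ^ j ∂(gaussianReal 0 1) =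
      ((∫ x, x ^ j ∂(gaussianReal 0 1) : ℝ) : ℂ) := by
    intro j
    rw [← integral_complex_ofReal]
    simp
  obtain ⟨m2, m3, m4⟩ := integral_gaussianReal_moments
  have hexp : ∀ r : ℝ × ℝ,
      conj (((r.1 : ℂ) + (r.2 : ℂ) * Complex.I) / ((√2 : ℝ) : ℂ)) ^ p *
        (((r.1 : ℂ) + (r.2 : ℂ) * Complex.I) / ((√2 : ℝ) : ℂ)) ^ q =
      ∑ j ∈ Finset.range (p + 1), ∑ k ∈ Finset.range (q + 1),
        ((((√2 : ℝ) : ℂ)⁻¹) ^ (p + q) * ((-Complex.I) ^ (p - j) * Complex.I ^ (q - k) *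
          (p.choose j * q.choose k))) *
        ((r.1 : ℂ) ^ (j + k) * (r.2 : ℂ) ^ ((p - j) + (q - k))) := by
    intro r
    have : conj (((r.1 : ℂ) + (r.2 : ℂ) * Complex.I) / ((√2 : ℝ) : ℂ)) =
        ((r.1 : ℂ) + (r.2 : ℂ) * (-Complex.I)) * (((√2 : ℝ) : ℂ)⁻¹) := by
      simp [div_eq_mul_inv]
    rw [this, div_eq_mul_inv, mul_pow, mul_pow, add_pow, add_pow,
      mul_mul_mul_comm, Finset.sum_mul_sum, ← pow_add, Finset.sum_mul]
    refine Finset.sum_congr rfl fun j _ => ?_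
    rw [Finset.sum_mul]
    refine Finset.sum_congr rfl fun k _ => ?_
    rw [mul_pow, mul_pow, pow_add (r.1 : ℂ), pow_add (r.2 : ℂ)]
    ring
  have hs2 : ((√2 : ℝ) : ℂ) ^ 2 = 2 := by
    rw [← Complex.ofReal_pow, Real.sq_sqrt (by norm_num)]; norm_num
  have hs4 : ((√2 : ℝ) : ℂ) ^ 4 = 4 := by
    rw [show (4 : ℕ) = 2 * 2 from rfl, pow_mul, hs2]; norm_num
  rw [gaussMoment, stdComplexGaussian,
    integral_map measurable_gaussMap.aemeasurable (by fun_prop)]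
  simp_rw [hexp]
  have hint : ∀ (c : ℂ) (j k : ℕ), Integrable (fun r : ℝ × ℝ => c * ((r.1 : ℂ) ^ j * (r.2 : ℂ) ^ k))
      ((gaussianReal 0 1).prod (gaussianReal 0 1)) := fun c j k =>
    ((integrable_pow_gaussianReal j).mul_prod (integrable_pow_gaussianReal k)).const_mul c
  rw [integral_finsetSum _ fun j _ => integrable_finsetSum _ fun k _ => hint _ _ _]
  simp_rw [integral_finsetSum _ fun k _ => hint _ _ _, integral_const_mul]
  have hprod : ∀ j k : ℕ, ∫ r : ℝ × ℝ, (r.1 : ℂ) ^ j * (r.2 : ℂ) ^ k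
      ∂((gaussianReal 0 1).prod (gaussianReal 0 1)) =
      ((∫ x, x ^ j ∂(gaussianReal 0 1) : ℝ) : ℂ) * ((∫ x, x ^ k ∂(gaussianReal 0 1) : ℝ) : ℂ) := by
    intro j k
    rw [← hM, ← hM]
    exact integral_prod_mul (fun x : ℝ => (x : ℂ) ^ j) (fun x : ℝ => (x : ℂ) ^ k)
  simp_rw [hprod]
  interval_cases p <;> interval_cases q <;>
    simp [Finset.sum_range_succ, m2, m3, m4, hs2, hs4]
  all_goals norm_num 

/-- The pairing of the copies at a vertex: `E[conj z_k z_k' conj z_l z_l']` for a vector `z` of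
independent standard complex Gaussians. -/
lemma prod_gaussMoment_four {C : Type*} [Fintype C] [DecidableEq C] (k k' l l' : C) :
    ∏ c, gaussMoment ((if k = c then 1 else 0) + (if l = c then 1 else 0))
      ((if k' = c then 1 else 0) + (if l' = c then 1 else 0)) =
    (if k = k' ∧ l = l' then 1 else 0) + (if k = l' ∧ l = k' then 1 else 0) := by
  have hle : ∀ x y c : C, (if x = c then 1 else 0) + (if y = c then 1 else 0) ≤ 2 := by
    intro x y c; split_ifs <;> simp
  have hzero : ∀ c, ((if k = c then 1 else 0) + (if l = c then 1 else 0) : ℕ) ≠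
      (if k' = c then 1 else 0) + (if l' = c then 1 else 0) →
      ∏ c, gaussMoment ((if k = c then 1 else 0) + (if l = c then 1 else 0))
      ((if k' = c then 1 else 0) + (if l' = c then 1 else 0)) = 0 := by
    intro c hc
    refine Finset.prod_eq_zero (Finset.mem_univ c) ?_
    rw [gaussMoment_eq _ _ (hle _ _ _) (hle _ _ _), if_neg hc]
  have hdiag : ∀ x y : C, ∏ c, gaussMoment ((if x = c then 1 else 0) + (if y = c then 1 else 0))
      ((if x = c then 1 else 0) + (if y = c then 1 else 0)) = if x = y then 2 else 1 := by
    intro x y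
    simp_rw [gaussMoment_eq _ _ (hle x y _) (hle x y _), if_true]
    split_ifs with h
    · subst h
      rw [Finset.prod_eq_single x]
      · simp
      · intro b _ hb; simp [hb.symm]
      · simp
    · refine Finset.prod_eq_one fun c _ => ?_
      by_cases h1 : x = c
      · have h2 : y ≠ c := fun h2 => h (h1.trans h2.symm)
        simp [h1, h2]
      · by_cases h2 : y = c <;> simp [h1, h2]
  by_cases h1 : k = k' ∧ l = l'
  · obtain ⟨rfl, rfl⟩ := h1
    rw [hdiag]
    by_cases h : k = l
    · subst h; simp; norm_num
    · simp [h]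
  · by_cases h2 : k = l' ∧ l = k'
    · obtain ⟨rfl, rfl⟩ := h2
      have h : k ≠ l := fun h => h1 ⟨h, h.symm⟩
      simp_rw [add_comm (if l = _ then 1 else 0 : ℕ)]
      rw [hdiag]
      simp [h]
    · rw [if_neg h1, if_neg h2, add_zero]
      by_cases hk : k = k'
      · subst hk
        have : l ≠ l' := fun h => h1 ⟨rfl, h⟩
        exact hzero l (by simp [this.symm])
      · by_cases hl : k = l'
        · subst hl
          have : l ≠ k' := fun h => h2 ⟨rfl, h⟩
          exact hzero l (by simp [this.symm])
        · refine hzero k ?_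
          rw [if_neg (Ne.symm hk), if_neg (Ne.symm hl), if_pos rfl]
          omega

lemma prod_gaussMoment_two {C : Type*} [Fintype C] [DecidableEq C] (k k' : C) :
    ∏ c, gaussMoment (if k = c then 1 else 0) (if k' = c then 1 else 0) =
    if k = k' then 1 else 0 := by
  have hle : ∀ x c : C, (if x = c then 1 else 0) ≤ 2 := by
    intro x c; split_ifs <;> simp
  split_ifs with h
  · subst h
    refine Finset.prod_eq_one fun c _ => ?_
    rw [gaussMoment_eq _ _ (hle _ _) (hle _ _), if_pos rfl]
    split_ifs <;> simp
  · refine Finset.prod_eq_zero (Finset.mem_univ k) ?_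
    rw [gaussMoment_eq _ _ (hle _ _) (hle _ _)]
    simp [Ne.symm h]

section Network

variable {X : Type*} [Fintype X] [DecidableEq X] {C : X → Type*} [∀ x, Fintype (C x)]
  [∀ x, DecidableEq (C x)]

/-- The coefficient `∏ x, conj ψ_x(k_x)` of the product of the vectors `⟨ψ_x|`. -/
noncomputable def braCoeff (ψ : (Σ x, C x) → ℂ) (k : ∀ x, C x) : ℂ := conj (∏ x, ψ ⟨x, k x⟩)

lemma braCoeff_mul_conj_eq (ψ : (Σ x, C x) → ℂ) (k k' : ∀ x, C x) :
    braCoeff ψ k * conj (braCoeff ψ k') = ∏ p : Σ x, C x,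
      (conj (ψ p) ^ (if k p.1 = p.2 then 1 else 0) * ψ p ^ (if k' p.1 = p.2 then 1 else 0)) := by
  simp only [braCoeff, Complex.conj_conj, map_prod, Fintype.prod_sigma, Finset.prod_mul_distrib,
    pow_ite, pow_one, pow_zero, Finset.prod_ite_eq, Finset.mem_univ, if_true]

lemma integral_braCoeff_two (k k' : ∀ x, C x) :
    ∫ ψ, braCoeff ψ k * conj (braCoeff ψ k') ∂(Measure.pi fun _ : Σ x, C x => stdComplexGaussian)
      = if k = k' then 1 else 0 := by
  simp_rw [braCoeff_mul_conj_eq]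
  rw [integral_fintype_prod_eq_prod (𝕜 := ℂ) (E := fun _ : Σ x, C x => ℂ)
    (fun p z => conj z ^ (if k p.1 = p.2 then 1 else 0) * z ^ (if k' p.1 = p.2 then 1 else 0)),
    Fintype.prod_sigma]
  have := fun x => prod_gaussMoment_two (k x) (k' x)
  simp only [gaussMoment] at this
  simp_rw [this]
  rw [Fintype.prod_ite_zero]
  simp [funext_iff]

lemma integrable_braCoeff_two (k k' : ∀ x, C x) :
    Integrable (fun ψ => braCoeff ψ k * conj (braCoeff ψ k'))
      (Measure.pi fun _ : Σ x, C x => stdComplexGaussian) := by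
  simp_rw [braCoeff_mul_conj_eq]
  exact Integrable.fintype_prod (f := fun (p : Σ x, C x) (z : ℂ) =>
    conj z ^ (if k p.1 = p.2 then 1 else 0) * z ^ (if k' p.1 = p.2 then 1 else 0))
    fun p => integrable_conj_pow_mul_pow _ _

lemma braCoeff_four_eq (ψ : (Σ x, C x) → ℂ) (k k' l l' : ∀ x, C x) :
    braCoeff ψ k * conj (braCoeff ψ k') * (braCoeff ψ l * conj (braCoeff ψ l')) =
      ∏ p : Σ x, C x,
      (conj (ψ p) ^ ((if k p.1 = p.2 then 1 else 0) + (if l p.1 = p.2 then 1 else 0)) *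
        ψ p ^ ((if k' p.1 = p.2 then 1 else 0) + (if l' p.1 = p.2 then 1 else 0))) := by
  rw [braCoeff_mul_conj_eq, braCoeff_mul_conj_eq, ← Finset.prod_mul_distrib]
  refine Finset.prod_congr rfl fun p _ => ?_
  rw [pow_add, pow_add]; ring

lemma integrable_braCoeff_four (k k' l l' : ∀ x, C x) :
    Integrable (fun ψ => braCoeff ψ k * conj (braCoeff ψ k') *
      (braCoeff ψ l * conj (braCoeff ψ l')))
      (Measure.pi fun _ : Σ x, C x => stdComplexGaussian) := by
  simp_rw [braCoeff_four_eq]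
  exact Integrable.fintype_prod (f := fun (p : Σ x, C x) (z : ℂ) =>
    conj z ^ ((if k p.1 = p.2 then 1 else 0) + (if l p.1 = p.2 then 1 else 0)) *
        z ^ ((if k' p.1 = p.2 then 1 else 0) + (if l' p.1 = p.2 then 1 else 0)))
    fun p => integrable_conj_pow_mul_pow _ _

/-- Wick's formula for two copies: the expectation is the sum over the choices, at each vertex `x`,
of one of the two pairings, `Δ` being the set of the vertices with the crossed one. -/
lemma integral_braCoeff_four (k k' l l' : ∀ x, C x) :
    ∫ ψ, braCoeff ψ k * conj (braCoeff ψ k') * (braCoeff ψ l * conj (braCoeff ψ l'))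
      ∂(Measure.pi fun _ : Σ x, C x => stdComplexGaussian) =
    ∑ Δ : Finset X, if (∀ x ∈ Δ, k x = l' x ∧ l x = k' x) ∧ ∀ x ∉ Δ, k x = k' x ∧ l x = l' x
      then 1 else 0 := by
  simp_rw [braCoeff_four_eq]
  rw [integral_fintype_prod_eq_prod (𝕜 := ℂ) (E := fun _ : Σ x, C x => ℂ)
    (fun p z => conj z ^ ((if k p.1 = p.2 then 1 else 0) + (if l p.1 = p.2 then 1 else 0)) *
        z ^ ((if k' p.1 = p.2 then 1 else 0) + (if l' p.1 = p.2 then 1 else 0))),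
    Fintype.prod_sigma]
  have := fun x => prod_gaussMoment_four (k x) (k' x) (l x) (l' x)
  simp only [gaussMoment] at this
  simp_rw [this, add_comm (if k _ = k' _ ∧ _ then (1 : ℂ) else 0)]
  rw [Finset.prod_add, Finset.powerset_univ]
  refine Finset.sum_congr rfl fun Δ _ => ?_
  rw [Finset.prod_ite_zero, Finset.prod_ite_zero]
  simp only [Finset.prod_const_one, Finset.mem_sdiff, Finset.mem_univ, true_and]
  split_ifs <;> simp_all

end Network

end Gaussian

/-! ### Matrices with amplitudes attached to labels -/

section Amplitude

variable {J m n : Type*} [DecidableEq m] [DecidableEq n]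

/-- The matrix `∑ a ∈ T, c a |f a⟩⟨g a|`. -/
noncomputable def ampMatrix (T : Finset J) (c : J → ℂ) (f : J → m) (g : J → n) : Matrix m n ℂ :=
  fun i k => ∑ a ∈ T, if f a = i ∧ g a = k then c a else 0

lemma hsSq_ampMatrix [Fintype m] [Fintype n] (T : Finset J) (c : J → ℂ) (f : J → m) (g : J → n) :
    (hsSq (ampMatrix T c f g) : ℂ) =
      ∑ a ∈ T, ∑ a' ∈ T, if f a = f a' ∧ g a = g a' then c a * conj (c a') else 0 := by
  simp only [hsSq, Complex.ofReal_sum, Complex.ofReal_pow, ← Complex.mul_conj', ampMatrix, map_sum,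
    Finset.sum_mul_sum]
  rw [Finset.sum_congr rfl fun i _ => Finset.sum_comm, Finset.sum_comm]
  refine Finset.sum_congr rfl fun a _ => ?_
  rw [Finset.sum_congr rfl fun i _ => Finset.sum_comm, Finset.sum_comm]
  refine Finset.sum_congr rfl fun a' _ => ?_
  rw [Finset.sum_eq_single (f a), Finset.sum_eq_single (g a)]
  · simp only [and_self, if_true]
    by_cases h : f a = f a' ∧ g a = g a'
    · simp [h]
    · rw [if_neg h, if_neg (fun h' => h ⟨h'.1.symm, h'.2.symm⟩), map_zero, mul_zero]
  · intro k _ hk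
    rw [if_neg (fun h => hk h.2.symm), zero_mul]
  · simp
  · intro i _ hi
    exact Finset.sum_eq_zero fun k _ => by rw [if_neg (fun h => hi h.1.symm), zero_mul]
  · simp

lemma ampMatrix_mul_conjTranspose [Fintype n] (T : Finset J) (c : J → ℂ) (f : J → m) (g : J → n) :
    ampMatrix T c f g * (ampMatrix T c f g).conjTranspose =
      ampMatrix ((T ×ˢ T).filter fun p => g p.1 = g p.2) (fun p => c p.1 * conj (c p.2))
        (fun p => f p.1) (fun p => f p.2) := by
  ext i i'
  simp only [Matrix.mul_apply, Matrix.conjTranspose_apply, ampMatrix, star_sum, RCLike.star_def,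
    Finset.sum_mul_sum, Finset.sum_filter, Finset.sum_product]
  rw [Finset.sum_comm]
  refine Finset.sum_congr rfl fun a _ => ?_
  rw [Finset.sum_comm]
  refine Finset.sum_congr rfl fun a' _ => ?_
  rw [Finset.sum_eq_single (g a)]
  · by_cases h : g a = g a'
    · by_cases h1 : f a = i <;> by_cases h2 : f a' = i' <;> simp [h, h1, h2]
    · rw [if_neg h, if_neg (c := f a' = i' ∧ g a' = g a) (fun h' => h h'.2.symm), map_zero, mul_zero]
  · intro k _ hk
    rw [if_neg (fun h => hk h.2.symm), zero_mul]
  · simp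

lemma ampMatrix_add_of_disjoint {T T' : Finset J} [DecidableEq J] (h : Disjoint T T') (c : J → ℂ)
    (f : J → m) (g : J → n) :
    ampMatrix (T ∪ T') c f g = ampMatrix T c f g + ampMatrix T' c f g := by
  ext i k
  simp only [ampMatrix, Matrix.add_apply, Finset.sum_union h]

end Amplitude

/-! ### Edge labels -/

section EdgeLabels

variable {V : Type*} {G : SimpleGraph V}

/-- A label of every edge: the link states `|φ_e⟩` are diagonal, so the full state is supported on
the half-edge labels which come from such a labelling. -/
abbrev EdgeCfg (D : G.edgeSet → ℕ) : Type _ := (e : G.edgeSet) → Fin (D e)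

/-- The labels of the half-edges at the vertices of `S`. -/
def halfCfg {D : G.edgeSet → ℕ} (S : Finset V) (a : EdgeCfg D) : Cfg D S := fun h => a h.1.1.1

lemma halfCfg_eq_iff {D : G.edgeSet → ℕ} {S : Finset V} {a b : EdgeCfg D} :
    halfCfg S a = halfCfg S b ↔ ∀ x ∈ S, ∀ e : G.edgeSet, x ∈ (e : Sym2 V) → a e = b e := by
  constructor
  · intro h x hx e he
    exact congrFun h ⟨⟨(e, x), he⟩, hx⟩
  · intro h
    funext p
    exact h _ p.2 _ p.1.2

lemma exists_mem_edge (e : G.edgeSet) : ∃ x, x ∈ (e : Sym2 V) := by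
  obtain ⟨e, he⟩ := e
  induction e with
  | _ x y => exact ⟨x, Sym2.mem_mk_left x y⟩

variable [Fintype V] [DecidableEq V] [DecidableRel G.Adj]

/-- The probability of an edge label in the product of the spectra of the link states. -/
noncomputable def LinkState.weight (φ : LinkState G) (a : EdgeCfg φ.dim) : ℝ :=
  ∏ e, φ.coeff e (a e)

lemma LinkState.weight_nonneg (φ : LinkState G) (a : EdgeCfg φ.dim) : 0 ≤ φ.weight a :=
  Finset.prod_nonneg fun e _ => φ.coeff_nonneg e _

lemma LinkState.sum_weight (φ : LinkState G) : ∑ a, φ.weight a = 1 := by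
  simp only [LinkState.weight]
  rw [← Fintype.prod_sum]
  exact Finset.prod_eq_one fun e _ => φ.sum_coeff e

lemma LinkState.vector_eq_sum (φ : LinkState G) (I : Cfg φ.dim Finset.univ) :
    φ.vector I = ∑ a, if halfCfg Finset.univ a = I then ((√(φ.weight a) : ℝ) : ℂ) else 0 := by
  rw [LinkState.vector, Fintype.prod_sum]
  refine Finset.sum_congr rfl fun a _ => ?_
  by_cases h : halfCfg Finset.univ a = I
  · rw [if_pos h, LinkState.weight, Real.sqrt_prod _ fun e _ => φ.coeff_nonneg e _,
      Complex.ofReal_prod]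
    subst h
    exact Finset.prod_congr rfl fun e _ => if_pos fun x => rfl
  · rw [if_neg h]
    by_contra hne
    refine h (funext fun p => ?_)
    have := Finset.prod_ne_zero_iff.1 hne p.1.1.1 (Finset.mem_univ _)
    exact ((ite_ne_right_iff.1 this).1 ⟨p.1.1.2, p.1.2⟩).symm

lemma join_eq_halfCfg_iff {D : G.edgeSet → ℕ} {S T W : Finset V} (hW : W ⊆ S ∪ T) (hS : S ⊆ W)
    (hT : T ⊆ W) (hd : Disjoint S T) (i : Cfg D S) (j : Cfg D T) (a : EdgeCfg D) :
    halfCfg W a = Cfg.join hW i j ↔ halfCfg S a = i ∧ halfCfg T a = j := by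
  constructor
  · intro h
    constructor
    · funext p
      have := congrFun h ⟨p.1, hS p.2⟩
      simpa [Cfg.join, halfCfg, p.2] using this
    · funext p
      have := congrFun h ⟨p.1, hT p.2⟩
      have hp : p.1.1.2 ∉ S := fun h => Finset.disjoint_left.1 hd h p.2
      simpa [Cfg.join, halfCfg, hp] using this
  · rintro ⟨rfl, rfl⟩
    funext p
    simp only [Cfg.join, halfCfg]
    split_ifs <;> rfl

/-- The partial trace in terms of edge labels: if `v` is a sum over labels, its reduced density matrix
on `H_S` is the product of a matrix, whose columns belong to the labels on the traced out vertices,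
with its adjoint. -/
lemma reducedState_eq_ampMatrix {D : G.edgeSet → ℕ}
    {W S : Finset V} (hS : S ⊆ W) (v : Cfg D W → ℂ)
    (T : Finset (EdgeCfg D)) (c : EdgeCfg D → ℂ)
    (hv : ∀ I, v I = ∑ a ∈ T, if halfCfg W a = I then c a else 0) :
    reducedState v S = ampMatrix T c (halfCfg S) (halfCfg (W \ S)) *
      (ampMatrix T c (halfCfg S) (halfCfg (W \ S))).conjTranspose := by
  have : ∀ i k, v (Cfg.join (by intro x; simp; tauto) i k) =
      ampMatrix T c (halfCfg S) (halfCfg (W \ S)) i k := by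
    intro i k
    rw [hv, ampMatrix]
    refine Finset.sum_congr rfl fun a _ => if_congr ?_ rfl rfl
    exact join_eq_halfCfg_iff _ hS Finset.sdiff_subset Finset.disjoint_sdiff _ _ _
  ext i i'
  simp only [reducedState, Matrix.mul_apply, Matrix.conjTranspose_apply, this, RCLike.star_def]

/-- The random coefficient of an edge label after the projection onto the bulk tensors. -/
noncomputable def bulkCoeff {D : G.edgeSet → ℕ} (bdry : Finset V) (ψ : BulkTensors D bdry)
    (a : EdgeCfg D) : ℂ :=
  braCoeff (C := fun x : {x : V // x ∈ bdryᶜ} => Cfg D {x.1}) ψ fun x => halfCfg {x.1} a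

lemma LinkState.networkVector_eq_sum (φ : LinkState G) (bdry : Finset V)
    (ψ : BulkTensors φ.dim bdry) (i : Cfg φ.dim bdry) :
    φ.networkVector bdry ψ i = ∑ a, if halfCfg bdry a = i then
      ((√(φ.weight a) : ℝ) : ℂ) * bulkCoeff bdry ψ a else 0 := by
  simp only [LinkState.networkVector, LinkState.vector_eq_sum, Finset.mul_sum]
  rw [Finset.sum_comm]
  refine Finset.sum_congr rfl fun a _ => ?_
  simp only [join_eq_halfCfg_iff _ (Finset.subset_univ bdry) (Finset.subset_univ _)
    disjoint_compl_right]
  rw [Finset.sum_eq_single (halfCfg bdryᶜ a)]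
  · by_cases h : halfCfg bdry a = i
    · simp only [h, and_self, if_true]
      rw [mul_comm]; rfl
    · simp [h]
  · intro k _ hk
    rw [if_neg (fun h => hk h.2.symm), mul_zero]
  · simp

end EdgeLabels

/-! ### Weights of cuts and purities -/

section SecondMoments

variable {V : Type*} [Fintype V] [DecidableEq V] {G : SimpleGraph V} [DecidableRel G.Adj]

/-- The edge `e` joins `Γ` to its complement. -/
def Crosses (Γ : Finset V) (e : G.edgeSet) : Prop :=
  (∃ x ∈ (e : Sym2 V), x ∈ Γ) ∧ ∃ y ∈ (e : Sym2 V), y ∉ Γ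

open Classical in
/-- The probability of the labels which `a` gives to the edges with `p`. -/
noncomputable def LinkState.partialWeight (φ : LinkState G) (p : G.edgeSet → Prop)
    (a : EdgeCfg φ.dim) : ℝ := ∏ e, if p e then φ.coeff e (a e) else 1

/-- The eigenvalue `λ_∂Γ(a)` of the state `φ_Γ` which belongs to the labels of the edges across
the cut `Γ`. -/
noncomputable def LinkState.cutWeight (φ : LinkState G) (Γ : Finset V) (a : EdgeCfg φ.dim) : ℝ :=
  φ.partialWeight (Crosses Γ) a

variable (φ : LinkState G)

lemma LinkState.coeff_le_one (e : G.edgeSet) (i : Fin (φ.dim e)) : φ.coeff e i ≤ 1 := by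
  rw [← φ.sum_coeff e]
  exact Finset.single_le_sum (fun i _ => φ.coeff_nonneg e i) (Finset.mem_univ i)

lemma LinkState.partialWeight_nonneg (p : G.edgeSet → Prop) (a : EdgeCfg φ.dim) :
    0 ≤ φ.partialWeight p a :=
  Finset.prod_nonneg fun e _ => by split_ifs; exacts [φ.coeff_nonneg e _, zero_le_one]

lemma LinkState.partialWeight_anti {p q : G.edgeSet → Prop} (h : ∀ e, p e → q e)
    (a : EdgeCfg φ.dim) : φ.partialWeight q a ≤ φ.partialWeight p a := by
  refine Finset.prod_le_prod (fun e _ => ?_) fun e _ => ?_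
  · split_ifs; exacts [φ.coeff_nonneg e _, zero_le_one]
  · by_cases hp : p e
    · simp [hp, h e hp]
    · rw [if_neg hp]
      split_ifs; exacts [φ.coeff_le_one e _, le_rfl]

lemma LinkState.weight_le_partialWeight (p : G.edgeSet → Prop) (a : EdgeCfg φ.dim) :
    φ.weight a ≤ φ.partialWeight p a := by
  refine le_trans (le_of_eq ?_) (φ.partialWeight_anti (p := p) (q := fun _ => True) (by simp) a)
  simp [LinkState.weight, LinkState.partialWeight]

lemma LinkState.partialWeight_congr {p : G.edgeSet → Prop} {a b : EdgeCfg φ.dim}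
    (h : ∀ e, p e → a e = b e) : φ.partialWeight p a = φ.partialWeight p b := by
  refine Finset.prod_congr rfl fun e _ => ?_
  split_ifs with hp
  · rw [h e hp]
  · rfl

open Classical in
/-- Summing out the labels of the other edges leaves the probability of the labels of the edges
with `p`. -/
lemma LinkState.sum_weight_agree (p : G.edgeSet → Prop) (a : EdgeCfg φ.dim) :
    ∑ b, (if ∀ e, p e → a e = b e then φ.weight b else 0) = φ.partialWeight p a := by
  have h : ∀ b, (if ∀ e, p e → a e = b e then φ.weight b else 0) =
      ∏ e, if p e → a e = b e then φ.coeff e (b e) else 0 := by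
    intro b
    rw [Finset.prod_ite_zero]
    simp [LinkState.weight]
  rw [Finset.sum_congr rfl fun b _ => h b,
    ← Fintype.prod_sum (fun e i => if p e → a e = i then φ.coeff e i else 0)]
  refine Finset.prod_congr rfl fun e _ => ?_
  by_cases hp : p e
  · simp [hp]
  · simp [hp, φ.sum_coeff e]

/-- The labels of the two copies of the state are exchanged at the vertices of `Δ`. -/
def Swapped {D : G.edgeSet → ℕ} (Δ : Finset V) (p q : EdgeCfg D × EdgeCfg D) : Prop :=
  (∀ x ∈ Δ, ∀ e : G.edgeSet, x ∈ (e : Sym2 V) → p.1 e = q.2 e ∧ q.1 e = p.2 e) ∧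
  (∀ x ∉ Δ, ∀ e : G.edgeSet, x ∈ (e : Sym2 V) → p.1 e = p.2 e ∧ q.1 e = q.2 e)

/-- The amplitude of a term of the fourth moments. -/
noncomputable def LinkState.amp₄ (p q : EdgeCfg φ.dim × EdgeCfg φ.dim) : ℝ :=
  √(φ.weight p.1) * √(φ.weight p.2) * (√(φ.weight q.1) * √(φ.weight q.2))

open Classical in
/-- The purity of the part of `|φ⟩` supported on the labels in `T`, on the vertices of `Δ`. -/
noncomputable def LinkState.purity (T : Finset (EdgeCfg φ.dim)) (Δ : Finset V) : ℝ :=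
  ∑ p ∈ T ×ˢ T, ∑ q ∈ T ×ˢ T, if Swapped Δ p q then φ.amp₄ p q else 0

lemma Swapped.agree {D : G.edgeSet → ℕ} {Δ : Finset V} {p q : EdgeCfg D × EdgeCfg D}
    (h : Swapped Δ p q) (e : G.edgeSet) (he : Crosses Δ e) : p.1 e = q.1 e := by
  obtain ⟨⟨x, hx, hxΔ⟩, y, hy, hyΔ⟩ := he
  rw [(h.2 y hyΔ e hy).1, (h.1 x hxΔ e hx).2]

/-- The exchange of the two vectors in both factors. -/
lemma Swapped.symm {D : G.edgeSet → ℕ} {Δ : Finset V} {p q : EdgeCfg D × EdgeCfg D}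
    (h : Swapped Δ p q) : Swapped Δ p.swap q.swap :=
  ⟨fun x hx e he => ⟨(h.1 x hx e he).2.symm, (h.1 x hx e he).1.symm⟩,
    fun x hx e he => ⟨(h.2 x hx e he).1.symm, (h.2 x hx e he).2.symm⟩⟩

lemma Swapped.unique {D : G.edgeSet → ℕ} {Δ : Finset V} {a b : EdgeCfg D} {r s : EdgeCfg D × EdgeCfg D}
    (hr : Swapped Δ (a, r.1) (b, r.2)) (hs : Swapped Δ (a, s.1) (b, s.2)) : r = s := by
  refine Prod.ext (funext fun e => ?_) (funext fun e => ?_) <;>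
  · obtain ⟨x, hx⟩ := exists_mem_edge e
    by_cases hxΔ : x ∈ Δ
    · have h1 := hr.1 x hxΔ e hx
      have h2 := hs.1 x hxΔ e hx
      simp_all
    · have h1 := hr.2 x hxΔ e hx
      have h2 := hs.2 x hxΔ e hx
      simp_all

lemma sum_prod_swap {E M : Type*} [AddCommMonoid M] (T : Finset E) (f : E × E → M) :
    ∑ p ∈ T ×ˢ T, f p.swap = ∑ p ∈ T ×ˢ T, f p := by
  rw [Finset.sum_product, Finset.sum_product_right]
  rfl

open Classical in
/-- A term of the purity vanishes unless its two first labels agree across `Δ`; they then determine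
the two second labels. -/
lemma LinkState.purity_le (T : Finset (EdgeCfg φ.dim)) (Δ : Finset V) :
    φ.purity T Δ ≤ ∑ a ∈ T, φ.weight a * φ.cutWeight Δ a := by
  -- by the inequality of the means, each of the two vectors may be paired with itself
  have h1 : ∀ p q : EdgeCfg φ.dim × EdgeCfg φ.dim,
      φ.amp₄ p q ≤ (φ.weight p.1 * φ.weight q.1 + φ.weight p.2 * φ.weight q.2) / 2 := by
    intro p q
    have a1 := Real.sq_sqrt (φ.weight_nonneg p.1)
    have a2 := Real.sq_sqrt (φ.weight_nonneg p.2)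
    have b1 := Real.sq_sqrt (φ.weight_nonneg q.1)
    have b2 := Real.sq_sqrt (φ.weight_nonneg q.2)
    have := sq_nonneg (√(φ.weight p.1) * √(φ.weight q.1) - √(φ.weight p.2) * √(φ.weight q.2))
    rw [LinkState.amp₄, ← a1, ← a2, ← b1, ← b2, a1, a2, b1, b2]
    nlinarith
  set W := ∑ p ∈ T ×ˢ T, ∑ q ∈ T ×ˢ T, if Swapped Δ p q then φ.weight p.1 * φ.weight q.1 else 0
    with hW
  have h2 : φ.purity T Δ ≤ W := by
    have hW' : W = ∑ p ∈ T ×ˢ T, ∑ q ∈ T ×ˢ T,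
        if Swapped Δ p q then φ.weight p.2 * φ.weight q.2 else 0 := by
      rw [hW, ← sum_prod_swap]
      refine Finset.sum_congr rfl fun p _ => ?_
      rw [← sum_prod_swap]
      refine Finset.sum_congr rfl fun q _ => ?_
      exact if_congr ⟨fun h => h.symm, fun h => h.symm⟩ rfl rfl
    have : φ.purity T Δ ≤ (W + W) / 2 := by
      nth_rewrite 2 [hW']
      rw [hW, ← Finset.sum_add_distrib, Finset.sum_div, LinkState.purity]
      refine Finset.sum_le_sum fun p _ => ?_
      rw [← Finset.sum_add_distrib, Finset.sum_div]
      refine Finset.sum_le_sum fun q _ => ?_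
      split_ifs
      · exact h1 p q
      · simp
    linarith
  refine h2.trans ?_
  have h3 : W = ∑ a ∈ T, ∑ b ∈ T, ∑ r ∈ T ×ˢ T,
      if Swapped Δ (a, r.1) (b, r.2) then φ.weight a * φ.weight b else 0 := by
    simp only [hW, Finset.sum_product]
    refine Finset.sum_congr rfl fun a _ => ?_
    rw [Finset.sum_comm]
  rw [h3]
  refine Finset.sum_le_sum fun a _ => ?_
  rw [LinkState.cutWeight, ← φ.sum_weight_agree, Finset.mul_sum]
  refine (Finset.sum_le_sum fun b _ => (?_ : _ ≤
    φ.weight a * if ∀ e, Crosses Δ e → a e = b e then φ.weight b else 0)).trans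
    (Finset.sum_le_sum_of_subset_of_nonneg (Finset.subset_univ _) fun b _ _ => ?_)
  · rw [← Finset.sum_filter, Finset.sum_const]
    have hab := mul_nonneg (φ.weight_nonneg a) (φ.weight_nonneg b)
    rcases Finset.eq_empty_or_nonempty
      ((T ×ˢ T).filter fun r => Swapped Δ (a, r.1) (b, r.2)) with h | ⟨r, hr⟩
    · rw [h, Finset.card_empty, zero_smul]
      split_ifs
      · exact hab
      · simp
    · rw [if_pos fun e he => (Finset.mem_filter.1 hr).2.agree e he]
      have : ((T ×ˢ T).filter fun r => Swapped Δ (a, r.1) (b, r.2)).card ≤ 1 :=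
        Finset.card_le_one.2 fun r hr s hs =>
          (Finset.mem_filter.1 hr).2.unique (Finset.mem_filter.1 hs).2
      calc _ ≤ 1 • (φ.weight a * φ.weight b) := nsmul_le_nsmul_left hab this
        _ = _ := one_smul _ _
  · have := φ.weight_nonneg a
    have := φ.weight_nonneg b
    split_ifs
    · positivity
    · simp

lemma LinkState.purity_empty (T : Finset (EdgeCfg φ.dim)) :
    φ.purity T ∅ = (∑ a ∈ T, φ.weight a) ^ 2 := by
  have h : ∀ p q : EdgeCfg φ.dim × EdgeCfg φ.dim, Swapped ∅ p q ↔ p.1 = p.2 ∧ q.1 = q.2 := by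
    intro p q
    constructor
    · intro h
      constructor <;> funext e <;> obtain ⟨x, hx⟩ := exists_mem_edge e
      · exact (h.2 x (by simp) e hx).1
      · exact (h.2 x (by simp) e hx).2
    · rintro ⟨h1, h2⟩
      exact ⟨by simp, fun x _ e _ => ⟨by rw [h1], by rw [h2]⟩⟩
  have hp : ∀ f : EdgeCfg φ.dim → EdgeCfg φ.dim → ℝ,
      ∑ p ∈ T ×ˢ T, (if p.1 = p.2 then f p.1 p.2 else 0) = ∑ a ∈ T, f a a := by
    intro f
    rw [Finset.sum_product]
    refine Finset.sum_congr rfl fun a ha => ?_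
    rw [Finset.sum_ite_eq, if_pos ha]
  have hw : ∀ a, √(φ.weight a) * √(φ.weight a) = φ.weight a := fun a =>
    Real.mul_self_sqrt (φ.weight_nonneg a)
  simp only [LinkState.purity, h, ite_and, LinkState.amp₄]
  rw [Finset.sum_congr rfl fun p _ => (by
    split_ifs
    · rw [hp fun a b => √(φ.weight p.1) * √(φ.weight p.2) * (√(φ.weight a) * √(φ.weight b))]
    · simp : _ = if p.1 = p.2 then
        ∑ a ∈ T, √(φ.weight p.1) * √(φ.weight p.2) * (√(φ.weight a) * √(φ.weight a)) else 0),
    hp fun b c => ∑ a ∈ T, √(φ.weight b) * √(φ.weight c) * (√(φ.weight a) * √(φ.weight a))]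
  simp only [hw, sq, Finset.sum_mul_sum]

end SecondMoments

/-! ### Moments of the network state -/

section NetworkMoments

variable {V : Type*} [Fintype V] [DecidableEq V] {G : SimpleGraph V} [DecidableRel G.Adj]
  (φ : LinkState G)

/-- The part of the boundary state with the edge labels in `T`, as a matrix whose rows belong to `A`
and whose columns belong to `bdry \ A`. -/
noncomputable def LinkState.netMatrix (bdry A : Finset V) (T : Finset (EdgeCfg φ.dim))
    (ψ : BulkTensors φ.dim bdry) : Matrix (Cfg φ.dim A) (Cfg φ.dim (bdry \ A)) ℂ :=
  ampMatrix T (fun a => ((√(φ.weight a) : ℝ) : ℂ) * bulkCoeff bdry ψ a) (halfCfg A)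
    (halfCfg (bdry \ A))

lemma LinkState.reducedState_networkVector {bdry A : Finset V} (hA : A ⊆ bdry)
    (ψ : BulkTensors φ.dim bdry) : reducedState (φ.networkVector bdry ψ) A =
      φ.netMatrix bdry A Finset.univ ψ * (φ.netMatrix bdry A Finset.univ ψ).conjTranspose :=
  reducedState_eq_ampMatrix hA _ _ _ (φ.networkVector_eq_sum bdry ψ)

instance (D : G.edgeSet → ℕ) (bdry : Finset V) : IsProbabilityMeasure (bulkLaw D bdry) := by
  unfold bulkLaw; infer_instance

lemma integral_bulkCoeff_two {D : G.edgeSet → ℕ} (bdry : Finset V) (a a' : EdgeCfg D) :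
    ∫ ψ, bulkCoeff bdry ψ a * conj (bulkCoeff bdry ψ a') ∂(bulkLaw D bdry) =
      if (fun x : {x : V // x ∈ bdryᶜ} => halfCfg {x.1} a) =
        fun x : {x : V // x ∈ bdryᶜ} => halfCfg {x.1} a' then 1 else 0 :=
  integral_braCoeff_two _ _

lemma integrable_bulkCoeff_two {D : G.edgeSet → ℕ} (bdry : Finset V) (a a' : EdgeCfg D) :
    Integrable (fun ψ => bulkCoeff bdry ψ a * conj (bulkCoeff bdry ψ a')) (bulkLaw D bdry) :=
  integrable_braCoeff_two _ _

/-- The fourth order monomial of the bulk tensors with the labels `p` and `q`. -/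
noncomputable def bulkCoeff₄ {D : G.edgeSet → ℕ} (bdry : Finset V) (ψ : BulkTensors D bdry)
    (p q : EdgeCfg D × EdgeCfg D) : ℂ :=
  bulkCoeff bdry ψ p.1 * conj (bulkCoeff bdry ψ p.2) *
    (bulkCoeff bdry ψ q.1 * conj (bulkCoeff bdry ψ q.2))

lemma integrable_bulkCoeff₄ {D : G.edgeSet → ℕ} (bdry : Finset V)
    (p q : EdgeCfg D × EdgeCfg D) :
    Integrable (fun ψ => bulkCoeff₄ bdry ψ p q) (bulkLaw D bdry) :=
  integrable_braCoeff_four _ _ _ _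

lemma halfCfg_singleton_eq_iff {D : G.edgeSet → ℕ} {x : V} {a b : EdgeCfg D} :
    halfCfg {x} a = halfCfg {x} b ↔ ∀ e : G.edgeSet, x ∈ (e : Sym2 V) → a e = b e := by
  simp [halfCfg_eq_iff]

/-- The set of bulk vertices with the crossed pairing, together with `B`. -/
def withBulk (bdry B : Finset V) (Δ : Finset {x : V // x ∈ bdryᶜ}) : Finset V :=
  B ∪ Δ.map (Function.Embedding.subtype _)

lemma mem_withBulk_iff_of_mem {bdry B : Finset V} {Δ : Finset {x : V // x ∈ bdryᶜ}} {x : V}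
    (hx : x ∈ bdry) : x ∈ withBulk bdry B Δ ↔ x ∈ B := by
  simp [withBulk, hx]

lemma mem_withBulk_iff_of_subset {bdry B : Finset V} (hB : B ⊆ bdry)
    {Δ : Finset {x : V // x ∈ bdryᶜ}} (x : {x : V // x ∈ bdryᶜ}) :
    x.1 ∈ withBulk bdry B Δ ↔ x ∈ Δ := by
  have h : x.1 ∉ bdry := Finset.mem_compl.1 x.2
  have h2 : x.1 ∉ B := fun h2 => h (hB h2)
  rw [withBulk, Finset.mem_union, or_iff_right h2, Finset.mem_map]
  constructor
  · rintro ⟨y, hy, hxy⟩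
    rwa [← Subtype.ext (a1 := y) (a2 := x) hxy]
  · exact fun hx => ⟨x, hx, rfl⟩

/-- `if_congr` for any two decidability instances. -/
lemma ite_zero_congr {M : Type*} [Zero M] {p q : Prop} {_ : Decidable p} {_ : Decidable q}
    {x y : M} (h : p ↔ q) (hxy : x = y) : (if p then x else 0) = if q then y else 0 := by
  by_cases hp : p
  · rw [if_pos hp, if_pos (h.1 hp), hxy]
  · rw [if_neg hp, if_neg (mt h.2 hp)]

open Classical in
/-- The expectation of a fourth order expression in which the two copies are exchanged exactly at
the vertices `B` of the boundary. -/
lemma LinkState.integral_fourth_moment {bdry B : Finset V} (hB : B ⊆ bdry)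
    (T : Finset (EdgeCfg φ.dim)) (X : BulkTensors φ.dim bdry → ℝ)
    (r : EdgeCfg φ.dim × EdgeCfg φ.dim → EdgeCfg φ.dim × EdgeCfg φ.dim → Prop)
    (hr : ∀ p q, r p q ↔
      (∀ x ∈ B, halfCfg {x} p.1 = halfCfg {x} q.2 ∧ halfCfg {x} q.1 = halfCfg {x} p.2) ∧
      ∀ x ∈ bdry \ B, halfCfg {x} p.1 = halfCfg {x} p.2 ∧ halfCfg {x} q.1 = halfCfg {x} q.2)
    (hX : ∀ ψ, (X ψ : ℂ) = ∑ p ∈ T ×ˢ T, ∑ q ∈ T ×ˢ T,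
      if r p q then (φ.amp₄ p q : ℂ) * bulkCoeff₄ bdry ψ p q else 0) :
    Integrable X (bulkLaw φ.dim bdry) ∧
      ∫ ψ, X ψ ∂(bulkLaw φ.dim bdry) = ∑ Δ, φ.purity T (withBulk bdry B Δ) := by
  have hint : ∀ p q, Integrable (fun ψ => if r p q then
      (φ.amp₄ p q : ℂ) * bulkCoeff₄ bdry ψ p q else 0) (bulkLaw φ.dim bdry) := by
    intro p q
    split_ifs
    · exact (integrable_bulkCoeff₄ bdry p q).const_mul _
    · exact integrable_zero _ _ _
  have hint' : Integrable (fun ψ => (X ψ : ℂ)) (bulkLaw φ.dim bdry) := by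
    simp_rw [hX]
    exact integrable_finsetSum _ fun p _ => integrable_finsetSum _ fun q _ => hint p q
  refine ⟨by simpa using hint'.re, ?_⟩
  apply Complex.ofReal_injective
  rw [← integral_complex_ofReal]
  simp_rw [hX]
  rw [integral_finsetSum _ fun p _ => integrable_finsetSum _ fun q _ => hint p q]
  simp_rw [integral_finsetSum _ fun q _ => hint _ q]
  have key : ∀ p q, ∫ ψ, (if r p q then (φ.amp₄ p q : ℂ) * bulkCoeff₄ bdry ψ p q else 0)
      ∂(bulkLaw φ.dim bdry) =
      ∑ Δ, if Swapped (withBulk bdry B Δ) p q then (φ.amp₄ p q : ℂ) else 0 := by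
    intro p q
    have hbulk := integral_braCoeff_four (C := fun x : {x : V // x ∈ bdryᶜ} => Cfg φ.dim {x.1})
      (fun x => halfCfg {x.1} p.1) (fun x => halfCfg {x.1} p.2)
      (fun x => halfCfg {x.1} q.1) (fun x => halfCfg {x.1} q.2)
    have hiff : ∀ Δ, Swapped (withBulk bdry B Δ) p q ↔ r p q ∧
        ((∀ x ∈ Δ, halfCfg {x.1} p.1 = halfCfg {x.1} q.2 ∧ halfCfg {x.1} q.1 = halfCfg {x.1} p.2) ∧
        ∀ x ∉ Δ, halfCfg {x.1} p.1 = halfCfg {x.1} p.2 ∧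
          halfCfg {x.1} q.1 = halfCfg {x.1} q.2) := by
      intro Δ
      have hS : Swapped (withBulk bdry B Δ) p q ↔ (∀ x ∈ withBulk bdry B Δ,
          halfCfg {x} p.1 = halfCfg {x} q.2 ∧ halfCfg {x} q.1 = halfCfg {x} p.2) ∧
          ∀ x ∉ withBulk bdry B Δ,
          halfCfg {x} p.1 = halfCfg {x} p.2 ∧ halfCfg {x} q.1 = halfCfg {x} q.2 := by
        simp only [Swapped, halfCfg_singleton_eq_iff, forall_and]
      rw [hS, hr]
      constructor
      · rintro ⟨h1, h2⟩
        refine ⟨⟨fun x hx => h1 x ((mem_withBulk_iff_of_mem (hB hx)).2 hx), fun x hx => h2 x ?_⟩,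
          fun x hx => h1 x ((mem_withBulk_iff_of_subset hB x).2 hx),
          fun x hx => h2 x (mt (mem_withBulk_iff_of_subset hB x).1 hx)⟩
        rw [Finset.mem_sdiff] at hx
        exact mt (mem_withBulk_iff_of_mem hx.1).1 hx.2
      · rintro ⟨⟨h1, h2⟩, h3, h4⟩
        constructor
        · intro x hx
          by_cases hb : x ∈ bdry
          · exact h1 x ((mem_withBulk_iff_of_mem hb).1 hx)
          · exact h3 ⟨x, Finset.mem_compl.2 hb⟩ ((mem_withBulk_iff_of_subset hB _).1 hx)
        · intro x hx
          by_cases hb : x ∈ bdry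
          · exact h2 x (Finset.mem_sdiff.2 ⟨hb, mt (mem_withBulk_iff_of_mem hb).2 hx⟩)
          · exact h4 ⟨x, Finset.mem_compl.2 hb⟩ (mt (mem_withBulk_iff_of_subset hB _).2 hx)
    simp_rw [hiff]
    by_cases h : r p q
    · simp only [h, if_true, true_and]
      rw [integral_const_mul]
      refine (congrArg _ hbulk).trans ?_
      rw [Finset.mul_sum]
      refine Finset.sum_congr rfl fun Δ _ => ?_
      rw [mul_ite, mul_one, mul_zero]
      congr
    · simp [h]
  simp_rw [key]
  simp only [LinkState.purity, Complex.ofReal_sum]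
  rw [Finset.sum_congr rfl fun p _ => Finset.sum_comm, Finset.sum_comm]
  refine Finset.sum_congr rfl fun Δ _ => Finset.sum_congr rfl fun p _ =>
    Finset.sum_congr rfl fun q _ => ?_
  split_ifs <;> simp

lemma halfCfg_eq_iff_singleton {D : G.edgeSet → ℕ} {S : Finset V} {a b : EdgeCfg D} :
    halfCfg S a = halfCfg S b ↔ ∀ x ∈ S, halfCfg {x} a = halfCfg {x} b := by
  simp only [halfCfg_eq_iff, Finset.mem_singleton, forall_eq]

lemma LinkState.hsSq_netMatrix (bdry A : Finset V) (T : Finset (EdgeCfg φ.dim))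
    (ψ : BulkTensors φ.dim bdry) : (hsSq (φ.netMatrix bdry A T ψ) : ℂ) =
      ∑ p ∈ T ×ˢ T, if halfCfg A p.1 = halfCfg A p.2 ∧
        halfCfg (bdry \ A) p.1 = halfCfg (bdry \ A) p.2
      then ((√(φ.weight p.1) * √(φ.weight p.2) : ℝ) : ℂ) *
        (bulkCoeff bdry ψ p.1 * conj (bulkCoeff bdry ψ p.2)) else 0 := by
  rw [LinkState.netMatrix, hsSq_ampMatrix, Finset.sum_product]
  refine Finset.sum_congr rfl fun a _ => Finset.sum_congr rfl fun a' _ => ?_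
  refine if_congr Iff.rfl ?_ rfl
  rw [map_mul, Complex.conj_ofReal]
  push_cast; ring

lemma forall_bdry_iff {bdry A : Finset V} (hA : A ⊆ bdry) {P : V → Prop} :
    (∀ x ∈ bdry, P x) ↔ (∀ x ∈ A, P x) ∧ ∀ x ∈ bdry \ A, P x := by
  constructor
  · exact fun h => ⟨fun x hx => h x (hA hx), fun x hx => h x (Finset.sdiff_subset hx)⟩
  · rintro ⟨h1, h2⟩ x hx
    by_cases hxA : x ∈ A
    · exact h1 x hxA
    · exact h2 x (Finset.mem_sdiff.2 ⟨hx, hxA⟩)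

lemma LinkState.integral_hsSq_netMatrix {bdry A : Finset V} (hA : A ⊆ bdry)
    (T : Finset (EdgeCfg φ.dim)) :
    Integrable (fun ψ => hsSq (φ.netMatrix bdry A T ψ)) (bulkLaw φ.dim bdry) ∧
    ∫ ψ, hsSq (φ.netMatrix bdry A T ψ) ∂(bulkLaw φ.dim bdry) = ∑ a ∈ T, φ.weight a := by
  have hint : ∀ p : EdgeCfg φ.dim × EdgeCfg φ.dim, Integrable
      (fun ψ => if halfCfg A p.1 = halfCfg A p.2 ∧
        halfCfg (bdry \ A) p.1 = halfCfg (bdry \ A) p.2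
      then ((√(φ.weight p.1) * √(φ.weight p.2) : ℝ) : ℂ) *
        (bulkCoeff bdry ψ p.1 * conj (bulkCoeff bdry ψ p.2)) else 0) (bulkLaw φ.dim bdry) := by
    intro p
    split_ifs
    · exact (integrable_bulkCoeff_two bdry _ _).const_mul _
    · exact integrable_zero _ _ _
  have hint' : Integrable (fun ψ => (hsSq (φ.netMatrix bdry A T ψ) : ℂ)) (bulkLaw φ.dim bdry) := by
    simp_rw [φ.hsSq_netMatrix]
    exact integrable_finsetSum _ fun p _ => hint p
  refine ⟨by simpa using hint'.re, ?_⟩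
  apply Complex.ofReal_injective
  rw [← integral_complex_ofReal]
  simp_rw [φ.hsSq_netMatrix]
  rw [integral_finsetSum _ fun p _ => hint p, Complex.ofReal_sum, Finset.sum_product]
  refine Finset.sum_congr rfl fun a ha => ?_
  rw [Finset.sum_eq_single a]
  · simp only [and_self, if_true]
    rw [integral_const_mul, integral_bulkCoeff_two, if_pos rfl, mul_one,
      Real.mul_self_sqrt (φ.weight_nonneg a)]
  · intro b _ hb
    split_ifs with h
    · rw [integral_const_mul, integral_bulkCoeff_two, if_neg, mul_zero]
      intro h'
      refine hb (funext fun e => ?_)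
      obtain ⟨x, hx⟩ := exists_mem_edge e
      rw [halfCfg_eq_iff_singleton, halfCfg_eq_iff_singleton, ← forall_bdry_iff hA] at h
      by_cases hxb : x ∈ bdry
      · exact (halfCfg_singleton_eq_iff.1 (h x hxb) e hx).symm
      · exact (halfCfg_singleton_eq_iff.1 (congrFun h' ⟨x, Finset.mem_compl.2 hxb⟩) e hx).symm
    · simp
  · exact fun h => absurd ha h

lemma LinkState.integral_hsSq_netMatrix_sq {bdry A : Finset V} (hA : A ⊆ bdry)
    (T : Finset (EdgeCfg φ.dim)) :
    Integrable (fun ψ => hsSq (φ.netMatrix bdry A T ψ) ^ 2) (bulkLaw φ.dim bdry) ∧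
    ∫ ψ, hsSq (φ.netMatrix bdry A T ψ) ^ 2 ∂(bulkLaw φ.dim bdry) =
      ∑ Δ, φ.purity T (withBulk bdry ∅ Δ) := by
  refine φ.integral_fourth_moment (Finset.empty_subset _) T _
    (fun p q => (halfCfg A p.1 = halfCfg A p.2 ∧ halfCfg (bdry \ A) p.1 = halfCfg (bdry \ A) p.2) ∧
      (halfCfg A q.1 = halfCfg A q.2 ∧ halfCfg (bdry \ A) q.1 = halfCfg (bdry \ A) q.2)) ?_ ?_
  · intro p q
    rw [halfCfg_eq_iff_singleton (S := A), halfCfg_eq_iff_singleton (S := bdry \ A),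
      ← forall_bdry_iff hA, halfCfg_eq_iff_singleton (S := A),
      halfCfg_eq_iff_singleton (S := bdry \ A), ← forall_bdry_iff hA]
    simp [forall_and]
  · intro ψ
    rw [Complex.ofReal_pow, φ.hsSq_netMatrix, sq, Finset.sum_mul_sum]
    refine Finset.sum_congr rfl fun p _ => Finset.sum_congr rfl fun q _ => ?_
    rw [ite_zero_mul_ite_zero]
    refine ite_zero_congr Iff.rfl ?_
    rw [LinkState.amp₄, bulkCoeff₄]
    push_cast; ring

lemma LinkState.integral_hsSq_netMatrix_mul_conjTranspose {bdry A : Finset V} (hA : A ⊆ bdry)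
    (T : Finset (EdgeCfg φ.dim)) :
    Integrable (fun ψ => hsSq (φ.netMatrix bdry A T ψ * (φ.netMatrix bdry A T ψ).conjTranspose))
      (bulkLaw φ.dim bdry) ∧
    ∫ ψ, hsSq (φ.netMatrix bdry A T ψ * (φ.netMatrix bdry A T ψ).conjTranspose)
      ∂(bulkLaw φ.dim bdry) = ∑ Δ, φ.purity T (withBulk bdry A Δ) := by
  refine φ.integral_fourth_moment hA T _
    (fun p q => halfCfg (bdry \ A) p.1 = halfCfg (bdry \ A) p.2 ∧
      halfCfg (bdry \ A) q.1 = halfCfg (bdry \ A) q.2 ∧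
      (halfCfg A p.1 = halfCfg A q.2 ∧ halfCfg A p.2 = halfCfg A q.1)) ?_ ?_
  · intro p q
    simp only [halfCfg_eq_iff_singleton (S := A), halfCfg_eq_iff_singleton (S := bdry \ A),
      forall_and]
    constructor
    · rintro ⟨h1, h2, h3, h4⟩
      exact ⟨⟨h3, fun x hx => (h4 x hx).symm⟩, h1, h2⟩
    · rintro ⟨⟨h3, h4⟩, h1, h2⟩
      exact ⟨h1, h2, h3, fun x hx => (h4 x hx).symm⟩
  · intro ψ
    rw [LinkState.netMatrix, ampMatrix_mul_conjTranspose, hsSq_ampMatrix, Finset.sum_filter]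
    refine Finset.sum_congr rfl fun p _ => ?_
    rw [Finset.sum_filter, ← sum_prod_swap]
    by_cases hp : halfCfg (bdry \ A) p.1 = halfCfg (bdry \ A) p.2
    · rw [if_pos hp]
      refine Finset.sum_congr rfl fun q _ => ?_
      rw [← ite_and]
      refine ite_zero_congr ?_ ?_
      · simp only [hp, true_and, Prod.fst_swap, Prod.snd_swap, eq_comm (a := halfCfg (bdry \ A) q.2)]
      · simp only [LinkState.amp₄, bulkCoeff₄, map_mul, Complex.conj_conj, Complex.conj_ofReal,
          Prod.fst_swap, Prod.snd_swap]
        push_cast; ring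
    · simp [hp]

end NetworkMoments

/-! ### Submodularity of cut weights -/

section CutWeights

variable {V : Type*} [Fintype V] [DecidableEq V] {G : SimpleGraph V} [DecidableRel G.Adj]
  (φ : LinkState G)

lemma crosses_mk {Γ : Finset V} {x y : V} (h : s(x, y) ∈ G.edgeSet) :
    Crosses Γ ⟨s(x, y), h⟩ ↔ (x ∈ Γ ∧ y ∉ Γ) ∨ (y ∈ Γ ∧ x ∉ Γ) := by
  simp only [Crosses, Sym2.mem_iff, exists_eq_or_imp, exists_eq_left]
  tauto

/-- The comparison is made edge by edge, as every factor is at most one. -/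
lemma LinkState.partialWeight_mul_le {p q r s : G.edgeSet → Prop}
    (h1 : ∀ e, r e → p e ∨ q e) (h2 : ∀ e, s e → p e ∨ q e) (h3 : ∀ e, r e → s e → p e ∧ q e)
    (a : EdgeCfg φ.dim) :
    φ.partialWeight p a * φ.partialWeight q a ≤ φ.partialWeight r a * φ.partialWeight s a := by
  simp only [LinkState.partialWeight, ← Finset.prod_mul_distrib]
  have h0 := fun e => φ.coeff_nonneg e (a e)
  refine Finset.prod_le_prod (fun e _ => ?_) fun e _ => ?_
  · have := h0 e
    split_ifs <;> positivity
  · replace h0 := h0 e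
    have hc := φ.coeff_le_one e (a e)
    replace h1 := h1 e
    replace h2 := h2 e
    replace h3 := h3 e
    generalize φ.coeff e (a e) = c at *
    have hcc : c * c ≤ c := mul_le_of_le_one_left h0 hc
    have hc1 : c * c ≤ 1 := hcc.trans hc
    by_cases hp : p e <;> by_cases hq : q e <;> by_cases hr : r e <;> by_cases hs : s e <;>
      simp [hp, hq, hr, hs] at h1 h2 h3 ⊢ <;> assumption

/-- Submodularity of the entropy of cuts, for every label. -/
lemma LinkState.cutWeight_mul_le_inter_union (X Y : Finset V) (a : EdgeCfg φ.dim) :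
    φ.cutWeight X a * φ.cutWeight Y a ≤ φ.cutWeight (X ∩ Y) a * φ.cutWeight (X ∪ Y) a := by
  refine φ.partialWeight_mul_le ?_ ?_ ?_ a <;> rintro ⟨e, he⟩ <;> induction e with
  | _ x y =>
    simp only [crosses_mk, Finset.mem_inter, Finset.mem_union]
    by_cases h1 : x ∈ X <;> by_cases h2 : y ∈ X <;> by_cases h3 : x ∈ Y <;>
      by_cases h4 : y ∈ Y <;> simp [h1, h2, h3, h4]

lemma LinkState.cutWeight_mul_le_sdiff (X Y : Finset V) (a : EdgeCfg φ.dim) :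
    φ.cutWeight X a * φ.cutWeight Y a ≤ φ.cutWeight (X \ Y) a * φ.cutWeight (Y \ X) a := by
  refine φ.partialWeight_mul_le ?_ ?_ ?_ a <;> rintro ⟨e, he⟩ <;> induction e with
  | _ x y =>
    simp only [crosses_mk, Finset.mem_sdiff]
    by_cases h1 : x ∈ X <;> by_cases h2 : y ∈ X <;> by_cases h3 : x ∈ Y <;>
      by_cases h4 : y ∈ Y <;> simp [h1, h2, h3, h4]

lemma LinkState.cutWeight_le_one (X : Finset V) (a : EdgeCfg φ.dim) : φ.cutWeight X a ≤ 1 := by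
  refine (φ.partialWeight_anti (p := fun _ => False) (by simp) a).trans (le_of_eq ?_)
  simp [LinkState.partialWeight]

lemma LinkState.cutWeight_nonneg (X : Finset V) (a : EdgeCfg φ.dim) : 0 ≤ φ.cutWeight X a :=
  φ.partialWeight_nonneg _ a

lemma LinkState.cutWeight_pos (X : Finset V) {a : EdgeCfg φ.dim} (ha : 0 < φ.weight a) :
    0 < φ.cutWeight X a := ha.trans_le (φ.weight_le_partialWeight _ a)

/-- The labels for which every competing cut has a weight smaller by the factor `θ` than the
minimal cut it is compared to. -/
structure LinkState.IsGood (bdry A Γ₁ Γ₂ : Finset V) (θ : ℝ) (a : EdgeCfg φ.dim) : Prop where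
  below : ∀ Δ, IsCut bdry A Δ → Δ ⊂ Γ₁ → φ.cutWeight Δ a ≤ θ * φ.cutWeight Γ₁ a
  above : ∀ Δ, IsCut bdry A Δ → Γ₂ ⊂ Δ → φ.cutWeight Δ a ≤ θ * φ.cutWeight Γ₂ a
  between : ∀ Δ, IsCut bdry A Δ → Γ₁ ⊂ Δ → Δ ⊂ Γ₂ → φ.cutWeight Δ a ≤ θ * φ.cutWeight Γ₁ a

variable {φ} {bdry A Γ₁ Γ₂ : Finset V}

/-- Uncrossing with `Γ₁` and then with `Γ₂`. -/
lemma LinkState.IsGood.cutWeight_le_max (hΓ₁ : IsCut bdry A Γ₁) (hΓ₂ : IsCut bdry A Γ₂)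
    (hΓ : Γ₁ ⊂ Γ₂) {θ : ℝ} (hθ : θ ≤ 1) {a : EdgeCfg φ.dim} (ha : φ.IsGood bdry A Γ₁ Γ₂ θ a)
    (hw : 0 < φ.weight a) {Δ : Finset V} (hΔ : IsCut bdry A Δ) :
    φ.cutWeight Δ a ≤ max (φ.cutWeight Γ₁ a) (φ.cutWeight Γ₂ a) := by
  have hθ' : ∀ {x : ℝ}, 0 ≤ x → θ * x ≤ x := fun hx => mul_le_of_le_one_left hx hθ
  unfold IsCut at hΓ₁ hΓ₂ hΔ
  have p1 := φ.cutWeight_pos Γ₁ hw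
  have p2 := φ.cutWeight_pos Γ₂ hw
  have s1 : φ.cutWeight Δ a ≤ φ.cutWeight (Δ ∪ Γ₁) a := by
    have h := φ.cutWeight_mul_le_inter_union Δ Γ₁ a
    have h2 : φ.cutWeight (Δ ∩ Γ₁) a ≤ φ.cutWeight Γ₁ a := by
      rcases (Finset.inter_subset_right (s₁ := Δ) (s₂ := Γ₁)).eq_or_ssubset with h3 | h3
      · rw [h3]
      · refine (ha.below _ ?_ h3).trans (hθ' p1.le)
        rw [IsCut, Finset.inter_right_comm, hΔ, ← hΓ₁]
        ext x; simp; tauto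
    refine le_of_mul_le_mul_right (h.trans ?_) p1
    rw [mul_comm]
    exact mul_le_mul_of_nonneg_left h2 (φ.cutWeight_nonneg _ a)
  have hcut : (Δ ∪ Γ₁) ∩ bdry = A := by
    rw [Finset.union_inter_distrib_right, hΔ, hΓ₁, Finset.union_self]
  have s2 : φ.cutWeight (Δ ∪ Γ₁) a ≤ φ.cutWeight ((Δ ∪ Γ₁) ∩ Γ₂) a := by
    have h := φ.cutWeight_mul_le_inter_union (Δ ∪ Γ₁) Γ₂ a
    have h2 : φ.cutWeight ((Δ ∪ Γ₁) ∪ Γ₂) a ≤ φ.cutWeight Γ₂ a := by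
      rcases (Finset.subset_union_right (s₁ := Δ ∪ Γ₁) (s₂ := Γ₂)).eq_or_ssubset with h3 | h3
      · rw [← h3]
      · refine (ha.above _ ?_ h3).trans (hθ' p2.le)
        rw [IsCut, Finset.union_inter_distrib_right, hcut, hΓ₂, Finset.union_self]
    refine le_of_mul_le_mul_right (h.trans ?_) p2
    exact mul_le_mul_of_nonneg_left h2 (φ.cutWeight_nonneg _ a)
  refine s1.trans (s2.trans ?_)
  have hcut2 : IsCut bdry A ((Δ ∪ Γ₁) ∩ Γ₂) := by
    rw [IsCut, Finset.inter_right_comm, hcut, ← hΓ₂]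
    ext x; simp; tauto
  rcases (Finset.inter_subset_right (s₁ := Δ ∪ Γ₁) (s₂ := Γ₂)).eq_or_ssubset with h3 | h3
  · rw [h3]; exact le_max_right _ _
  · have hsub : Γ₁ ⊆ (Δ ∪ Γ₁) ∩ Γ₂ := Finset.subset_inter Finset.subset_union_right hΓ.1
    rcases hsub.eq_or_ssubset with h4 | h4
    · rw [← h4]; exact le_max_left _ _
    · exact ((ha.between _ hcut2 h4 h3).trans (hθ' p1.le)).trans (le_max_left _ _)

/-- The edges across both sides of the middle region are disjoint, so those across one side are
across its boundary. -/
lemma LinkState.cutWeight_sdiff_le (hΓ : Γ₁ ⊂ Γ₂)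
    (hdisj : Disjoint (cutEdges G Γ₁) (cutEdges G Γ₂)) (a : EdgeCfg φ.dim) :
    φ.cutWeight (Γ₂ \ Γ₁) a ≤ φ.cutWeight Γ₁ a := by
  refine φ.partialWeight_anti ?_ a
  rintro ⟨e, he⟩ hc
  have hd : ¬ Crosses Γ₂ ⟨e, he⟩ := fun h2 =>
    Set.disjoint_left.1 hdisj (show e ∈ cutEdges G Γ₁ from ⟨he, hc⟩) ⟨he, h2⟩
  induction e with
  | _ x y =>
    rw [crosses_mk] at hc hd ⊢
    have hx : x ∈ Γ₁ → x ∈ Γ₂ := fun h => hΓ.1 h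
    have hy : y ∈ Γ₁ → y ∈ Γ₂ := fun h => hΓ.1 h
    simp only [Finset.mem_sdiff]
    tauto

/-- A set `Δ` of bulk vertices is uncrossed with `Γ₁` or with `Γ₂`, which gives a competing cut unless
`Δ` is the region between the two cuts. In that case the edges across `Γ₁` are across `Δ`. -/
lemma LinkState.IsGood.cutWeight_le_add (hΓ₁ : IsCut bdry A Γ₁) (hΓ₂ : IsCut bdry A Γ₂)
    (hΓ : Γ₁ ⊂ Γ₂) (hdisj : Disjoint (cutEdges G Γ₁) (cutEdges G Γ₂)) {θ : ℝ} (hθ : 0 ≤ θ)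
    {a : EdgeCfg φ.dim} (ha : φ.IsGood bdry A Γ₁ Γ₂ θ a) (hw : 0 < φ.weight a) {Δ : Finset V}
    (hΔ : Disjoint Δ bdry) (hne : Δ.Nonempty) : φ.cutWeight Δ a ≤ θ + φ.cutWeight Γ₁ a := by
  unfold IsCut at hΓ₁ hΓ₂
  have p1 := φ.cutWeight_pos Γ₁ hw
  have p2 := φ.cutWeight_pos Γ₂ hw
  rw [Finset.disjoint_iff_inter_eq_empty] at hΔ
  by_cases h1 : (Γ₁ ∩ Δ).Nonempty
  · refine le_add_of_le_of_nonneg (le_of_mul_le_mul_right ?_ p1) p1.le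
    obtain ⟨x, hx⟩ := h1
    rw [Finset.mem_inter] at hx
    have hss : Γ₁ \ Δ ⊂ Γ₁ := ⟨Finset.sdiff_subset, fun h =>
      (Finset.mem_sdiff.1 (h hx.1)).2 hx.2⟩
    refine (φ.cutWeight_mul_le_sdiff Δ Γ₁ a).trans ?_
    refine (mul_le_of_le_one_left (φ.cutWeight_nonneg _ a) (φ.cutWeight_le_one _ a)).trans
      (ha.below _ ?_ hss)
    rw [IsCut, ← hΓ₁]
    ext x
    have := Finset.ext_iff.1 hΔ x
    simp at this ⊢; tauto
  by_cases h2 : (Δ \ Γ₂).Nonempty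
  · refine le_add_of_le_of_nonneg (le_of_mul_le_mul_right ?_ p2) p1.le
    obtain ⟨x, hx⟩ := h2
    rw [Finset.mem_sdiff] at hx
    have hss : Γ₂ ⊂ Δ ∪ Γ₂ := ⟨Finset.subset_union_right, fun h =>
      hx.2 (h (Finset.mem_union_left _ hx.1))⟩
    refine (φ.cutWeight_mul_le_inter_union Δ Γ₂ a).trans ?_
    refine (mul_le_of_le_one_left (φ.cutWeight_nonneg _ a) (φ.cutWeight_le_one _ a)).trans
      (ha.above _ ?_ hss)
    rw [IsCut, Finset.union_inter_distrib_right, hΔ, Finset.empty_union, hΓ₂]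
  rw [Finset.not_nonempty_iff_eq_empty] at h1 h2
  rw [Finset.sdiff_eq_empty_iff_subset] at h2
  have hsub : Δ ∪ Γ₁ ⊆ Γ₂ := Finset.union_subset h2 hΓ.1
  rcases hsub.eq_or_ssubset with h3 | h3
  · have : Δ = Γ₂ \ Γ₁ := by
      rw [← h3]
      ext x
      have := Finset.ext_iff.1 h1 x
      simp at this ⊢; tauto
    rw [this]
    exact (LinkState.cutWeight_sdiff_le hΓ hdisj a).trans (le_add_of_nonneg_left hθ)
  · refine le_add_of_le_of_nonneg (le_of_mul_le_mul_right ?_ p1) p1.le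
    obtain ⟨x, hx⟩ := hne
    have hss : Γ₁ ⊂ Δ ∪ Γ₁ := ⟨Finset.subset_union_right, fun h => by
      have h4 := Finset.mem_inter.2 ⟨h (Finset.mem_union_left _ hx), hx⟩
      rw [h1] at h4
      exact Finset.notMem_empty x h4⟩
    refine (φ.cutWeight_mul_le_inter_union Δ Γ₁ a).trans ?_
    refine (mul_le_of_le_one_left (φ.cutWeight_nonneg _ a) (φ.cutWeight_le_one _ a)).trans
      (ha.between _ ?_ hss h3)
    rw [IsCut, Finset.union_inter_distrib_right, hΔ, Finset.empty_union, hΓ₁]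

lemma LinkState.sum_weight_le_one (T : Finset (EdgeCfg φ.dim)) : ∑ a ∈ T, φ.weight a ≤ 1 := by
  rw [← φ.sum_weight]
  exact Finset.sum_le_sum_of_subset_of_nonneg (Finset.subset_univ _) fun a _ _ => φ.weight_nonneg a

lemma LinkState.sum_weight_mul_le {T : Finset (EdgeCfg φ.dim)} {f : EdgeCfg φ.dim → ℝ} {t : ℝ}
    (ht : 0 ≤ t) (h : ∀ a ∈ T, 0 < φ.weight a → f a ≤ t) : ∑ a ∈ T, φ.weight a * f a ≤ t := by
  calc ∑ a ∈ T, φ.weight a * f a ≤ ∑ a ∈ T, φ.weight a * t := by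
        refine Finset.sum_le_sum fun a ha => ?_
        rcases (φ.weight_nonneg a).eq_or_lt with h0 | h0
        · simp [← h0]
        · exact mul_le_mul_of_nonneg_left (h a ha h0) h0.le
    _ = (∑ a ∈ T, φ.weight a) * t := (Finset.sum_mul ..).symm
    _ ≤ 1 * t := mul_le_mul_of_nonneg_right (φ.sum_weight_le_one T) ht
    _ = t := one_mul t

lemma withBulk_isCut {bdry A : Finset V} (hA : A ⊆ bdry) (Δ : Finset {x : V // x ∈ bdryᶜ}) :
    IsCut bdry A (withBulk bdry A Δ) := by
  rw [IsCut]
  ext x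
  rw [Finset.mem_inter]
  constructor
  · rintro ⟨h1, h2⟩
    exact (mem_withBulk_iff_of_mem h2).1 h1
  · exact fun h => ⟨(mem_withBulk_iff_of_mem (hA h)).2 h, hA h⟩

/-- The number of ways to pair the two copies at the bulk vertices. -/
def numPairings (bdry : Finset V) : ℕ := Fintype.card (Finset {x : V // x ∈ bdryᶜ})

/-- The boundary vertices in `A` are exchanged, so only cuts for `A` contribute, each at most `t`. -/
lemma LinkState.integral_purity_netMatrix_le (hΓ₁ : IsCut bdry A Γ₁) (hΓ₂ : IsCut bdry A Γ₂)
    (hΓ : Γ₁ ⊂ Γ₂) {θ t : ℝ} (hθ : θ ≤ 1) (ht : 0 ≤ t) {T : Finset (EdgeCfg φ.dim)}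
    (hT : ∀ a ∈ T, φ.IsGood bdry A Γ₁ Γ₂ θ a)
    (hTt : ∀ a ∈ T, φ.cutWeight Γ₁ a ≤ t ∧ φ.cutWeight Γ₂ a ≤ t) :
    ∫ ψ, hsSq (φ.netMatrix bdry A T ψ * (φ.netMatrix bdry A T ψ).conjTranspose)
      ∂(bulkLaw φ.dim bdry) ≤ numPairings bdry * t := by
  have hA : A ⊆ bdry := by
    have h : Γ₁ ∩ bdry = A := hΓ₁
    rw [← h]; exact Finset.inter_subset_right
  rw [(φ.integral_hsSq_netMatrix_mul_conjTranspose hA T).2, numPairings, ← nsmul_eq_mul,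
    ← Finset.card_univ]
  refine Finset.sum_le_card_nsmul _ _ _ fun Δ _ => (φ.purity_le T _).trans ?_
  refine LinkState.sum_weight_mul_le ht fun a ha hw => ?_
  exact ((hT a ha).cutWeight_le_max hΓ₁ hΓ₂ hΓ hθ hw (withBulk_isCut hA Δ)).trans
    (max_le (hTt a ha).1 (hTt a ha).2)

/-- In the second moment, the empty set of exchanged vertices contributes the square of the mean,
and the nonempty sets have a small weight. -/
lemma LinkState.integral_sq_sub_netMatrix_le (hΓ₁ : IsCut bdry A Γ₁) (hΓ₂ : IsCut bdry A Γ₂)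
    (hΓ : Γ₁ ⊂ Γ₂) (hdisj : Disjoint (cutEdges G Γ₁) (cutEdges G Γ₂)) {θ : ℝ} (hθ : 0 ≤ θ)
    {T : Finset (EdgeCfg φ.dim)} (hT : ∀ a ∈ T, φ.IsGood bdry A Γ₁ Γ₂ θ a) :
    Integrable (fun ψ => (hsSq (φ.netMatrix bdry A T ψ) - ∑ a ∈ T, φ.weight a) ^ 2)
      (bulkLaw φ.dim bdry) ∧
    ∫ ψ, (hsSq (φ.netMatrix bdry A T ψ) - ∑ a ∈ T, φ.weight a) ^ 2 ∂(bulkLaw φ.dim bdry) ≤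
      numPairings bdry * (θ + ∑ a, φ.weight a * φ.cutWeight Γ₁ a) := by
  have hA : A ⊆ bdry := by
    have h : Γ₁ ∩ bdry = A := hΓ₁
    rw [← h]; exact Finset.inter_subset_right
  obtain ⟨i1, e1⟩ := φ.integral_hsSq_netMatrix hA T
  obtain ⟨i2, e2⟩ := φ.integral_hsSq_netMatrix_sq hA T
  set P := ∑ a ∈ T, φ.weight a with hP
  have hq : 0 ≤ ∑ a, φ.weight a * φ.cutWeight Γ₁ a :=
    Finset.sum_nonneg fun a _ => mul_nonneg (φ.weight_nonneg a) (φ.cutWeight_nonneg _ a)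
  have hexp : ∀ ψ, (hsSq (φ.netMatrix bdry A T ψ) - P) ^ 2 =
      hsSq (φ.netMatrix bdry A T ψ) ^ 2 - 2 * P * hsSq (φ.netMatrix bdry A T ψ) + P ^ 2 := by
    intro ψ; ring
  simp_rw [hexp]
  have i3 : Integrable (fun ψ => hsSq (φ.netMatrix bdry A T ψ) ^ 2 -
      2 * P * hsSq (φ.netMatrix bdry A T ψ)) (bulkLaw φ.dim bdry) := i2.sub (i1.const_mul _)
  refine ⟨i3.add (integrable_const _), ?_⟩
  rw [integral_add i3 (integrable_const _),
    integral_sub i2 (i1.const_mul _), integral_const_mul, e1, e2, integral_const, probReal_univ,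
    one_smul, ← Finset.add_sum_erase _ _ (Finset.mem_univ ∅)]
  have h0 : withBulk bdry ∅ ∅ = (∅ : Finset V) := by simp [withBulk]
  rw [h0, φ.purity_empty, ← hP]
  have hle : ∑ Δ ∈ Finset.univ.erase (∅ : Finset {x : V // x ∈ bdryᶜ}),
      φ.purity T (withBulk bdry ∅ Δ) ≤
      numPairings bdry * (θ + ∑ a, φ.weight a * φ.cutWeight Γ₁ a) := by
    calc _ ≤ (Finset.univ.erase (∅ : Finset {x : V // x ∈ bdryᶜ})).card •
          (θ + ∑ a, φ.weight a * φ.cutWeight Γ₁ a) := by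
          refine Finset.sum_le_card_nsmul _ _ _ fun Δ hΔ => (φ.purity_le T _).trans ?_
          have hd : Disjoint (withBulk bdry ∅ Δ) bdry := by
            rw [Finset.disjoint_right]
            intro x hx h
            exact absurd ((mem_withBulk_iff_of_mem hx).1 h) (by simp)
          have hne : (withBulk bdry ∅ Δ).Nonempty := by
            rw [withBulk, Finset.empty_union, Finset.map_nonempty]
            exact Finset.nonempty_iff_ne_empty.2 (Finset.ne_of_mem_erase hΔ)
          have h1 : ∑ a ∈ T, φ.weight a * φ.cutWeight (withBulk bdry ∅ Δ) a ≤
              ∑ a ∈ T, (φ.weight a * θ + φ.weight a * φ.cutWeight Γ₁ a) := by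
            refine Finset.sum_le_sum fun a ha => ?_
            rcases (φ.weight_nonneg a).eq_or_lt with h0 | h0
            · simp [← h0]
            · rw [← mul_add]
              exact mul_le_mul_of_nonneg_left
                ((hT a ha).cutWeight_le_add hΓ₁ hΓ₂ hΓ hdisj hθ h0 hd hne) h0.le
          refine h1.trans ?_
          rw [Finset.sum_add_distrib]
          refine add_le_add (LinkState.sum_weight_mul_le hθ fun a _ _ => le_rfl) ?_
          exact Finset.sum_le_sum_of_subset_of_nonneg (Finset.subset_univ _) fun a _ _ =>
            mul_nonneg (φ.weight_nonneg a) (φ.cutWeight_nonneg _ a)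
      _ ≤ _ := by
          rw [nsmul_eq_mul, numPairings, ← Finset.card_univ]
          gcongr
          exact Finset.erase_subset _ _
  nlinarith

end CutWeights

/-! ### The classical content of a min-entropy bound -/

section TestOperator

/-- The matrix with the columns `∑ z, c z x |F z x⟩`. -/
noncomputable def colMatrix {I Z X : Type*} [Fintype Z] [DecidableEq I] (c : Z → X → ℝ)
    (F : Z → X → I) : Matrix I X ℂ :=
  fun i x => ∑ z, if F z x = i then (c z x : ℂ) else 0

lemma colMatrix_conj_apply {I Z X : Type*} [Fintype Z] [Fintype I] [DecidableEq I] (c : Z → X → ℝ)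
    (F : Z → X → I) (Y : Matrix I I ℂ) (x x' : X) :
    ((colMatrix c F).conjTranspose * Y * colMatrix c F) x x' =
      ∑ z, ∑ z', (c z x : ℂ) * c z' x' * Y (F z x) (F z' x') := by
  have h1 : ∀ j, ((colMatrix c F).conjTranspose * Y) x j = ∑ z, (c z x : ℂ) * Y (F z x) j := by
    intro j
    simp only [Matrix.mul_apply, Matrix.conjTranspose_apply, colMatrix, star_sum, Finset.sum_mul]
    rw [Finset.sum_comm]
    refine Finset.sum_congr rfl fun z _ => ?_
    rw [Finset.sum_eq_single (F z x)]
    · simp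
    · intro i _ hi
      rw [if_neg hi.symm, star_zero, zero_mul]
    · simp
  rw [Matrix.mul_apply]
  simp only [h1, colMatrix, Finset.mul_sum]
  rw [Finset.sum_comm]
  refine Eq.trans ?_ Finset.sum_comm
  refine Finset.sum_congr rfl fun z' _ => ?_
  rw [Finset.sum_eq_single (F z' x')]
  · rw [if_pos rfl, Finset.sum_mul]
    exact Finset.sum_congr rfl fun z _ => by ring
  · intro i _ hi
    rw [if_neg hi.symm, mul_zero]
  · simp

/-- If `H_min^ε ≥ K`, then the state has a neighbour below `2 ^ r (1 ⊗ σ)` for some `r < 1 - K`. -/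
lemma exists_le_of_le_smoothCondMinEntropy {a b : Type*} [Fintype a] [DecidableEq a] [Fintype b]
    [DecidableEq b] {ρ : Matrix (a × b) (a × b) ℂ} {ε K : ℝ}
    (h : (K : EReal) ≤ smoothCondMinEntropy ε ρ) :
    ∃ (ρ' : Matrix (a × b) (a × b) ℂ) (σ : Matrix b b ℂ) (r : ℝ), IsSubnormalized ρ' ∧
      purifiedDistance ρ' ρ ≤ ε ∧ IsSubnormalized σ ∧ r < 1 - K ∧
      (((2 : ℝ) ^ r) • ((1 : Matrix a a ℂ) ⊗ₖ σ) - ρ').PosSemidef := by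
  have h1 : ((K - 1 : ℝ) : EReal) < smoothCondMinEntropy ε ρ :=
    lt_of_lt_of_le (EReal.coe_lt_coe_iff.2 (by linarith)) h
  simp only [smoothCondMinEntropy, condMinEntropy, lt_iSup_iff] at h1
  obtain ⟨ρ', ⟨hρ', hd⟩, σ, hσ, h2⟩ := h1
  rw [condMinEntropyRel, EReal.lt_neg_comm] at h2
  simp only [iInf_lt_iff] at h2
  obtain ⟨r, hr, h3⟩ := h2
  refine ⟨ρ', σ, r, hρ', hd, hσ, ?_, hr⟩
  rw [← EReal.coe_neg, EReal.coe_lt_coe_iff] at h3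
  linarith

variable {X₀ X₁ X₂ X₃ IS IT : Type*} [Fintype X₀] [Fintype X₁] [Fintype X₂] [Fintype X₃]
  [DecidableEq X₁] [DecidableEq X₃]
  [Fintype IS] [Fintype IT] [DecidableEq IS] [DecidableEq IT]

/-- A bound on the smooth min-entropy of a state which is the product of a diagonal state with
the eigenvalues `l₁` on `S`, of a pure entangled state with the Schmidt coefficients `√l₂`, and of
further states on `S` and on `T`. With high probability, `l₁` is much smaller than `l₂`.

The test for this event is the projection onto the span of the vectors which are, given the label
`x₁`, the restriction of the entangled state to the labels `x₂` with `l₁ x₁ > θ l₂ x₂`. -/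
lemma sum_le_of_le_smoothCondMinEntropy {l₀ : X₀ → ℝ} {l₁ : X₁ → ℝ} {l₂ : X₂ → ℝ} {l₃ : X₃ → ℝ}
    (h₀ : ∀ x, 0 ≤ l₀ x) (h₁ : ∀ x, 0 ≤ l₁ x) (h₂ : ∀ x, 0 ≤ l₂ x)
    (s₀ : ∑ x, l₀ x = 1) (s₁ : ∑ x, l₁ x = 1) (s₂ : ∑ x, l₂ x = 1) (s₃ : ∑ x, l₃ x = 1)
    (FS : X₀ → X₁ → X₂ → IS) (FT : X₂ → X₃ → IT)
    (hFS : ∀ {x₀ x₁ x₂ y₀ y₁ y₂}, FS x₀ x₁ x₂ = FS y₀ y₁ y₂ → x₀ = y₀ ∧ x₁ = y₁ ∧ x₂ = y₂)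
    (hFT : ∀ {x₂ x₃ y₂ y₃}, FT x₂ x₃ = FT y₂ y₃ → x₂ = y₂ ∧ x₃ = y₃)
    {ρ : Matrix (IS × IT) (IS × IT) ℂ} (hρ : ρ.PosSemidef) (hρ1 : ρ.trace = 1)
    (hent : ∀ x₀ x₁ x₂ x₃ y₀ y₂, ρ (FS x₀ x₁ x₂, FT x₂ x₃) (FS y₀ x₁ y₂, FT y₂ x₃) =
      ((√(l₀ x₀) * √(l₂ x₂) * (√(l₀ y₀) * √(l₂ y₂)) * (l₁ x₁ * l₃ x₃) : ℝ) : ℂ))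
    {ε K θ η : ℝ} (hθ : 0 < θ) (hη : 0 < η)
    (hK : (K : EReal) ≤ smoothCondMinEntropy ε ρ) :
    ∑ x₁, ∑ x₂, (if θ * l₂ x₂ < l₁ x₁ then l₁ x₁ * l₂ x₂ else 0) ≤
      η + (ε ^ 2 + 3 * √(2 ^ (1 - K) / (θ * η))) := by
  obtain ⟨ρ', σ, r, hρ', hd, hσ, hr, hle⟩ := exists_le_of_le_smoothCondMinEntropy hK
  set p : X₁ → ℝ := fun x₁ => ∑ x₂, if θ * l₂ x₂ < l₁ x₁ then l₂ x₂ else 0 with hp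
  have hp0 : ∀ x, 0 ≤ p x := fun x => Finset.sum_nonneg fun y _ => by
    split_ifs; exacts [h₂ y, le_rfl]
  have hp1 : ∀ x, p x ≤ 1 := fun x => by
    rw [← s₂]
    refine Finset.sum_le_sum fun y _ => ?_
    split_ifs; exacts [le_rfl, h₂ y]
  -- labels `x₁` with a small conditional probability are left out, to bound the norming factor
  set d : X₁ → X₂ → ℝ := fun x₁ x₂ => if θ * l₂ x₂ < l₁ x₁ ∧ η ≤ p x₁ then √(l₂ x₂) / √(p x₁) else 0
    with hd'
  set c : X₀ × X₂ → X₁ × X₃ → ℝ := fun z x => √(l₀ z.1) * d x.1 z.2 with hc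
  set F : X₀ × X₂ → X₁ × X₃ → IS × IT := fun z x => (FS z.1 x.1 z.2, FT z.2 x.2) with hF
  set D : X₁ → ℝ := fun x => if η ≤ p x then 1 else 0 with hD
  set U := colMatrix c F with hU
  have hFinj : ∀ {z z' x x'}, F z x = F z' x' → z = z' ∧ x = x' := by
    intro z z' x x' h
    obtain ⟨h1, h2⟩ := Prod.ext_iff.1 h
    obtain ⟨a1, a2, a3⟩ := hFS h1
    obtain ⟨-, b2⟩ := hFT h2
    exact ⟨Prod.ext a1 a3, Prod.ext a2 b2⟩
  have hd2 : ∀ x₁ x₂, d x₁ x₂ ^ 2 =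
      if η ≤ p x₁ then (if θ * l₂ x₂ < l₁ x₁ then l₂ x₂ else 0) / p x₁ else 0 := by
    intro x₁ x₂
    simp only [hd']
    by_cases h1 : θ * l₂ x₂ < l₁ x₁ <;> by_cases h2 : η ≤ p x₁ <;>
      simp [h1, h2, div_pow, Real.sq_sqrt (h₂ x₂), Real.sq_sqrt (hp0 x₁)]
  have hd2s : ∀ x₁, ∑ x₂, d x₁ x₂ ^ 2 = D x₁ := by
    intro x₁
    simp only [hd2, hD]
    split_ifs with h
    · rw [← Finset.sum_div]
      exact div_self (hη.trans_le h).ne'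
    · simp
  have hds : ∀ x₁, ∑ x₂, d x₁ x₂ * √(l₂ x₂) = D x₁ * √(p x₁) := by
    intro x₁
    simp only [hd', hD]
    by_cases h : η ≤ p x₁
    · simp only [h, and_true, if_true, one_mul]
      have : ∀ x₂, (if θ * l₂ x₂ < l₁ x₁ then √(l₂ x₂) / √(p x₁) else 0) * √(l₂ x₂) =
          (if θ * l₂ x₂ < l₁ x₁ then l₂ x₂ else 0) / √(p x₁) := by
        intro x₂
        split_ifs
        · rw [div_mul_eq_mul_div, Real.mul_self_sqrt (h₂ x₂)]
        · simp
      rw [Finset.sum_congr rfl fun x₂ _ => this x₂, ← Finset.sum_div]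
      exact Real.div_sqrt
    · simp [h]
  have hc2s : ∀ x, ∑ z, c z x * c z x = D x.1 := by
    intro x
    rw [Fintype.sum_prod_type]
    calc _ = ∑ x₀, l₀ x₀ * ∑ x₂, d x.1 x₂ ^ 2 := by
          refine Finset.sum_congr rfl fun x₀ _ => ?_
          rw [Finset.mul_sum]
          refine Finset.sum_congr rfl fun x₂ _ => ?_
          simp only [hc]
          nth_rewrite 3 [← Real.sq_sqrt (h₀ x₀)]
          ring
      _ = _ := by rw [← Finset.sum_mul, s₀, one_mul, hd2s]
  have hUU : U.conjTranspose * U = Matrix.diagonal fun x : X₁ × X₃ => (D x.1 : ℂ) := by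
    ext x x'
    have := colMatrix_conj_apply c F 1 x x'
    rw [Matrix.mul_one] at this
    rw [hU, this]
    by_cases hx : x = x'
    · subst hx
      rw [Matrix.diagonal_apply_eq, ← hc2s, Complex.ofReal_sum]
      refine Finset.sum_congr rfl fun z _ => ?_
      rw [Finset.sum_eq_single z]
      · rw [Matrix.one_apply_eq]; push_cast; ring
      · intro z' _ hz
        rw [Matrix.one_apply_ne fun h => hz (hFinj h).1.symm, mul_zero]
      · simp
    · rw [Matrix.diagonal_apply_ne _ hx]
      refine Finset.sum_eq_zero fun z _ => Finset.sum_eq_zero fun z' _ => ?_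
      rw [Matrix.one_apply_ne fun h => hx (hFinj h).2, mul_zero]
  have hUD : U * Matrix.diagonal (fun x : X₁ × X₃ => (D x.1 : ℂ)) = U := by
    ext i x
    rw [Matrix.mul_diagonal]
    by_cases h : η ≤ p x.1
    · simp [hD, h]
    · have : U i x = 0 := by
        refine Finset.sum_eq_zero fun z _ => ?_
        simp [hc, hd', h]
      rw [this, zero_mul]
  set Q := U * U.conjTranspose with hQ
  have hQh : Q.conjTranspose = Q := by
    rw [hQ, Matrix.conjTranspose_mul, Matrix.conjTranspose_conjTranspose]
  have hQQ : Q * Q = Q := by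
    rw [hQ, show U * U.conjTranspose * (U * U.conjTranspose) =
      U * (U.conjTranspose * U) * U.conjTranspose by simp only [Matrix.mul_assoc], hUU, hUD]
  have htr : ∀ Y : Matrix (IS × IT) (IS × IT) ℂ, (Q * Y).trace =
      ∑ x, ∑ z, ∑ z', (c z x : ℂ) * c z' x * Y (F z x) (F z' x) := by
    intro Y
    rw [hQ, Matrix.mul_assoc, Matrix.trace_mul_comm]
    simp only [Matrix.trace, Matrix.diag]
    exact Finset.sum_congr rfl fun x _ => colMatrix_conj_apply c F Y x x
  -- the probability of the test in the given state
  have hρQ : (Q * ρ).trace.re = ∑ x₁, l₁ x₁ * (D x₁ * p x₁) := by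
    have h1 : (Q * ρ).trace = ((∑ x₁, l₁ x₁ * (D x₁ * p x₁) : ℝ) : ℂ) := by
      rw [htr]
      have h2 : ∀ x : X₁ × X₃, ∑ z, ∑ z', (c z x : ℂ) * c z' x * ρ (F z x) (F z' x) =
          ((l₁ x.1 * (D x.1 * p x.1) * l₃ x.2 : ℝ) : ℂ) := by
        intro x
        have h3 : ∑ z, c z x * (√(l₀ z.1) * √(l₂ z.2)) = D x.1 * √(p x.1) := by
          rw [Fintype.sum_prod_type]
          calc _ = ∑ x₀, l₀ x₀ * ∑ x₂, d x.1 x₂ * √(l₂ x₂) := by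
                refine Finset.sum_congr rfl fun x₀ _ => ?_
                rw [Finset.mul_sum]
                refine Finset.sum_congr rfl fun x₂ _ => ?_
                simp only [hc]
                nth_rewrite 3 [← Real.sq_sqrt (h₀ x₀)]
                ring
            _ = _ := by rw [← Finset.sum_mul, s₀, one_mul, hds]
        have h4 : D x.1 * p x.1 = (D x.1 * √(p x.1)) * (D x.1 * √(p x.1)) := by
          rw [mul_mul_mul_comm, Real.mul_self_sqrt (hp0 _)]
          simp only [hD]
          split_ifs <;> simp
        rw [h4, ← h3, Finset.sum_mul_sum]
        push_cast
        rw [Finset.mul_sum, Finset.sum_mul]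
        refine Finset.sum_congr rfl fun z _ => ?_
        rw [Finset.mul_sum, Finset.sum_mul]
        refine Finset.sum_congr rfl fun z' _ => ?_
        simp only [hF]
        rw [hent]
        push_cast; ring
      rw [Finset.sum_congr rfl fun x _ => h2 x, ← Complex.ofReal_sum, Fintype.sum_prod_type]
      congr 1
      refine Finset.sum_congr rfl fun x₁ _ => ?_
      change ∑ y, l₁ x₁ * (D x₁ * p x₁) * l₃ y = _
      rw [← Finset.mul_sum, s₃, mul_one]
    rw [h1, Complex.ofReal_re]
  -- the probability of the test in the state `1 ⊗ σ`
  have hσQ : (Q * ((1 : Matrix IS IS ℂ) ⊗ₖ σ)).trace.re ≤ 1 / (θ * η) := by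
    have hσd : ∀ j, 0 ≤ (σ j j).re := fun j => (Complex.le_def.1 (hσ.1.diag_nonneg (i := j))).1
    have h1 : (Q * ((1 : Matrix IS IS ℂ) ⊗ₖ σ)).trace.re =
        ∑ x : X₁ × X₃, ∑ z, c z x * c z x * (σ (FT z.2 x.2) (FT z.2 x.2)).re := by
      rw [htr, Complex.re_sum]
      refine Finset.sum_congr rfl fun x _ => ?_
      rw [Complex.re_sum]
      refine Finset.sum_congr rfl fun z _ => ?_
      rw [Finset.sum_eq_single z]
      · simp only [hF, Matrix.kroneckerMap_apply, Matrix.one_apply_eq, one_mul]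
        rw [← Complex.ofReal_mul, Complex.re_ofReal_mul]
      · intro z' _ hz
        have : FS z.1 x.1 z.2 ≠ FS z'.1 x.1 z'.2 := fun h =>
          hz (Prod.ext (hFS h).1.symm (hFS h).2.2.symm)
        simp [hF, Matrix.kroneckerMap_apply, Matrix.one_apply_ne this]
      · simp
    have h2 : ∀ x₂, ∑ x₁, d x₁ x₂ ^ 2 ≤ 1 / (θ * η) := by
      intro x₂
      have h3 : ∀ x₁, d x₁ x₂ ^ 2 ≤ l₁ x₁ / (θ * η) := by
        intro x₁
        rw [hd2]
        have := h₁ x₁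
        split_ifs with h4 h5
        · rw [div_le_div_iff₀ (hη.trans_le h4) (by positivity)]
          calc l₂ x₂ * (θ * η) = θ * l₂ x₂ * η := by ring
            _ ≤ l₁ x₁ * p x₁ := mul_le_mul h5.le h4 hη.le this
        · rw [zero_div]; positivity
        · positivity
      calc _ ≤ ∑ x₁, l₁ x₁ / (θ * η) := Finset.sum_le_sum fun x₁ _ => h3 x₁
        _ = _ := by rw [← Finset.sum_div, s₁]
    rw [h1]
    calc _ = ∑ q : X₂ × X₃, (∑ x₁, d x₁ q.1 ^ 2) * (σ (FT q.1 q.2) (FT q.1 q.2)).re := by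
          simp only [Fintype.sum_prod_type, hc, Finset.sum_mul]
          calc _ = ∑ x₁, ∑ x₃, ∑ x₀, l₀ x₀ * ∑ x₂, d x₁ x₂ ^ 2 * (σ (FT x₂ x₃) (FT x₂ x₃)).re := by
                refine Finset.sum_congr rfl fun x₁ _ => Finset.sum_congr rfl fun x₃ _ =>
                  Finset.sum_congr rfl fun x₀ _ => ?_
                rw [Finset.mul_sum]
                refine Finset.sum_congr rfl fun x₂ _ => ?_
                nth_rewrite 3 [← Real.sq_sqrt (h₀ x₀)]
                ring
            _ = ∑ x₁, ∑ x₃, ∑ x₂, d x₁ x₂ ^ 2 * (σ (FT x₂ x₃) (FT x₂ x₃)).re := by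
                simp only [← Finset.sum_mul, s₀, one_mul]
            _ = _ := by
                rw [Finset.sum_congr rfl fun x₁ _ => Finset.sum_comm, Finset.sum_comm]
                exact Finset.sum_congr rfl fun x₂ _ => Finset.sum_comm
      _ ≤ ∑ q : X₂ × X₃, 1 / (θ * η) * (σ (FT q.1 q.2) (FT q.1 q.2)).re :=
          Finset.sum_le_sum fun q _ => mul_le_mul_of_nonneg_right (h2 q.1) (hσd _)
      _ = 1 / (θ * η) * ∑ q : X₂ × X₃, (σ (FT q.1 q.2) (FT q.1 q.2)).re := by
          rw [Finset.mul_sum]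
      _ ≤ 1 / (θ * η) * ∑ j, (σ j j).re := by
          refine mul_le_mul_of_nonneg_left ?_ (by positivity)
          rw [← Finset.sum_image (s := Finset.univ) (g := fun q : X₂ × X₃ => FT q.1 q.2)
            (f := fun j => (σ j j).re) fun q _ q' _ h => Prod.ext (hFT h).1 (hFT h).2]
          exact Finset.sum_le_sum_of_subset_of_nonneg (Finset.subset_univ _) fun j _ _ => hσd j
      _ ≤ 1 / (θ * η) * 1 := by
          refine mul_le_mul_of_nonneg_left (le_trans (le_of_eq ?_) hσ.2) (by positivity)
          simp [Matrix.trace]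
      _ = _ := mul_one _
  have hρ'Q : (Q * ρ').trace.re ≤ 2 ^ (1 - K) / (θ * η) := by
    have h1 := (hle.mul_mul_conjTranspose_same Q).trace_nonneg
    rw [Matrix.trace_mul_comm, ← Matrix.mul_assoc, hQh, hQQ, Matrix.mul_sub, Matrix.mul_smul,
      Matrix.trace_sub, Matrix.trace_smul] at h1
    have h2 := (Complex.le_def.1 h1).1
    rw [Complex.sub_re, Complex.smul_re, Complex.zero_re, smul_eq_mul] at h2
    have h3 : (2 : ℝ) ^ r ≤ 2 ^ (1 - K) := Real.rpow_le_rpow_of_exponent_le one_le_two hr.le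
    have h4 : (2 : ℝ) ^ r * (Q * ((1 : Matrix IS IS ℂ) ⊗ₖ σ)).trace.re ≤
        2 ^ r * (1 / (θ * η)) := mul_le_mul_of_nonneg_left hσQ (by positivity)
    have h5 : (2 : ℝ) ^ r * (1 / (θ * η)) ≤ 2 ^ (1 - K) * (1 / (θ * η)) :=
      mul_le_mul_of_nonneg_right h3 (by positivity)
    rw [div_eq_mul_one_div]
    linarith
  have hfin := trace_le_of_purifiedDistance_le hρ hρ1 hρ' hQh hQQ hd
  rw [hρQ] at hfin
  have h6 : ∑ x₁, ∑ x₂, (if θ * l₂ x₂ < l₁ x₁ then l₁ x₁ * l₂ x₂ else 0) ≤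
      ∑ x₁, (l₁ x₁ * η + l₁ x₁ * (D x₁ * p x₁)) := by
    refine Finset.sum_le_sum fun x₁ _ => ?_
    have : ∑ x₂, (if θ * l₂ x₂ < l₁ x₁ then l₁ x₁ * l₂ x₂ else 0) = l₁ x₁ * p x₁ := by
      rw [hp, Finset.mul_sum]
      exact Finset.sum_congr rfl fun x₂ _ => by rw [mul_ite, mul_zero]
    rw [this, ← mul_add]
    refine mul_le_mul_of_nonneg_left ?_ (h₁ x₁)
    simp only [hD]
    split_ifs with h
    · linarith
    · linarith [not_le.1 h]
  rw [Finset.sum_add_distrib, ← Finset.sum_mul, s₁, one_mul] at h6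
  refine h6.trans (add_le_add_right (hfin.trans ?_) _)
  gcongr

end TestOperator

/-! ### Splitting the edge labels -/

section Splitting

variable {E : Type*} [Fintype E] [DecidableEq E] (cls : E → Fin 5) (D : E → ℕ)

/-- The labels of the edges of the class `j`. -/
abbrev Part (j : Fin 5) : Type _ := (e : {e : E // cls e = j}) → Fin (D e.1)

variable {D}

/-- The restriction of a label to the class `j`. -/
def restrPart (j : Fin 5) (a : (e : E) → Fin (D e)) : Part cls D j := fun e => a e.1

/-- The components of a tuple of labels of the five classes. -/
def tupleGet (x : Part cls D 0 × Part cls D 1 × Part cls D 2 × Part cls D 3 × Part cls D 4) :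
    (j : Fin 5) → Part cls D j
  | 0 => x.1
  | 1 => x.2.1
  | 2 => x.2.2.1
  | 3 => x.2.2.2.1
  | 4 => x.2.2.2.2

/-- An edge label is the same as a tuple of labels of the five classes. Five classes suffice to
describe the edges relative to two disjoint sets of vertices; for a single cut two of them are
empty. -/
def splitParts : (Part cls D 0 × Part cls D 1 × Part cls D 2 × Part cls D 3 × Part cls D 4) ≃
    ((e : E) → Fin (D e)) where
  toFun x e := tupleGet cls x (cls e) ⟨e, rfl⟩
  invFun a := (restrPart cls 0 a, restrPart cls 1 a, restrPart cls 2 a, restrPart cls 3 a,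
    restrPart cls 4 a)
  left_inv x := by
    have h : ∀ j, restrPart cls j (fun e => tupleGet cls x (cls e) ⟨e, rfl⟩) = tupleGet cls x j := by
      intro j
      funext ⟨e, he⟩
      subst he
      rfl
    exact Prod.ext (h 0) (Prod.ext (h 1) (Prod.ext (h 2) (Prod.ext (h 3) (h 4))))
  right_inv a := by
    funext e
    have h : ∀ j (he : cls e = j), tupleGet cls (restrPart cls 0 a, restrPart cls 1 a,
        restrPart cls 2 a, restrPart cls 3 a, restrPart cls 4 a) j ⟨e, he⟩ = a e := by
      intro j he
      fin_cases j <;> rfl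
    exact h _ rfl

lemma restrPart_splitParts (j : Fin 5)
    (x : Part cls D 0 × Part cls D 1 × Part cls D 2 × Part cls D 3 × Part cls D 4) :
    restrPart cls j (splitParts cls x) = tupleGet cls x j := by
  funext ⟨e, he⟩
  subst he
  rfl

lemma splitParts_congr {x y : Part cls D 0 × Part cls D 1 × Part cls D 2 × Part cls D 3 ×
    Part cls D 4} {p : E → Prop} :
    (∀ e, p e → splitParts cls x e = splitParts cls y e) ↔
      ∀ j, ∀ e : {e // cls e = j}, p e.1 → tupleGet cls x j e = tupleGet cls y j e := by
  constructor
  · rintro h j ⟨e, rfl⟩ he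
    exact h e he
  · intro h e he
    exact h (cls e) ⟨e, rfl⟩ he

end Splitting

section SplitWeights

variable {V : Type*} [Fintype V] [DecidableEq V] {G : SimpleGraph V} [DecidableRel G.Adj]
  (φ : LinkState G) (cls : G.edgeSet → Fin 5)

/-- The probability of a label of the edges of the class `j`. -/
noncomputable def LinkState.partProb (j : Fin 5) (x : Part cls φ.dim j) : ℝ :=
  ∏ e, φ.coeff e.1 (x e)

lemma LinkState.partProb_nonneg (j : Fin 5) (x : Part cls φ.dim j) : 0 ≤ φ.partProb cls j x :=
  Finset.prod_nonneg fun _ _ => φ.coeff_nonneg _ _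

lemma LinkState.sum_partProb (j : Fin 5) : ∑ x, φ.partProb cls j x = 1 := by
  simp only [LinkState.partProb]
  rw [← Fintype.prod_sum (fun (e : {e : G.edgeSet // cls e = j}) i => φ.coeff e.1 i)]
  exact Finset.prod_eq_one fun e _ => φ.sum_coeff _

lemma LinkState.weight_splitParts (x : Part cls φ.dim 0 × Part cls φ.dim 1 × Part cls φ.dim 2 ×
    Part cls φ.dim 3 × Part cls φ.dim 4) :
    φ.weight (splitParts cls x) = φ.partProb cls 0 x.1 * (φ.partProb cls 1 x.2.1 *
      (φ.partProb cls 2 x.2.2.1 * (φ.partProb cls 3 x.2.2.2.1 * φ.partProb cls 4 x.2.2.2.2))) := by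
  have h : ∀ j, ∏ e : {e // cls e = j}, φ.coeff e.1 (splitParts cls x e.1) =
      φ.partProb cls j (tupleGet cls x j) := by
    intro j
    rw [← restrPart_splitParts]
    rfl
  rw [LinkState.weight, ← Fintype.prod_fiberwise cls, Finset.prod_congr rfl fun j _ => h j,
    Fin.prod_univ_five]
  simp only [tupleGet, mul_assoc]

lemma LinkState.partialWeight_eq_partProb {p : G.edgeSet → Prop} {j : Fin 5}
    (h : ∀ e, p e ↔ cls e = j) (a : EdgeCfg φ.dim) :
    φ.partialWeight p a = φ.partProb cls j (restrPart cls j a) := by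
  classical
  rw [LinkState.partialWeight, LinkState.partProb, Finset.prod_ite, Finset.prod_const_one, mul_one]
  exact Finset.prod_subtype (p := fun e => cls e = j) (Finset.univ.filter p) (by simp [h])
    (fun e => φ.coeff e (a e))

lemma LinkState.exists_edgeCfg : ∃ a : EdgeCfg φ.dim, 0 < φ.weight a := by
  by_contra h
  push Not at h
  have h1 := φ.sum_weight
  rw [Finset.sum_eq_zero fun a _ => le_antisymm (h a) (φ.weight_nonneg a)] at h1
  exact zero_ne_one h1

/-- The edge `e` has an end point in `S`. -/
def Touches (S : Finset V) (e : G.edgeSet) : Prop := ∃ x ∈ (e : Sym2 V), x ∈ S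

lemma touches_mk {S : Finset V} {x y : V} (h : s(x, y) ∈ G.edgeSet) :
    Touches S ⟨s(x, y), h⟩ ↔ x ∈ S ∨ y ∈ S := by
  simp only [Touches, Sym2.mem_iff, exists_eq_or_imp, exists_eq_left]

lemma halfCfg_eq_iff_touches {D : G.edgeSet → ℕ} {S : Finset V} {a b : EdgeCfg D} :
    halfCfg S a = halfCfg S b ↔ ∀ e : G.edgeSet, Touches S e → a e = b e := by
  rw [halfCfg_eq_iff]
  constructor
  · rintro h e ⟨x, hx, hxS⟩
    exact h x hxS e hx
  · exact fun h x hx e he => h e ⟨x, he, hx⟩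

lemma crosses_iff_touches {Γ : Finset V} {e : G.edgeSet} :
    Crosses Γ e ↔ Touches Γ e ∧ Touches Γᶜ e := by
  simp [Crosses, Touches]

lemma touches_or_compl (Γ : Finset V) (e : G.edgeSet) : Touches Γ e ∨ Touches Γᶜ e := by
  obtain ⟨x, hx⟩ := exists_mem_edge e
  by_cases h : x ∈ Γ
  · exact Or.inl ⟨x, hx, h⟩
  · exact Or.inr ⟨x, hx, by simpa using h⟩

/-! ### The Schmidt decomposition across a cut -/

open Classical in
/-- The class of an edge relative to a cut: inside `0`, across `1`, outside `2`. -/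
noncomputable def cutClass (Γ : Finset V) (e : G.edgeSet) : Fin 5 :=
  if Touches Γ e then (if Touches Γᶜ e then 1 else 0) else 2

lemma cutClass_touches (Γ : Finset V) (e : G.edgeSet) :
    Touches Γ e ↔ cutClass Γ e = 0 ∨ cutClass Γ e = 1 := by
  unfold cutClass; split_ifs with h1 h2 <;> simp [h1]

lemma cutClass_touches_compl (Γ : Finset V) (e : G.edgeSet) :
    Touches Γᶜ e ↔ cutClass Γ e = 1 ∨ cutClass Γ e = 2 := by
  have := touches_or_compl Γ e
  unfold cutClass; split_ifs with h1 h2 <;> simp_all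

lemma cutClass_le (Γ : Finset V) (e : G.edgeSet) : cutClass Γ e ≤ 2 := by
  unfold cutClass; split_ifs <;> decide

lemma cutClass_crosses (Γ : Finset V) (e : G.edgeSet) : Crosses Γ e ↔ cutClass Γ e = 1 := by
  rw [crosses_iff_touches]
  unfold cutClass; split_ifs <;> simp_all

/-- A matrix which is a sum over the edge labels of products of a factor of the labels on `Γ` and
of a factor of the labels on the complement has at most the rank of the number of labels
across `Γ`. -/
lemma LinkState.rank_mul_le {I K : Type*} [Fintype I] [Fintype K] (Γ : Finset V)
    (F : I → EdgeCfg φ.dim → ℂ) (H : K → EdgeCfg φ.dim → ℂ)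
    (hF : ∀ i a b, (∀ e, Touches Γ e → a e = b e) → F i a = F i b)
    (hH : ∀ k a b, (∀ e, Touches Γᶜ e → a e = b e) → H k a = H k b)
    {t : ℝ} (ht : 0 ≤ t) (hsupp : ∀ i k a, F i a * H k a ≠ 0 → t ≤ φ.cutWeight Γ a)
    (M : Matrix I K ℂ) (hM : ∀ i k, M i k = ∑ a, F i a * H k a) : M.rank * t ≤ 1 := by
  obtain ⟨o, -⟩ := φ.exists_edgeCfg
  set cls : G.edgeSet → Fin 5 := cutClass Γ with hcls
  set r := fun j => restrPart cls j o with hr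
  set C : Finset (Part cls φ.dim 1) := Finset.univ.filter fun x => t ≤ φ.partProb cls 1 x with hC
  let U : Matrix I C ℂ := fun i c => ∑ x₀, F i (splitParts cls (x₀, c.1, r 2, r 3, r 4))
  let W : Matrix C K ℂ := fun c k => ∑ y : Part cls φ.dim 2 × Part cls φ.dim 3 × Part cls φ.dim 4,
    H k (splitParts cls (r 0, c.1, y))
  have hUW : M = U * W := by
    ext i k
    have h1 : M i k = ∑ c : Part cls φ.dim 1, (∑ x₀, F i (splitParts cls (x₀, c, r 2, r 3, r 4))) *
        ∑ y : Part cls φ.dim 2 × Part cls φ.dim 3 × Part cls φ.dim 4,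
          H k (splitParts cls (r 0, c, y)) := by
      rw [hM, ← (splitParts cls).sum_comp, Fintype.sum_prod_type, Finset.sum_congr rfl fun x₀ _ =>
        Fintype.sum_prod_type _, Finset.sum_comm]
      refine Finset.sum_congr rfl fun c _ => ?_
      rw [Finset.sum_mul_sum]
      refine Finset.sum_congr rfl fun x₀ _ => Finset.sum_congr rfl fun y _ => ?_
      congr 1
      · refine hF i _ _ ((splitParts_congr cls).2 fun j e he => ?_)
        rw [cutClass_touches, ← hcls, e.2] at he
        rcases he with rfl | rfl <;> rfl
      · refine hH k _ _ ((splitParts_congr cls).2 fun j e he => ?_)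
        rw [cutClass_touches_compl, ← hcls, e.2] at he
        rcases he with rfl | rfl <;> rfl
    rw [h1, Matrix.mul_apply]
    refine Eq.trans ?_ (Finset.sum_coe_sort C (fun c =>
      (∑ x₀, F i (splitParts cls (x₀, c, r 2, r 3, r 4))) *
        ∑ y : Part cls φ.dim 2 × Part cls φ.dim 3 × Part cls φ.dim 4,
          H k (splitParts cls (r 0, c, y)))).symm
    symm
    refine Finset.sum_subset (Finset.subset_univ _) fun c _ hc => ?_
    rw [Finset.sum_mul_sum]
    refine Finset.sum_eq_zero fun x₀ _ => Finset.sum_eq_zero fun y _ => ?_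
    have e1 : F i (splitParts cls (x₀, c, r 2, r 3, r 4)) = F i (splitParts cls (x₀, c, y)) := by
      refine hF i _ _ ((splitParts_congr cls).2 fun j e he => ?_)
      rw [cutClass_touches, ← hcls, e.2] at he
      rcases he with rfl | rfl <;> rfl
    have e2 : H k (splitParts cls (r 0, c, y)) = H k (splitParts cls (x₀, c, y)) := by
      refine hH k _ _ ((splitParts_congr cls).2 fun j e he => ?_)
      rw [cutClass_touches_compl, ← hcls, e.2] at he
      rcases he with rfl | rfl <;> rfl
    rw [e1, e2]
    by_contra hne
    refine hc ?_
    have := hsupp i k _ hne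
    rw [LinkState.cutWeight, φ.partialWeight_eq_partProb cls (cutClass_crosses Γ),
      restrPart_splitParts] at this
    exact Finset.mem_filter.2 ⟨Finset.mem_univ _, this⟩
  have h2 : M.rank ≤ C.card := by
    rw [hUW]
    exact (Matrix.rank_mul_le_left _ _).trans ((Matrix.rank_le_card_width U).trans (by simp))
  calc (M.rank : ℝ) * t ≤ C.card * t := by gcongr
    _ ≤ ∑ x ∈ C, φ.partProb cls 1 x := by
        rw [← nsmul_eq_mul]
        exact Finset.card_nsmul_le_sum _ _ _ fun x hx => (Finset.mem_filter.1 hx).2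
    _ ≤ ∑ x, φ.partProb cls 1 x := Finset.sum_le_sum_of_subset_of_nonneg (Finset.subset_univ _)
        fun x _ _ => φ.partProb_nonneg cls 1 x
    _ = 1 := φ.sum_partProb cls 1

lemma colMatrix_isometry {I Z X : Type*} [Fintype Z] [Fintype I] [DecidableEq I] [DecidableEq X]
    (c : Z → X → ℝ) (F : Z → X → I) (hF : ∀ {z z' x x'}, F z x = F z' x' → z = z' ∧ x = x')
    (hc : ∀ x, ∑ z, c z x * c z x = 1) : (colMatrix c F).conjTranspose * colMatrix c F = 1 := by
  ext x x'
  have := colMatrix_conj_apply c F 1 x x'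
  rw [Matrix.mul_one] at this
  rw [this]
  by_cases hx : x = x'
  · subst hx
    rw [Matrix.one_apply_eq, ← Complex.ofReal_one, ← hc x, Complex.ofReal_sum]
    refine Finset.sum_congr rfl fun z _ => ?_
    rw [Finset.sum_eq_single z]
    · rw [Matrix.one_apply_eq]; push_cast; ring
    · intro z' _ hz
      rw [Matrix.one_apply_ne fun h => hz (hF h).1.symm, mul_zero]
    · simp
  · rw [Matrix.one_apply_ne hx]
    refine Finset.sum_eq_zero fun z _ => Finset.sum_eq_zero fun z' _ => ?_
    rw [Matrix.one_apply_ne fun h => hx (hF h).2, mul_zero]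

/-- The eigenvalues of `φ_Γ` are the weights of the labels across the cut. -/
lemma LinkState.sum_eigenvalues_reducedState (Γ : Finset V) {M : Type*} [AddCommMonoid M]
    (g : ℝ → M) (hg : g 0 = 0) :
    ∑ i, g ((reducedState_isHermitian φ.vector Γ).eigenvalues i) =
      ∑ x, g (φ.partProb (cutClass Γ) 1 x) := by
  obtain ⟨o, -⟩ := φ.exists_edgeCfg
  set cls : G.edgeSet → Fin 5 := cutClass Γ with hcls
  set r := fun j => restrPart cls j o with hr
  set FS : Part cls φ.dim 0 → Part cls φ.dim 1 → Cfg φ.dim Γ :=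
    fun x₀ x₁ => halfCfg Γ (splitParts cls (x₀, x₁, r 2, r 3, r 4)) with hFS
  set FR : (Part cls φ.dim 2 × Part cls φ.dim 3 × Part cls φ.dim 4) → Part cls φ.dim 1 →
    Cfg φ.dim (Finset.univ \ Γ) := fun y x₁ => halfCfg _ (splitParts cls (r 0, x₁, y)) with hFR
  set pR : (Part cls φ.dim 2 × Part cls φ.dim 3 × Part cls φ.dim 4) → ℝ := fun y =>
    φ.partProb cls 2 y.1 * (φ.partProb cls 3 y.2.1 * φ.partProb cls 4 y.2.2) with hpR
  have hpR0 : ∀ y, 0 ≤ pR y := fun y => mul_nonneg (φ.partProb_nonneg _ _ _)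
    (mul_nonneg (φ.partProb_nonneg _ _ _) (φ.partProb_nonneg _ _ _))
  have hpRs : ∑ y, pR y = 1 := by
    simp only [hpR, Fintype.sum_prod_type, ← Finset.mul_sum, φ.sum_partProb, mul_one]
  set U := colMatrix (fun x₀ _ => √(φ.partProb cls 0 x₀)) FS with hU
  set Y := colMatrix (fun y _ => √(pR y)) FR with hY
  have hempty : ∀ j : Fin 5, 2 < j → ∀ x y : Part cls φ.dim j, x = y := by
    intro j hj x y
    funext e
    exact absurd (e.2 ▸ cutClass_le Γ e.1) (not_le.2 hj)
  have hUU : U.conjTranspose * U = 1 := by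
    refine colMatrix_isometry _ _ ?_ fun x => ?_
    · intro z z' x x' h
      rw [hFS, halfCfg_eq_iff_touches, splitParts_congr] at h
      exact ⟨funext fun e => h 0 e ((cutClass_touches Γ e.1).2 (Or.inl e.2)),
        funext fun e => h 1 e ((cutClass_touches Γ e.1).2 (Or.inr e.2))⟩
    · rw [← φ.sum_partProb cls 0]
      exact Finset.sum_congr rfl fun z _ => Real.mul_self_sqrt (φ.partProb_nonneg _ _ _)
  have hYY : Y.conjTranspose * Y = 1 := by
    refine colMatrix_isometry _ _ ?_ fun x => ?_
    · intro z z' x x' h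
      rw [hFR, halfCfg_eq_iff_touches, ← Finset.compl_eq_univ_sdiff, splitParts_congr] at h
      exact ⟨Prod.ext (funext fun e => h 2 e ((cutClass_touches_compl Γ e.1).2 (Or.inr e.2)))
          (Prod.ext (hempty 3 (by decide) _ _) (hempty 4 (by decide) _ _)),
        funext fun e => h 1 e ((cutClass_touches_compl Γ e.1).2 (Or.inl e.2))⟩
    · rw [← hpRs]
      exact Finset.sum_congr rfl fun z _ => Real.mul_self_sqrt (hpR0 z)
  set d : Part cls φ.dim 1 → ℂ := fun x => ((√(φ.partProb cls 1 x) : ℝ) : ℂ) with hd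
  set M := ampMatrix Finset.univ (fun a => ((√(φ.weight a) : ℝ) : ℂ)) (halfCfg Γ)
    (halfCfg (Finset.univ \ Γ)) with hM
  have hMU : M = U * Matrix.diagonal d * Y.conjTranspose := by
    ext i k
    rw [Matrix.mul_apply]
    have hUYd : ∀ x₁, (U * Matrix.diagonal d) i x₁ * Y.conjTranspose x₁ k = ∑ x₀, ∑ y,
        (if FS x₀ x₁ = i then ((√(φ.partProb cls 0 x₀) : ℝ) : ℂ) else 0) * d x₁ *
          (if FR y x₁ = k then ((√(pR y) : ℝ) : ℂ) else 0) := by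
      intro x₁
      have hYs : Y.conjTranspose x₁ k =
          ∑ y, if FR y x₁ = k then ((√(pR y) : ℝ) : ℂ) else 0 := by
        rw [Matrix.conjTranspose_apply, hY, colMatrix, star_sum]
        refine Finset.sum_congr rfl fun y _ => ?_
        split_ifs
        · exact Complex.conj_ofReal _
        · exact star_zero _
      rw [Matrix.mul_diagonal, hYs, hU, colMatrix, Finset.sum_mul, Finset.sum_mul_sum]
    rw [Finset.sum_congr rfl fun x₁ _ => hUYd x₁]
    rw [hM, ampMatrix, ← (splitParts cls).sum_comp, Fintype.sum_prod_type, Finset.sum_congr rfl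
      fun x₀ _ => Fintype.sum_prod_type _, Finset.sum_comm]
    refine Finset.sum_congr rfl fun x₁ _ => ?_
    refine Finset.sum_congr rfl fun x₀ _ => Finset.sum_congr rfl fun y _ => ?_
    have e1 : halfCfg Γ (splitParts cls (x₀, x₁, y)) = FS x₀ x₁ := by
      rw [hFS, halfCfg_eq_iff_touches]
      refine (splitParts_congr cls).2 fun j e he => ?_
      rw [cutClass_touches, ← hcls, e.2] at he
      rcases he with rfl | rfl <;> rfl
    have e2 : halfCfg (Finset.univ \ Γ) (splitParts cls (x₀, x₁, y)) = FR y x₁ := by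
      rw [hFR, halfCfg_eq_iff_touches, ← Finset.compl_eq_univ_sdiff]
      refine (splitParts_congr cls).2 fun j e he => ?_
      rw [cutClass_touches_compl, ← hcls, e.2] at he
      rcases he with rfl | rfl <;> rfl
    have e3 : √(φ.weight (splitParts cls (x₀, x₁, y))) =
        √(φ.partProb cls 0 x₀) * √(φ.partProb cls 1 x₁) * √(pR y) := by
      rw [φ.weight_splitParts, Real.sqrt_mul (φ.partProb_nonneg _ _ _),
        Real.sqrt_mul (φ.partProb_nonneg _ _ _), mul_assoc]
    rw [e1, e2, e3]
    by_cases h1 : FS x₀ x₁ = i <;> by_cases h2 : FR y x₁ = k <;>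
      simp [h1, h2, hd]
  have hρ : reducedState φ.vector Γ = U *
      Matrix.diagonal (fun x => ((φ.partProb cls 1 x : ℝ) : ℂ)) * U.conjTranspose := by
    rw [reducedState_eq_ampMatrix (Finset.subset_univ Γ) _ Finset.univ _ φ.vector_eq_sum, ← hM,
      hMU, Matrix.conjTranspose_mul, Matrix.conjTranspose_mul, Matrix.conjTranspose_conjTranspose,
      show U * Matrix.diagonal d * Y.conjTranspose * (Y * ((Matrix.diagonal d).conjTranspose *
        U.conjTranspose)) = U * Matrix.diagonal d * (Y.conjTranspose * Y) *
        (Matrix.diagonal d).conjTranspose * U.conjTranspose by simp only [Matrix.mul_assoc],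
      hYY, Matrix.mul_one, Matrix.diagonal_conjTranspose, Matrix.mul_assoc U,
      Matrix.diagonal_mul_diagonal]
    congr 3
    funext x
    simp only [hd, Pi.star_apply, RCLike.star_def, Complex.conj_ofReal]
    rw [← Complex.ofReal_mul, Real.mul_self_sqrt (φ.partProb_nonneg _ _ _)]
  exact sum_eigenvalues_isometry _ U _ hUU hρ g hg

end SplitWeights

/-! ### The weight of the labels which violate the entropy condition of a competing cut -/

section EntropyCondition

-- the instances on `Cfg D S × Cfg D T` exceed the default size
set_option synthInstance.maxSize 512

variable {V : Type*} [Fintype V] [DecidableEq V] {G : SimpleGraph V} [DecidableRel G.Adj]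
  (φ : LinkState G)

open Classical in
/-- The class of an edge relative to disjoint sets `S`, `T` of vertices: inside `S` it is `0`,
from `S` to the complement of `S ∪ T` it is `1`, from `S` to `T` it is `2`, otherwise it is `3`
if it touches `T` and `4` if not. -/
noncomputable def edgeClass (S T : Finset V) (e : G.edgeSet) : Fin 5 :=
  if Touches S e then (if Touches T e then 2 else if Touches (S ∪ T)ᶜ e then 1 else 0)
  else if Touches T e then 3 else 4

lemma edgeClass_touches_left (S T : Finset V) (e : G.edgeSet) :
    Touches S e ↔ edgeClass S T e = 0 ∨ edgeClass S T e = 1 ∨ edgeClass S T e = 2 := by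
  unfold edgeClass; split_ifs <;> simp_all

lemma edgeClass_touches_right (S T : Finset V) (e : G.edgeSet) :
    Touches T e ↔ edgeClass S T e = 2 ∨ edgeClass S T e = 3 := by
  unfold edgeClass; split_ifs <;> simp_all

/-- An edge has only two end points, so it does not touch three disjoint sets. -/
lemma not_touches_three {S T R : Finset V} (h₁ : Disjoint S T) (h₂ : Disjoint S R)
    (h₃ : Disjoint T R) (e : G.edgeSet) : ¬ (Touches S e ∧ Touches T e ∧ Touches R e) := by
  rw [Finset.disjoint_left] at h₁ h₂ h₃
  obtain ⟨e, he⟩ := e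
  induction e with
  | _ x y =>
    simp only [touches_mk]
    have := @h₁ x; have := @h₁ y; have := @h₂ x; have := @h₂ y; have := @h₃ x; have := @h₃ y
    tauto

lemma touches_union {S T : Finset V} {e : G.edgeSet} :
    Touches (S ∪ T) e ↔ Touches S e ∨ Touches T e := by
  simp only [Touches, Finset.mem_union, and_or_left, exists_or]

lemma edgeClass_touches_rest {S T : Finset V} (h : Disjoint S T) (e : G.edgeSet) :
    (Touches (S ∪ T)ᶜ e → edgeClass S T e = 1 ∨ edgeClass S T e = 3 ∨ edgeClass S T e = 4) ∧
      (edgeClass S T e = 1 ∨ edgeClass S T e = 4 → Touches (S ∪ T)ᶜ e) := by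
  have h1 := not_touches_three h
    (Finset.disjoint_of_subset_left Finset.subset_union_left disjoint_compl_right)
    (Finset.disjoint_of_subset_left Finset.subset_union_right disjoint_compl_right) e
  have h2 := touches_or_compl (S ∪ T) e
  rw [touches_union] at h2
  unfold edgeClass
  split_ifs <;> simp_all

/-- The state on `S` and `T`, with the amplitudes of the full state as a factor. -/
lemma LinkState.bipartiteState_eq {S T : Finset V} (h : Disjoint S T) :
    bipartiteState φ.vector S T =
      ampMatrix Finset.univ (fun a => ((√(φ.weight a) : ℝ) : ℂ))
        (fun a => (halfCfg S a, halfCfg T a)) (halfCfg (Finset.univ \ (S ∪ T))) *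
      (ampMatrix Finset.univ (fun a => ((√(φ.weight a) : ℝ) : ℂ))
        (fun a => (halfCfg S a, halfCfg T a)) (halfCfg (Finset.univ \ (S ∪ T)))).conjTranspose := by
  rw [bipartiteState, reducedState_eq_ampMatrix (Finset.subset_univ _) _ Finset.univ _
    φ.vector_eq_sum]
  have h1 : ∀ p k, ampMatrix Finset.univ (fun a => ((√(φ.weight a) : ℝ) : ℂ))
        (fun a => (halfCfg S a, halfCfg T a)) (halfCfg (Finset.univ \ (S ∪ T))) p k =
      ampMatrix Finset.univ (fun a => ((√(φ.weight a) : ℝ) : ℂ)) (halfCfg (S ∪ T))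
        (halfCfg (Finset.univ \ (S ∪ T))) (Cfg.join (Finset.Subset.refl _) p.1 p.2) k := by
    intro p k
    refine Finset.sum_congr rfl fun a _ => if_congr ?_ rfl rfl
    rw [join_eq_halfCfg_iff _ Finset.subset_union_left Finset.subset_union_right h, Prod.ext_iff]
  ext p q
  simp only [Matrix.submatrix_apply, Matrix.mul_apply, Matrix.conjTranspose_apply, h1]

lemma LinkState.bipartiteState_posSemidef {S T : Finset V} (h : Disjoint S T) :
    (bipartiteState φ.vector S T).PosSemidef := by
  rw [φ.bipartiteState_eq h]
  exact Matrix.posSemidef_self_mul_conjTranspose _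

lemma LinkState.trace_bipartiteState {S T : Finset V} (h : Disjoint S T) :
    (bipartiteState φ.vector S T).trace = 1 := by
  classical
  rw [φ.bipartiteState_eq h, ← hsSq_eq_trace, hsSq_ampMatrix, ← Complex.ofReal_one, ← φ.sum_weight,
    Complex.ofReal_sum]
  refine Finset.sum_congr rfl fun a _ => ?_
  rw [Finset.sum_eq_single a]
  · rw [if_pos ⟨rfl, rfl⟩, Complex.conj_ofReal, ← Complex.ofReal_mul,
      Real.mul_self_sqrt (φ.weight_nonneg a)]
  · intro b _ hb
    refine if_neg fun h' => hb ?_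
    rw [Prod.ext_iff] at h'
    simp only [halfCfg_eq_iff_touches, ← Finset.compl_eq_univ_sdiff] at h'
    funext e
    rcases touches_or_compl (S ∪ T) e with he | he
    · rcases touches_union.1 he with he | he
      · exact (h'.1.1 e he).symm
      · exact (h'.1.2 e he).symm
    · exact (h'.2 e he).symm
  · simp

lemma LinkState.partialWeight_or {p q : G.edgeSet → Prop} (h : ∀ e, p e → ¬ q e)
    (a : EdgeCfg φ.dim) :
    φ.partialWeight (fun e => p e ∨ q e) a = φ.partialWeight p a * φ.partialWeight q a := by
  simp only [LinkState.partialWeight, ← Finset.prod_mul_distrib]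
  refine Finset.prod_congr rfl fun e _ => ?_
  by_cases h1 : p e
  · rw [if_pos (Or.inl h1), if_pos h1, if_neg (h e h1), mul_one]
  · by_cases h2 : q e
    · rw [if_pos (Or.inr h2), if_neg h1, if_pos h2, one_mul]
    · rw [if_neg (not_or.2 ⟨h1, h2⟩), if_neg h1, if_neg h2, one_mul]

open Classical in
/-- If the smooth conditional min-entropy of `S` given `T` is at least `K`, the labels for which the
cut `S ∪ T` does not have a much smaller weight than the cut `T` are improbable. -/
lemma LinkState.sum_le_of_le_smoothMinEntropy {S T : Finset V} (h : Disjoint S T)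
    {ε K θ η : ℝ} (hθ : 0 < θ) (hη : 0 < η) (hK : (K : EReal) ≤ φ.smoothMinEntropy ε S T) :
    ∑ a, (if θ * φ.cutWeight T a < φ.cutWeight (S ∪ T) a then φ.weight a else 0) ≤
      η + (ε ^ 2 + 3 * √(2 ^ (1 - K) / (θ * η))) := by
  obtain ⟨o, -⟩ := φ.exists_edgeCfg
  set cls : G.edgeSet → Fin 5 := edgeClass S T with hcls
  have hl := fun e => edgeClass_touches_left (G := G) S T e
  have hr := fun e => edgeClass_touches_right (G := G) S T e
  have hrest := fun e => edgeClass_touches_rest (G := G) h e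
  rw [← hcls] at hl hr hrest
  set o' := fun j => restrPart cls j o with ho'
  set FS : Part cls φ.dim 0 → Part cls φ.dim 1 → Part cls φ.dim 2 → Cfg φ.dim S :=
    fun x₀ x₁ x₂ => halfCfg S (splitParts cls (x₀, x₁, x₂, o' 3, o' 4)) with hFS
  set FT : Part cls φ.dim 2 → Part cls φ.dim 3 → Cfg φ.dim T :=
    fun x₂ x₃ => halfCfg T (splitParts cls (o' 0, o' 1, x₂, x₃, o' 4)) with hFT
  have hFS' : ∀ {x₀ x₁ x₂ a}, halfCfg S a = FS x₀ x₁ x₂ ↔ restrPart cls 0 a = x₀ ∧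
      restrPart cls 1 a = x₁ ∧ restrPart cls 2 a = x₂ := by
    intro x₀ x₁ x₂ a
    obtain ⟨⟨a₀, a₁, a₂, a₃, a₄⟩, rfl⟩ := (splitParts cls).surjective a
    simp only [hFS, restrPart_splitParts, tupleGet]
    rw [halfCfg_eq_iff_touches, splitParts_congr]
    constructor
    · intro h
      exact ⟨funext fun e => h 0 e ((hl e).2 (Or.inl e.2)),
        funext fun e => h 1 e ((hl e).2 (Or.inr (Or.inl e.2))),
        funext fun e => h 2 e ((hl e).2 (Or.inr (Or.inr e.2)))⟩
    · rintro ⟨rfl, rfl, rfl⟩ j e he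
      rw [hl, e.2] at he
      rcases he with rfl | rfl | rfl <;> rfl
  have hFT' : ∀ {x₂ x₃ a}, halfCfg T a = FT x₂ x₃ ↔ restrPart cls 2 a = x₂ ∧
      restrPart cls 3 a = x₃ := by
    intro x₂ x₃ a
    obtain ⟨⟨a₀, a₁, a₂, a₃, a₄⟩, rfl⟩ := (splitParts cls).surjective a
    simp only [hFT, restrPart_splitParts, tupleGet]
    rw [halfCfg_eq_iff_touches, splitParts_congr]
    constructor
    · intro h
      exact ⟨funext fun e => h 2 e ((hr e).2 (Or.inl e.2)),
        funext fun e => h 3 e ((hr e).2 (Or.inr e.2))⟩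
    · rintro ⟨rfl, rfl⟩ j e he
      rw [hr, e.2] at he
      rcases he with rfl | rfl <;> rfl
  have hent : ∀ x₀ x₁ x₂ x₃ y₀ y₂,
      bipartiteState φ.vector S T (FS x₀ x₁ x₂, FT x₂ x₃) (FS y₀ x₁ y₂, FT y₂ x₃) =
      ((√(φ.partProb cls 0 x₀) * √(φ.partProb cls 2 x₂) *
        (√(φ.partProb cls 0 y₀) * √(φ.partProb cls 2 y₂)) *
        (φ.partProb cls 1 x₁ * φ.partProb cls 3 x₃) : ℝ) : ℂ) := by
    intro x₀ x₁ x₂ x₃ y₀ y₂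
    -- the labels of the edges of the last class are summed over, those of the other classes fixed
    have hset : ((Finset.univ ×ˢ Finset.univ : Finset (EdgeCfg φ.dim × EdgeCfg φ.dim)).filter
          fun p => halfCfg (Finset.univ \ (S ∪ T)) p.1 = halfCfg (Finset.univ \ (S ∪ T)) p.2).filter
        (fun p => (halfCfg S p.1, halfCfg T p.1) = (FS x₀ x₁ x₂, FT x₂ x₃) ∧
          (halfCfg S p.2, halfCfg T p.2) = (FS y₀ x₁ y₂, FT y₂ x₃)) =
        Finset.univ.image fun z : Part cls φ.dim 4 =>
          (splitParts cls (x₀, x₁, x₂, x₃, z), splitParts cls (y₀, x₁, y₂, x₃, z)) := by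
      ext ⟨a, b⟩
      obtain ⟨⟨a₀, a₁, a₂, a₃, a₄⟩, rfl⟩ := (splitParts cls).surjective a
      obtain ⟨⟨b₀, b₁, b₂, b₃, b₄⟩, rfl⟩ := (splitParts cls).surjective b
      simp only [Finset.mem_filter, Finset.mem_product, Finset.mem_univ, true_and, and_self,
        Finset.mem_image, Prod.mk.injEq, hFS', hFT', restrPart_splitParts, tupleGet,
        (splitParts cls).injective.eq_iff]
      constructor
      · rintro ⟨h1, ⟨⟨rfl, rfl, rfl⟩, _, rfl⟩, ⟨rfl, rfl, rfl⟩, _, rfl⟩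
        refine ⟨a₄, ⟨rfl, rfl, rfl, rfl, rfl⟩, rfl, rfl, rfl, rfl, ?_⟩
        rw [halfCfg_eq_iff_touches, ← Finset.compl_eq_univ_sdiff, splitParts_congr] at h1
        exact funext fun e => h1 4 e ((hrest e).2 (Or.inr e.2))
      · rintro ⟨z, ⟨rfl, rfl, rfl, rfl, rfl⟩, rfl, rfl, rfl, rfl, rfl⟩
        refine ⟨?_, by simp, by simp⟩
        rw [halfCfg_eq_iff_touches, ← Finset.compl_eq_univ_sdiff, splitParts_congr]
        intro j e he
        have := (hrest e).1 he
        rw [e.2] at this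
        rcases this with rfl | rfl | rfl <;> rfl
    rw [φ.bipartiteState_eq h, ampMatrix_mul_conjTranspose, ampMatrix, ← Finset.sum_filter, hset,
      Finset.sum_image]
    · rw [← mul_one (φ.partProb cls 1 x₁ * φ.partProb cls 3 x₃), ← φ.sum_partProb cls 4,
        Finset.mul_sum, Finset.mul_sum, Complex.ofReal_sum]
      refine Finset.sum_congr rfl fun z _ => ?_
      rw [Complex.conj_ofReal, ← Complex.ofReal_mul, φ.weight_splitParts, φ.weight_splitParts]
      have hp := φ.partProb_nonneg cls
      rw [Real.sqrt_mul (hp _ _), Real.sqrt_mul (hp _ _), Real.sqrt_mul (hp _ _),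
        Real.sqrt_mul (hp _ _), Real.sqrt_mul (hp _ _), Real.sqrt_mul (hp _ _),
        Real.sqrt_mul (hp _ _), Real.sqrt_mul (hp _ _)]
      congr 1
      calc _ = √(φ.partProb cls 0 x₀) * √(φ.partProb cls 2 x₂) *
            (√(φ.partProb cls 0 y₀) * √(φ.partProb cls 2 y₂)) *
            ((√(φ.partProb cls 1 x₁) * √(φ.partProb cls 1 x₁)) *
            (√(φ.partProb cls 3 x₃) * √(φ.partProb cls 3 x₃)) *
            (√(φ.partProb cls 4 z) * √(φ.partProb cls 4 z))) := by ring
        _ = _ := by simp only [Real.mul_self_sqrt (hp _ _)]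
    · intro z _ z' _ hz
      have := (splitParts cls).injective (congrArg Prod.fst hz)
      simpa using this
  have hmain := sum_le_of_le_smoothCondMinEntropy (φ.partProb_nonneg cls 0)
    (φ.partProb_nonneg cls 1) (φ.partProb_nonneg cls 2) (φ.sum_partProb cls 0)
    (φ.sum_partProb cls 1) (φ.sum_partProb cls 2) (φ.sum_partProb cls 3) FS FT
    (fun {x₀ x₁ x₂ y₀ y₁ y₂} h => by
      have h1 := hFS'.1 h
      simpa only [restrPart_splitParts, tupleGet] using h1)
    (fun {x₂ x₃ y₂ y₃} h => by
      have h1 := hFT'.1 h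
      simpa only [restrPart_splitParts, tupleGet] using h1)
    (φ.bipartiteState_posSemidef h) (φ.trace_bipartiteState h) hent hθ hη hK
  refine le_trans ?_ hmain
  -- the weights of the edges from `T` to the complement of `S ∪ T` cancel in the comparison
  have hR : ∀ e : G.edgeSet, ¬ (Touches S e ∧ Touches T e ∧ Touches (S ∪ T)ᶜ e) := not_touches_three h
    (Finset.disjoint_of_subset_left Finset.subset_union_left disjoint_compl_right)
    (Finset.disjoint_of_subset_left Finset.subset_union_right disjoint_compl_right)
  have hT : Tᶜ = S ∪ (S ∪ T)ᶜ := by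
    ext x
    have := fun hx : x ∈ S => Finset.disjoint_left.1 h hx
    simp only [Finset.mem_compl, Finset.mem_union]
    tauto
  have hcr1 : Crosses (G := G) (S ∪ T) =
      fun e => cls e = 1 ∨ (Touches T e ∧ Touches (S ∪ T)ᶜ e) := by
    funext e
    have h1 := hR e
    rw [crosses_iff_touches, touches_union, hcls, edgeClass, eq_iff_iff]
    generalize Touches (S ∪ T)ᶜ e = q at h1 ⊢
    by_cases hs : Touches S e <;> by_cases ht : Touches T e <;> by_cases hq : q <;>
      simp [hs, ht, hq] at h1 ⊢
  have hcr2 : Crosses (G := G) T =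
      fun e => cls e = 2 ∨ (Touches T e ∧ Touches (S ∪ T)ᶜ e) := by
    funext e
    have h1 := hR e
    rw [crosses_iff_touches, hT, touches_union, hcls, edgeClass, eq_iff_iff]
    generalize Touches (S ∪ T)ᶜ e = q at h1 ⊢
    by_cases hs : Touches S e <;> by_cases ht : Touches T e <;> by_cases hq : q <;>
      simp [hs, ht, hq] at h1 ⊢
  have hex : ∀ e, (cls e = 1 ∨ cls e = 2) → ¬ (Touches T e ∧ Touches (S ∪ T)ᶜ e) := by
    intro e he h'
    rcases he with he | he
    · exact hR e ⟨(hl e).2 (Or.inr (Or.inl he)), h'⟩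
    · exact hR e ⟨(hl e).2 (Or.inr (Or.inr he)), h'⟩
  calc ∑ a, (if θ * φ.cutWeight T a < φ.cutWeight (S ∪ T) a then φ.weight a else 0)
      ≤ ∑ a, (if θ * φ.partProb cls 2 (restrPart cls 2 a) < φ.partProb cls 1 (restrPart cls 1 a)
          then φ.weight a else 0) := by
        refine Finset.sum_le_sum fun a _ => ?_
        rw [LinkState.cutWeight, LinkState.cutWeight, hcr1, hcr2,
          φ.partialWeight_or fun e he => hex e (Or.inl he),
          φ.partialWeight_or fun e he => hex e (Or.inr he),
          φ.partialWeight_eq_partProb cls (j := 1) fun e => Iff.rfl,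
          φ.partialWeight_eq_partProb cls (j := 2) fun e => Iff.rfl, ← mul_assoc]
        split_ifs with h1 h2
        · exact le_rfl
        · exact absurd (lt_of_mul_lt_mul_right h1 (φ.partialWeight_nonneg _ _)) h2
        · exact φ.weight_nonneg a
        · exact le_rfl
    _ = ∑ x₁, ∑ x₂, (if θ * φ.partProb cls 2 x₂ < φ.partProb cls 1 x₁ then
          φ.partProb cls 1 x₁ * φ.partProb cls 2 x₂ else 0) := by
        rw [← (splitParts cls).sum_comp]
        simp only [restrPart_splitParts, tupleGet, φ.weight_splitParts, Fintype.sum_prod_type]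
        have h1 : ∀ x₀ x₁ x₂, ∑ x₃, ∑ x₄,
            (if θ * φ.partProb cls 2 x₂ < φ.partProb cls 1 x₁ then φ.partProb cls 0 x₀ *
              (φ.partProb cls 1 x₁ * (φ.partProb cls 2 x₂ *
                (φ.partProb cls 3 x₃ * φ.partProb cls 4 x₄))) else 0) =
            φ.partProb cls 0 x₀ * (if θ * φ.partProb cls 2 x₂ < φ.partProb cls 1 x₁ then
              φ.partProb cls 1 x₁ * φ.partProb cls 2 x₂ else 0) := by
          intro x₀ x₁ x₂
          split_ifs
          · simp only [← Finset.mul_sum, φ.sum_partProb, mul_one]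
          · simp
        simp only [h1, ← Finset.mul_sum, ← Finset.sum_mul, φ.sum_partProb, one_mul]

lemma LinkState.cutWeight_compl (Γ : Finset V) (a : EdgeCfg φ.dim) :
    φ.cutWeight Γᶜ a = φ.cutWeight Γ a := by
  have h : Crosses (G := G) Γᶜ = Crosses Γ := by
    funext e
    rw [crosses_iff_touches, crosses_iff_touches, compl_compl, and_comm]
  rw [LinkState.cutWeight, h, LinkState.cutWeight]

open Classical in
/-- Most labels are good for a pair of minimal cuts: the entropy conditions hold for finitely many
competing cuts. -/
lemma LinkState.sum_not_isGood_le {bdry A Γ₁ Γ₂ : Finset V} {ε K θ η : ℝ} (hθ : 0 < θ) (hη : 0 < η)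
    (h : IsMinimalCutPair φ bdry A Γ₁ Γ₂ ε K) :
    ∑ a, (if φ.IsGood bdry A Γ₁ Γ₂ θ a then 0 else φ.weight a) ≤
      3 * Fintype.card (Finset V) * (η + (ε ^ 2 + 3 * √(2 ^ (1 - K) / (θ * η)))) := by
  set B := η + (ε ^ 2 + 3 * √(2 ^ (1 - K) / (θ * η))) with hB
  have hB0 : 0 ≤ B := by positivity
  obtain ⟨h1, h2, h3⟩ := h
  have hb : ∀ (Γ Δ : Finset V) (p : Prop) [Decidable p], (p → ∑ a, (if θ * φ.cutWeight Γ a < φ.cutWeight Δ a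
      then φ.weight a else 0) ≤ B) →
      ∑ a, (if p ∧ θ * φ.cutWeight Γ a < φ.cutWeight Δ a then φ.weight a else 0) ≤ B := by
    intro Γ Δ p _ hp
    by_cases hp' : p
    · simpa only [hp', true_and] using hp hp'
    · simpa [hp'] using hB0
  calc ∑ a, (if φ.IsGood bdry A Γ₁ Γ₂ θ a then 0 else φ.weight a)
      ≤ ∑ a, ∑ Δ : Finset V,
        ((if (IsCut bdry A Δ ∧ Δ ⊂ Γ₁) ∧ θ * φ.cutWeight Γ₁ a < φ.cutWeight Δ a
          then φ.weight a else 0) +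
        (if (IsCut bdry A Δ ∧ Γ₂ ⊂ Δ) ∧ θ * φ.cutWeight Γ₂ a < φ.cutWeight Δ a
          then φ.weight a else 0) +
        (if (IsCut bdry A Δ ∧ Γ₁ ⊂ Δ ∧ Δ ⊂ Γ₂) ∧ θ * φ.cutWeight Γ₁ a < φ.cutWeight Δ a
          then φ.weight a else 0)) := by
        refine Finset.sum_le_sum fun a _ => ?_
        have hw := φ.weight_nonneg a
        have hi : ∀ (p : Prop) [Decidable p], 0 ≤ if p then φ.weight a else 0 := fun p _ => by
          split_ifs; exacts [hw, le_rfl]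
        have hnn : ∀ Δ ∈ (Finset.univ : Finset (Finset V)), 0 ≤
            (if (IsCut bdry A Δ ∧ Δ ⊂ Γ₁) ∧ θ * φ.cutWeight Γ₁ a < φ.cutWeight Δ a
              then φ.weight a else 0) +
            (if (IsCut bdry A Δ ∧ Γ₂ ⊂ Δ) ∧ θ * φ.cutWeight Γ₂ a < φ.cutWeight Δ a
              then φ.weight a else 0) +
            (if (IsCut bdry A Δ ∧ Γ₁ ⊂ Δ ∧ Δ ⊂ Γ₂) ∧ θ * φ.cutWeight Γ₁ a < φ.cutWeight Δ a
              then φ.weight a else 0) :=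
          fun Δ _ => add_nonneg (add_nonneg (hi _) (hi _)) (hi _)
        split_ifs with hg
        · exact Finset.sum_nonneg hnn
        · have : ∃ Δ : Finset V, ((IsCut bdry A Δ ∧ Δ ⊂ Γ₁) ∧
              θ * φ.cutWeight Γ₁ a < φ.cutWeight Δ a) ∨
              ((IsCut bdry A Δ ∧ Γ₂ ⊂ Δ) ∧ θ * φ.cutWeight Γ₂ a < φ.cutWeight Δ a) ∨
              ((IsCut bdry A Δ ∧ Γ₁ ⊂ Δ ∧ Δ ⊂ Γ₂) ∧
                θ * φ.cutWeight Γ₁ a < φ.cutWeight Δ a) := by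
            by_contra hc
            push Not at hc
            exact hg ⟨fun Δ hΔ h => (hc Δ).1 ⟨hΔ, h⟩, fun Δ hΔ h => (hc Δ).2.1 ⟨hΔ, h⟩,
              fun Δ hΔ h h' => (hc Δ).2.2 ⟨hΔ, h, h'⟩⟩
          obtain ⟨Δ, hΔ⟩ := this
          refine le_trans ?_ (Finset.single_le_sum hnn (Finset.mem_univ Δ))
          rcases hΔ with hΔ | hΔ | hΔ
          · rw [if_pos hΔ, add_assoc]
            exact le_add_of_nonneg_right (add_nonneg (hi _) (hi _))
          · rw [if_pos hΔ, add_right_comm]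
            exact le_add_of_nonneg_left (add_nonneg (hi _) (hi _))
          · rw [if_pos hΔ]
            exact le_add_of_nonneg_left (add_nonneg (hi _) (hi _))
    _ ≤ ∑ _Δ : Finset V, (B + B + B) := by
        rw [Finset.sum_comm]
        refine Finset.sum_le_sum fun Δ _ => ?_
        rw [Finset.sum_add_distrib, Finset.sum_add_distrib]
        refine add_le_add (add_le_add ?_ ?_) ?_
        · refine hb Γ₁ Δ (IsCut bdry A Δ ∧ Δ ⊂ Γ₁) fun ⟨hΔ, hs⟩ => ?_
          have h4 := φ.sum_le_of_le_smoothMinEntropy (Finset.disjoint_of_subset_left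
            Finset.sdiff_subset disjoint_compl_right) hθ hη (h1 Δ hΔ hs)
          rw [show Γ₁ \ Δ ∪ Γ₁ᶜ = Δᶜ by
            ext x
            have := @hs.1 x
            simp only [Finset.mem_union, Finset.mem_sdiff, Finset.mem_compl]
            tauto] at h4
          simpa only [φ.cutWeight_compl] using h4
        · refine hb Γ₂ Δ (IsCut bdry A Δ ∧ Γ₂ ⊂ Δ) fun ⟨hΔ, hs⟩ => ?_
          have h4 := φ.sum_le_of_le_smoothMinEntropy Finset.sdiff_disjoint hθ hη (h2 Δ hΔ hs)
          rwa [Finset.sdiff_union_of_subset hs.1] at h4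
        · refine hb Γ₁ Δ (IsCut bdry A Δ ∧ Γ₁ ⊂ Δ ∧ Δ ⊂ Γ₂) fun ⟨hΔ, hs, hs'⟩ => ?_
          have h4 := φ.sum_le_of_le_smoothMinEntropy Finset.sdiff_disjoint hθ hη (h3 Δ hΔ hs hs').1
          rwa [Finset.sdiff_union_of_subset hs.1] at h4
    _ = _ := by
        rw [Finset.sum_const, Finset.card_univ, nsmul_eq_mul]
        ring

end EntropyCondition

/-! ### Distribution functions and weak convergence -/

section DistributionFunctions

/-- Weak convergence is controlled by finitely many values of the distribution function and the
total mass. -/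
lemma exists_finset_integral_close (ν : Measure ℝ) [IsProbabilityMeasure ν]
    (f : BoundedContinuousFunction ℝ ℝ) {δ : ℝ} (hδ : 0 < δ) :
    ∃ X : Finset ℝ, ∃ η : ℝ, 0 < η ∧ ∀ μ : Measure ℝ, IsFiniteMeasure μ →
      (∀ x ∈ X, |μ.real (Set.Iic x) - ν.real (Set.Iic x)| < η) → |μ.real Set.univ - 1| < η →
      |(∫ x, f x ∂μ) - ∫ x, f x ∂ν| < δ := by
  by_contra! hcon
  -- otherwise there is a sequence of measures whose distribution functions converge at all
  -- rational points, while the integrals stay away from the limit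
  obtain ⟨q, hq⟩ := exists_surjective_nat ℚ
  set X : ℕ → Finset ℝ := fun m => (Finset.range (m + 1)).image fun j => (q j : ℝ) with hX
  set η : ℕ → ℝ := fun m => 1 / ((m : ℝ) + 1) with hη
  have hη0 : ∀ m, 0 < η m := fun m => Nat.one_div_pos_of_nat
  have hηt : Tendsto η atTop (𝓝 0) := tendsto_one_div_add_atTop_nhds_zero_nat
  choose μ hμf hμX hμ1 hμδ using fun m => hcon (X m) (η m) (hη0 m)
  have hIic : ∀ r : ℚ, Tendsto (fun m => (μ m).real (Set.Iic (r : ℝ))) atTop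
      (𝓝 (ν.real (Set.Iic (r : ℝ)))) := by
    intro r
    obtain ⟨j, rfl⟩ := hq r
    rw [tendsto_iff_dist_tendsto_zero]
    refine squeeze_zero' (Eventually.of_forall fun _ => dist_nonneg) ?_ hηt
    filter_upwards [eventually_ge_atTop j] with m hm
    refine (hμX m _ ?_).le
    exact Finset.mem_image.2 ⟨j, Finset.mem_range.2 (by omega), rfl⟩
  have hmass : Tendsto (fun m => (μ m).real Set.univ) atTop (𝓝 1) := by
    rw [tendsto_iff_dist_tendsto_zero]
    exact squeeze_zero (fun _ => dist_nonneg) (fun m => (hμ1 m).le) hηt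
  set F : ℕ → FiniteMeasure ℝ := fun m => ⟨μ m, hμf m⟩ with hF
  set N : FiniteMeasure ℝ := ⟨ν, inferInstance⟩ with hN
  have hFr : ∀ m s, ((F m s : NNReal) : ℝ) = (μ m).real s := fun m s => rfl
  have hNr : ∀ s, ((N s : NNReal) : ℝ) = ν.real s := fun s => rfl
  have hmassF : ∀ m, ((F m).mass : ℝ) = (μ m).real Set.univ := fun m => rfl
  have hmassN : N.mass = 1 := by
    rw [← NNReal.coe_inj]
    exact (hNr Set.univ).trans (by simp)
  have hN0 : N ≠ 0 := by
    rw [← FiniteMeasure.mass_nonzero_iff, hmassN]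
    exact one_ne_zero
  have hlim : Tendsto F atTop (𝓝 N) := by
    rw [← FiniteMeasure.tendsto_normalize_iff_tendsto hN0]
    constructor
    · have hne : ∀ᶠ m in atTop, F m ≠ 0 := by
        filter_upwards [hmass.eventually_ne (one_ne_zero)] with m hm h0
        rw [← hmassF, h0] at hm
        exact hm (by simp)
      have hIicN : ∀ r : ℚ, Tendsto (fun m => ((F m).normalize (Set.Iic (r : ℝ)) : ℝ)) atTop
          (𝓝 ((N.normalize (Set.Iic (r : ℝ)) : NNReal) : ℝ)) := by
        intro r
        rw [FiniteMeasure.normalize_eq_of_nonzero _ hN0, hmassN, inv_one, one_mul, hNr,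
          ← one_mul (ν.real _), ← inv_one]
        refine ((hmass.inv₀ one_ne_zero).mul (hIic r)).congr' ?_
        filter_upwards [hne] with m hm
        rw [FiniteMeasure.normalize_eq_of_nonzero _ hm, NNReal.coe_mul, NNReal.coe_inv, hmassF, hFr]
      refine (isPiSystem_Ioc (fun r : ℚ => (r : ℝ)) (fun r : ℚ => (r : ℝ))
        ).tendsto_probabilityMeasure_of_tendsto_of_mem ?_ ?_ ?_
      · rintro s ⟨i, j, -, rfl⟩
        exact measurableSet_Ioc
      · intro u hu x hx
        obtain ⟨e, he, heu⟩ := Metric.isOpen_iff.1 hu x hx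
        obtain ⟨p, hp1, hp2⟩ := exists_rat_btwn (show x - e < x by linarith)
        obtain ⟨q, hq1, hq2⟩ := exists_rat_btwn (show x < x + e by linarith)
        refine ⟨Set.Ioc p q, ⟨p, q, hp2.trans hq1, rfl⟩, Ioc_mem_nhds hp2 hq1, fun y hy => heu ?_⟩
        rw [Metric.mem_ball, Real.dist_eq, abs_lt]
        constructor <;> linarith [hy.1, hy.2]
      · rintro s ⟨i, j, hij, rfl⟩
        rw [← NNReal.tendsto_coe]
        have hIoc : ∀ P : ProbabilityMeasure ℝ, ((P (Set.Ioc (i : ℝ) j) : NNReal) : ℝ) =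
            P (Set.Iic (j : ℝ)) - P (Set.Iic (i : ℝ)) := by
          intro P
          rw [show Set.Ioc (i : ℝ) j = Set.Iic (j : ℝ) \ Set.Iic (i : ℝ) by
            ext y; simp]
          exact measureReal_sdiff (μ := (P : Measure ℝ)) (Set.Iic_subset_Iic.2 hij.le)
            measurableSet_Iic
        simp only [hIoc]
        exact (hIicN j).sub (hIicN i)
    · rw [hmassN, ← NNReal.tendsto_coe]
      exact hmass
  have h1 := FiniteMeasure.tendsto_iff_forall_integral_tendsto.1 hlim f
  have h2 := (Metric.tendsto_nhds.1 h1 δ hδ).exists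
  obtain ⟨m, hm⟩ := h2
  exact absurd (hμδ m) (not_le.2 hm)

instance isProbabilityMeasure_minPushforward (ν₁ ν₂ : Measure ℝ) [IsProbabilityMeasure ν₁]
    [IsProbabilityMeasure ν₂] : IsProbabilityMeasure (minPushforward ν₁ ν₂) :=
  Measure.isProbabilityMeasure_map (by fun_prop)

lemma minPushforward_real_Iic (ν₁ ν₂ : Measure ℝ) [IsProbabilityMeasure ν₁]
    [IsProbabilityMeasure ν₂] (x : ℝ) : (minPushforward ν₁ ν₂).real (Set.Iic x) =
      1 - (1 - cdf ν₁ x) * (1 - cdf ν₂ x) := by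
  have h : ∀ (ν : Measure ℝ) [IsProbabilityMeasure ν], ν.real (Set.Ioi x) = 1 - cdf ν x := by
    intro ν _
    rw [cdf_eq_real, ← Set.compl_Iic, probReal_compl_eq_one_sub measurableSet_Iic]
  have h2 := probReal_compl_eq_one_sub (μ := minPushforward ν₁ ν₂) (measurableSet_Iic (a := x))
  have h3 : (minPushforward ν₁ ν₂).real (Set.Iic x)ᶜ = ν₁.real (Set.Ioi x) * ν₂.real (Set.Ioi x) := by
    rw [Set.compl_Iic, minPushforward, map_measureReal_apply (by fun_prop) measurableSet_Ioi,
      ← measureReal_prod_prod]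
    congr 1
    ext p
    simp
  rw [h3, h, h] at h2
  linarith

/-- If a sequence of probability measures converges weakly to a measure with a continuous
distribution function, the distribution functions converge pointwise. -/
lemma WeaklyConverges.tendsto_real_Iic {μ : ℕ → Measure ℝ} {ν : Measure ℝ}
    [∀ k, IsProbabilityMeasure (μ k)] [IsProbabilityMeasure ν] (h : WeaklyConverges μ ν)
    (hν : Continuous (cdf ν)) (x : ℝ) :
    Tendsto (fun k => (μ k).real (Set.Iic x)) atTop (𝓝 (cdf ν x)) := by
  let P : ℕ → ProbabilityMeasure ℝ := fun k => ⟨μ k, inferInstance⟩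
  let Q : ProbabilityMeasure ℝ := ⟨ν, inferInstance⟩
  have h1 : Tendsto P atTop (𝓝 Q) := ProbabilityMeasure.tendsto_iff_forall_integral_tendsto.2 h
  have h2 : ν {x} = 0 := by
    rw [← measure_cdf ν, StieltjesFunction.measure_singleton, ENNReal.ofReal_eq_zero,
      hν.continuousAt.continuousWithinAt.leftLim_eq, sub_self]
  have h3 := ProbabilityMeasure.tendsto_measure_of_null_frontier_of_tendsto' h1
    (E := Set.Iic x) (by rw [frontier_Iic]; exact h2)
  rw [cdf_eq_real]
  exact (ENNReal.tendsto_toReal (measure_ne_top ν _)).comp h3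

end DistributionFunctions

/-! ### The spectral measures -/

section SpectralMeasures

/-- The eigenvalue which corresponds to the point `x` of the rescaled logarithmic scale. -/
noncomputable def threshold (n : ℕ) (h x : ℝ) : ℝ := 2 ^ (-(h + x * √(n : ℝ)))

lemma threshold_pos (n : ℕ) (h x : ℝ) : 0 < threshold n h x := Real.rpow_pos_of_pos two_pos _

variable {a : Type*} [Fintype a] [DecidableEq a] {M : Matrix a a ℂ} (hM : M.IsHermitian)

instance (n : ℕ) (h : ℝ) : IsFiniteMeasure (spectralLogMeasure hM n h) := by
  have : ∀ i, IsFiniteMeasure (ENNReal.ofReal (hM.eigenvalues i) •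
      Measure.dirac ((1 / √(n : ℝ)) * (Real.logb 2 (1 / hM.eigenvalues i) - h))) :=
    fun i => Measure.smul_finite _ ENNReal.ofReal_ne_top
  unfold spectralLogMeasure
  infer_instance

lemma log_le_iff_threshold_le {n : ℕ} (hn : 0 < n) (h x : ℝ) {l : ℝ} (hl : 0 < l) :
    (1 / √(n : ℝ)) * (Real.logb 2 (1 / l) - h) ≤ x ↔ threshold n h x ≤ l := by
  have hs : 0 < √(n : ℝ) := Real.sqrt_pos.2 (Nat.cast_pos.2 hn)
  rw [threshold, ← Real.le_logb_iff_rpow_le one_lt_two hl, one_div, inv_mul_le_iff₀ hs, one_div,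
    Real.logb_inv]
  constructor <;> intro <;> linarith

lemma spectralLogMeasure_real_Iic (hpos : ∀ i, 0 ≤ hM.eigenvalues i) {n : ℕ} (hn : 0 < n)
    (h x : ℝ) : (spectralLogMeasure hM n h).real (Set.Iic x) =
      ∑ i with threshold n h x ≤ hM.eigenvalues i, hM.eigenvalues i := by
  rw [Measure.real, spectralLogMeasure, Measure.finsetSum_apply, ENNReal.toReal_sum fun i _ => by
    rw [Measure.smul_apply, smul_eq_mul]
    exact ENNReal.mul_ne_top ENNReal.ofReal_ne_top (measure_ne_top _ _), Finset.sum_filter]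
  refine Finset.sum_congr rfl fun i _ => ?_
  rw [Measure.smul_apply, smul_eq_mul, ENNReal.toReal_mul, ENNReal.toReal_ofReal (hpos i),
    Measure.dirac_apply' _ measurableSet_Iic]
  rcases (hpos i).eq_or_lt with h0 | h0
  · simp [← h0]
  · have := log_le_iff_threshold_le hn h x h0
    by_cases h1 : threshold n h x ≤ hM.eigenvalues i
    · rw [Set.indicator_of_mem (Set.mem_Iic.2 (this.2 h1)), if_pos h1]
      simp
    · rw [Set.indicator_of_notMem (fun h2 => h1 (this.1 (Set.mem_Iic.1 h2))), if_neg h1]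
      simp

lemma spectralLogMeasure_real_univ (hpos : ∀ i, 0 ≤ hM.eigenvalues i) (n : ℕ) (h : ℝ) :
    (spectralLogMeasure hM n h).real Set.univ = ∑ i, hM.eigenvalues i := by
  rw [Measure.real, spectralLogMeasure, Measure.finsetSum_apply, ENNReal.toReal_sum fun i _ => by
    rw [Measure.smul_apply, smul_eq_mul]
    exact ENNReal.mul_ne_top ENNReal.ofReal_ne_top (measure_ne_top _ _)]
  refine Finset.sum_congr rfl fun i _ => ?_
  rw [Measure.smul_apply, smul_eq_mul, measure_univ, mul_one, ENNReal.toReal_ofReal (hpos i)]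

end SpectralMeasures

section CutMeasures

variable {V : Type*} [Fintype V] [DecidableEq V] {G : SimpleGraph V} [DecidableRel G.Adj]
  (φ : LinkState G)

/-- The probability of the labels whose cut weight is below `t`. -/
noncomputable def LinkState.lowProb (Γ : Finset V) (t : ℝ) : ℝ :=
  ∑ a, if φ.cutWeight Γ a < t then φ.weight a else 0

lemma LinkState.eigenvalues_reducedState_nonneg (Γ : Finset V) (i : Cfg φ.dim Γ) :
    0 ≤ (reducedState_isHermitian φ.vector Γ).eigenvalues i := by
  have h : (reducedState φ.vector Γ).PosSemidef := by
    rw [reducedState_eq_ampMatrix (Finset.subset_univ Γ) _ Finset.univ _ φ.vector_eq_sum]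
    exact Matrix.posSemidef_self_mul_conjTranspose _
  exact h.eigenvalues_nonneg i

/-- The spectrum of `φ_Γ`, weighted by itself, is the distribution of the cut weight. -/
lemma LinkState.sum_eigenvalues_mul (Γ : Finset V) (g : ℝ → ℝ) :
    ∑ i, (reducedState_isHermitian φ.vector Γ).eigenvalues i *
      g ((reducedState_isHermitian φ.vector Γ).eigenvalues i) =
    ∑ a, φ.weight a * g (φ.cutWeight Γ a) := by
  rw [φ.sum_eigenvalues_reducedState Γ (fun l => l * g l) (zero_mul _),
    ← (splitParts (cutClass Γ)).sum_comp]
  simp only [LinkState.cutWeight, φ.partialWeight_eq_partProb (cutClass Γ) (cutClass_crosses Γ),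
    restrPart_splitParts, tupleGet, φ.weight_splitParts, Fintype.sum_prod_type]
  have h1 : ∀ x₀ x₁ x₂ x₃ x₄, φ.partProb (cutClass Γ) 0 x₀ * (φ.partProb (cutClass Γ) 1 x₁ *
      (φ.partProb (cutClass Γ) 2 x₂ * (φ.partProb (cutClass Γ) 3 x₃ *
        φ.partProb (cutClass Γ) 4 x₄))) * g (φ.partProb (cutClass Γ) 1 x₁) =
      φ.partProb (cutClass Γ) 0 x₀ * ((φ.partProb (cutClass Γ) 1 x₁ *
        g (φ.partProb (cutClass Γ) 1 x₁)) * (φ.partProb (cutClass Γ) 2 x₂ *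
        (φ.partProb (cutClass Γ) 3 x₃ * φ.partProb (cutClass Γ) 4 x₄))) := by
    intros; ring
  simp only [h1, ← Finset.mul_sum, φ.sum_partProb, mul_one]
  rw [← Finset.sum_mul, φ.sum_partProb, one_mul]

instance (Γ : Finset V) (n : ℕ) (h : ℝ) : IsProbabilityMeasure (cutMeasure φ Γ n h) := by
  have h1 : IsFiniteMeasure (cutMeasure φ Γ n h) := by unfold cutMeasure; infer_instance
  have h2 := spectralLogMeasure_real_univ _ (φ.eigenvalues_reducedState_nonneg Γ) n h
  have h3 := φ.sum_eigenvalues_mul Γ fun _ => 1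
  simp only [mul_one, φ.sum_weight] at h3
  rw [h3] at h2
  exact ⟨(ENNReal.toReal_eq_one_iff _).1 h2⟩

lemma LinkState.lowProb_threshold (Γ : Finset V) {n : ℕ} (hn : 0 < n) (h x : ℝ) :
    φ.lowProb Γ (threshold n h x) = 1 - (cutMeasure φ Γ n h).real (Set.Iic x) := by
  rw [cutMeasure, spectralLogMeasure_real_Iic _ (φ.eigenvalues_reducedState_nonneg Γ) hn,
    Finset.sum_filter]
  have h1 := φ.sum_eigenvalues_mul Γ fun l => if threshold n h x ≤ l then 1 else 0
  simp only [mul_ite, mul_one, mul_zero] at h1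
  rw [h1, ← φ.sum_weight, LinkState.lowProb, ← Finset.sum_sub_distrib]
  refine Finset.sum_congr rfl fun a _ => ?_
  by_cases h2 : threshold n h x ≤ φ.cutWeight Γ a
  · rw [if_neg (not_lt.2 h2), if_pos h2, sub_self]
  · rw [if_pos (not_le.1 h2), if_neg h2, sub_zero]

/-- Functions of the labels of disjoint sets of edges are independent: the two copies of the labels
can be exchanged on one of the sets. -/
lemma LinkState.sum_weight_mul_mul (p : G.edgeSet → Prop) (f g : EdgeCfg φ.dim → ℝ)
    (hf : ∀ a b, (∀ e, p e → a e = b e) → f a = f b)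
    (hg : ∀ a b, (∀ e, ¬ p e → a e = b e) → g a = g b) :
    ∑ a, φ.weight a * (f a * g a) = (∑ a, φ.weight a * f a) * ∑ a, φ.weight a * g a := by
  classical
  let mix : EdgeCfg φ.dim → EdgeCfg φ.dim → EdgeCfg φ.dim := fun a b e => if p e then a e else b e
  have hmm : ∀ a b, mix (mix a b) (mix b a) = a := fun a b => by
    funext e; by_cases h : p e <;> simp [mix, h]
  let σ : EdgeCfg φ.dim × EdgeCfg φ.dim ≃ EdgeCfg φ.dim × EdgeCfg φ.dim :=
    { toFun := fun q => (mix q.1 q.2, mix q.2 q.1)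
      invFun := fun q => (mix q.1 q.2, mix q.2 q.1)
      left_inv := fun q => Prod.ext (hmm _ _) (hmm _ _)
      right_inv := fun q => Prod.ext (hmm _ _) (hmm _ _) }
  have hw : ∀ a b, φ.weight (mix a b) * φ.weight (mix b a) = φ.weight a * φ.weight b := by
    intro a b
    simp only [LinkState.weight, ← Finset.prod_mul_distrib]
    refine Finset.prod_congr rfl fun e _ => ?_
    by_cases h : p e
    · simp [mix, h]
    · simp [mix, h, mul_comm]
  rw [Finset.sum_mul_sum, ← Fintype.sum_prod_type', ← σ.sum_comp, Fintype.sum_prod_type]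
  refine Finset.sum_congr rfl fun a _ => ?_
  calc φ.weight a * (f a * g a) = ∑ b, φ.weight b * (φ.weight a * (f a * g a)) := by
        rw [← Finset.sum_mul, φ.sum_weight, one_mul]
    _ = _ := by
        refine Finset.sum_congr rfl fun b _ => ?_
        have h1 : f (mix a b) = f a := hf _ _ fun e he => by simp [mix, he]
        have h2 : g (mix b a) = g a := hg _ _ fun e he => by simp [mix, he]
        change _ = φ.weight (mix a b) * f (mix a b) * (φ.weight (mix b a) * g (mix b a))
        rw [h1, h2, mul_mul_mul_comm, hw]
        ring

/-- The cuts have no common edge, so their weights are independent. -/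
lemma LinkState.sum_low_low {Γ₁ Γ₂ : Finset V}
    (hdisj : Disjoint (cutEdges G Γ₁) (cutEdges G Γ₂)) (t : ℝ) :
    ∑ a, (if φ.cutWeight Γ₁ a < t ∧ φ.cutWeight Γ₂ a < t then φ.weight a else 0) =
      φ.lowProb Γ₁ t * φ.lowProb Γ₂ t := by
  have h := φ.sum_weight_mul_mul (Crosses Γ₁)
    (fun a => if φ.cutWeight Γ₁ a < t then 1 else 0)
    (fun a => if φ.cutWeight Γ₂ a < t then 1 else 0)
    (fun a b h => by
      have h1 : φ.cutWeight Γ₁ a = φ.cutWeight Γ₁ b := φ.partialWeight_congr h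
      simp only [h1])
    (fun a b h => by
      have h1 : φ.cutWeight Γ₂ a = φ.cutWeight Γ₂ b := φ.partialWeight_congr fun e he =>
        h e fun h1 => Set.disjoint_left.1 hdisj (show (e : Sym2 V) ∈ cutEdges G Γ₁ from ⟨e.2, h1⟩)
          ⟨e.2, he⟩
      simp only [h1])
  simp only [mul_ite, mul_one, mul_zero] at h
  rw [LinkState.lowProb, LinkState.lowProb, ← h]
  refine Finset.sum_congr rfl fun a _ => ?_
  by_cases h1 : φ.cutWeight Γ₁ a < t <;> by_cases h2 : φ.cutWeight Γ₂ a < t <;> simp [h1, h2]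

end CutMeasures

/-! ### Rank of the part of the state with large cut weights -/

section NetworkRank

variable {V : Type*} [Fintype V] [DecidableEq V] {G : SimpleGraph V} [DecidableRel G.Adj]
  (φ : LinkState G)

lemma rank_add_le_rank_add_rank {m n : Type*} [Fintype m] [Fintype n] (M N : Matrix m n ℂ) :
    (M + N).rank ≤ M.rank + N.rank := by
  rw [Matrix.rank, Matrix.mulVecLin_add]
  refine le_trans (Submodule.finrank_mono ?_) (Submodule.finrank_add_le_finrank_add_finrank
    (LinearMap.range M.mulVecLin) (LinearMap.range N.mulVecLin))
  rintro _ ⟨v, rfl⟩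
  exact Submodule.add_mem_sup ⟨v, rfl⟩ ⟨v, rfl⟩

open Classical in
/-- The bulk tensors and the link states factor across a cut, so that the part of the network state
with cut weights at least `t` has a rank of at most `1 / t`. -/
lemma LinkState.rank_netMatrix_mul_le {bdry A Γ : Finset V} (hΓ : IsCut bdry A Γ)
    {T : Finset (EdgeCfg φ.dim)} (hT : ∀ a b, (∀ e, Touches Γ e → a e = b e) → (a ∈ T ↔ b ∈ T))
    {t : ℝ} (ht : 0 ≤ t) (hTt : ∀ a ∈ T, t ≤ φ.cutWeight Γ a) (ψ : BulkTensors φ.dim bdry) :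
    (φ.netMatrix bdry A T ψ).rank * t ≤ 1 := by
  have hA : A ⊆ Γ := by rw [← hΓ]; exact Finset.inter_subset_left
  have hB : bdry \ A ⊆ Γᶜ := by
    intro x hx
    rw [← hΓ, Finset.mem_sdiff, Finset.mem_inter] at hx
    rw [Finset.mem_compl]
    exact fun h => hx.2 ⟨h, hx.1⟩
  have hmem : ∀ {S X : Finset V} {a b : EdgeCfg φ.dim}, S ⊆ X →
      (∀ e, Touches X e → a e = b e) → halfCfg S a = halfCfg S b := by
    intro S X a b hSX h
    rw [halfCfg_eq_iff_touches]
    exact fun e ⟨x, hx, hxS⟩ => h e ⟨x, hx, hSX hxS⟩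
  set f : EdgeCfg φ.dim → {x : V // x ∈ bdryᶜ} → ℂ := fun a x => conj (ψ ⟨x, halfCfg {x.1} a⟩)
    with hf
  refine φ.rank_mul_le Γ
    (fun i a => if a ∈ T ∧ halfCfg A a = i then ((√(φ.partialWeight (Touches Γ) a) : ℝ) : ℂ) *
      ∏ x, (if x.1 ∈ Γ then f a x else 1) else 0)
    (fun k a => if halfCfg (bdry \ A) a = k then
      ((√(φ.partialWeight (fun e => ¬ Touches Γ e) a) : ℝ) : ℂ) *
      ∏ x, (if x.1 ∈ Γ then 1 else f a x) else 0) ?_ ?_ ht ?_ _ ?_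
  · intro i a b h
    refine if_congr ?_ ?_ rfl
    · rw [hT a b h, hmem hA h]
    · rw [φ.partialWeight_congr h]
      congr 1
      refine Finset.prod_congr rfl fun x _ => ?_
      split_ifs with hx
      · rw [hf]
        dsimp only
        rw [hmem (Finset.singleton_subset_iff.2 hx) h]
      · rfl
  · intro k a b h
    refine if_congr ?_ ?_ rfl
    · rw [hmem hB h]
    · rw [φ.partialWeight_congr fun e he => h e ((touches_or_compl Γ e).resolve_left he)]
      congr 1
      refine Finset.prod_congr rfl fun x _ => ?_
      split_ifs with hx
      · rfl
      · rw [hf]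
        dsimp only
        rw [hmem (Finset.singleton_subset_iff.2 (Finset.mem_compl.2 hx)) h]
  · intro i k a h
    exact hTt a (ite_ne_right_iff.1 (left_ne_zero_of_mul h)).1.1
  · intro i k
    rw [LinkState.netMatrix, ampMatrix, ← Finset.sum_filter_add_sum_filter_not Finset.univ (· ∈ T)
      (fun a => _ * _), Finset.filter_univ_mem]
    rw [Finset.sum_eq_zero (s := Finset.univ.filter fun a => a ∉ T), add_zero]
    · refine Finset.sum_congr rfl fun a ha => ?_
      have hw : φ.weight a = φ.partialWeight (Touches Γ) a *
          φ.partialWeight (fun e => ¬ Touches Γ e) a := by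
        rw [← φ.partialWeight_or fun e he => not_not.2 he]
        simp only [LinkState.partialWeight, LinkState.weight, or_not, if_true]
      have hb : bulkCoeff bdry ψ a = (∏ x, (if x.1 ∈ Γ then f a x else 1)) *
          ∏ x, (if x.1 ∈ Γ then 1 else f a x) := by
        rw [← Finset.prod_mul_distrib]
        rw [bulkCoeff, braCoeff, map_prod]
        refine Finset.prod_congr rfl fun x _ => ?_
        split_ifs <;> simp [hf]
      rw [hw, hb, Real.sqrt_mul (φ.partialWeight_nonneg _ _), Complex.ofReal_mul]
      by_cases h1 : halfCfg A a = i <;> by_cases h2 : halfCfg (bdry \ A) a = k <;>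
        simp [h1, h2, ha]
      ring
    · intro a ha
      rw [if_neg fun h => (Finset.mem_filter.1 ha).2 h.1, zero_mul]

open Classical in
lemma LinkState.netMatrix_filter_add (bdry A : Finset V) (T : Finset (EdgeCfg φ.dim))
    (p : EdgeCfg φ.dim → Prop) (ψ : BulkTensors φ.dim bdry) : φ.netMatrix bdry A T ψ =
      φ.netMatrix bdry A (T.filter p) ψ + φ.netMatrix bdry A (T.filter fun a => ¬ p a) ψ := by
  rw [LinkState.netMatrix, LinkState.netMatrix, LinkState.netMatrix,
    ← ampMatrix_add_of_disjoint (Finset.disjoint_filter_filter_not _ _ _),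
    Finset.filter_union_filter_not_eq]

/-- The labels with a cut weight below `t` at both cuts. -/
def LinkState.IsLow (Γ₁ Γ₂ : Finset V) (t : ℝ) (a : EdgeCfg φ.dim) : Prop :=
  φ.cutWeight Γ₁ a < t ∧ φ.cutWeight Γ₂ a < t

open Classical in
lemma LinkState.rank_netMatrix_not_isLow_mul_le {bdry A Γ₁ Γ₂ : Finset V} (hΓ₁ : IsCut bdry A Γ₁)
    (hΓ₂ : IsCut bdry A Γ₂) (hΓ : Γ₁ ⊂ Γ₂) {t : ℝ} (ht : 0 ≤ t) (ψ : BulkTensors φ.dim bdry) :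
    (φ.netMatrix bdry A (Finset.univ.filter fun a => ¬ φ.IsLow Γ₁ Γ₂ t a) ψ).rank * t ≤ 2 := by
  rw [φ.netMatrix_filter_add bdry A _ (fun a => t ≤ φ.cutWeight Γ₁ a), Finset.filter_filter,
    Finset.filter_filter]
  set T₁ := Finset.univ.filter fun a => ¬ φ.IsLow Γ₁ Γ₂ t a ∧ t ≤ φ.cutWeight Γ₁ a with hT₁
  set T₂ := Finset.univ.filter fun a => ¬ φ.IsLow Γ₁ Γ₂ t a ∧ ¬ t ≤ φ.cutWeight Γ₁ a with hT₂
  have m₁ : ∀ a, a ∈ T₁ ↔ t ≤ φ.cutWeight Γ₁ a := by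
    intro a
    simp only [hT₁, LinkState.IsLow, Finset.mem_filter, Finset.mem_univ, true_and, ← not_le]
    tauto
  have m₂ : ∀ a, a ∈ T₂ ↔ ¬ t ≤ φ.cutWeight Γ₁ a ∧ t ≤ φ.cutWeight Γ₂ a := by
    intro a
    simp only [hT₂, LinkState.IsLow, Finset.mem_filter, Finset.mem_univ, true_and, ← not_le]
    tauto
  have hc : ∀ {Γ Γ' : Finset V} {a b : EdgeCfg φ.dim}, Γ ⊆ Γ' →
      (∀ e, Touches Γ' e → a e = b e) → φ.cutWeight Γ a = φ.cutWeight Γ b := by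
    intro Γ Γ' a b hs h
    exact φ.partialWeight_congr fun e ⟨⟨x, hx, hxΓ⟩, _⟩ => h e ⟨x, hx, hs hxΓ⟩
  have h₁ := φ.rank_netMatrix_mul_le hΓ₁ (T := T₁)
    (fun a b h => by rw [m₁, m₁, hc subset_rfl h]) ht (fun a ha => (m₁ a).1 ha) ψ
  have h₂ := φ.rank_netMatrix_mul_le hΓ₂ (T := T₂)
    (fun a b h => by rw [m₂, m₂, hc subset_rfl h, hc hΓ.1 h]) ht (fun a ha => ((m₂ a).1 ha).2) ψ
  have h₃ : ((φ.netMatrix bdry A T₁ ψ + φ.netMatrix bdry A T₂ ψ).rank : ℝ) ≤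
      (φ.netMatrix bdry A T₁ ψ).rank + (φ.netMatrix bdry A T₂ ψ).rank := by
    exact_mod_cast rank_add_le_rank_add_rank _ _
  calc _ ≤ ((φ.netMatrix bdry A T₁ ψ).rank + (φ.netMatrix bdry A T₂ ψ).rank : ℝ) * t :=
        mul_le_mul_of_nonneg_right h₃ ht
    _ ≤ 2 := by linarith

end NetworkRank

/-! ### The distribution function of the boundary spectrum -/

section BoundarySpectrum

lemma measureReal_le_div {Ω : Type*} [MeasurableSpace Ω] {μ : Measure Ω} {f : Ω → ℝ} {B c : ℝ}
    (hf : ∀ ω, 0 ≤ f ω) (h : Integrable f μ ∧ ∫ ω, f ω ∂μ ≤ B) (hc : 0 < c) :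
    μ.real {ω | c ≤ f ω} ≤ B / c := by
  rw [le_div_iff₀' hc]
  exact (mul_meas_ge_le_integral_of_nonneg (ae_of_all _ hf) h.1 c).trans h.2

lemma measureReal_le_add_six {Ω : Type*} [MeasurableSpace Ω] {μ : Measure Ω} [IsFiniteMeasure μ]
    {E E₁ E₂ E₃ E₄ E₅ E₆ : Set Ω} (h : ∀ ω, ω ∉ E₁ → ω ∉ E₂ → ω ∉ E₃ → ω ∉ E₄ → ω ∉ E₅ →
      ω ∉ E₆ → ω ∉ E) :
    μ.real E ≤ μ.real E₁ + (μ.real E₂ + (μ.real E₃ + (μ.real E₄ + (μ.real E₅ + μ.real E₆)))) := by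
  have h' : E ⊆ E₁ ∪ (E₂ ∪ (E₃ ∪ (E₄ ∪ (E₅ ∪ E₆)))) := by
    intro ω hω
    by_contra hn
    simp only [Set.mem_union, not_or] at hn
    exact h ω hn.1 hn.2.1 hn.2.2.1 hn.2.2.2.1 hn.2.2.2.2.1 hn.2.2.2.2.2 hω
  refine (measureReal_mono h').trans ((measureReal_union_le _ _).trans (add_le_add_right ?_ _))
  refine (measureReal_union_le _ _).trans (add_le_add_right ?_ _)
  refine (measureReal_union_le _ _).trans (add_le_add_right ?_ _)
  refine (measureReal_union_le _ _).trans (add_le_add_right ?_ _)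
  exact measureReal_union_le _ _

lemma le_add_of_le_one_add_mul {β x y w : ℝ} (hβ : 0 < β) (hβ1 : β ≤ 1)
    (h : x ≤ (1 + β) * y + 2 * β) (hy : y ≤ w + β) (hw : w ≤ 1) : x ≤ w + 5 * β := by
  nlinarith [mul_le_mul_of_nonneg_left hy (by positivity : 0 ≤ 1 + β),
    mul_le_mul_of_nonneg_left hw hβ.le, mul_le_mul_of_nonneg_left hβ1 hβ.le]

section Hermitian

variable {m n : Type*} [Fintype m] [DecidableEq m] [Fintype n] [DecidableEq n]

lemma sum_eigenvalues_of_eq {X : Matrix m m ℂ} (hX : X.IsHermitian) {M : Matrix m n ℂ}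
    (h : X = M * M.conjTranspose) : ∑ i, hX.eigenvalues i = hsSq M := by
  subst h; exact sum_eigenvalues_eq_hsSq M hX

lemma eigenvalues_nonneg_of_eq {X : Matrix m m ℂ} (hX : X.IsHermitian) {M : Matrix m n ℂ}
    (h : X = M * M.conjTranspose) (i : m) : 0 ≤ hX.eigenvalues i := by
  subst h; exact eigenvalues_mul_conjTranspose_nonneg M hX i

lemma hsSq_le_of_eq {X : Matrix m m ℂ} (hX : X.IsHermitian) {M S N : Matrix m n ℂ}
    (h : X = M * M.conjTranspose) (hMSN : M = S + N) {s : ℝ} (hs : 0 ≤ s) :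
    hsSq M ≤ ∑ i with s ≤ hX.eigenvalues i, hX.eigenvalues i + S.rank * s + hsSq N := by
  subst h; exact hsSq_le_sum_large_eigenvalues M S N hMSN hX hs

lemma sum_large_le_of_eq {X : Matrix m m ℂ} (hX : X.IsHermitian) {M S N : Matrix m n ℂ}
    (h : X = M * M.conjTranspose) (hMSN : M = S + N) {s τ : ℝ} (hs : 0 < s) (hτ : 0 < τ) :
    ∑ i with s ≤ hX.eigenvalues i, hX.eigenvalues i ≤ (1 + τ) * hsSq S +
      (1 + 1 / τ) * √(hsSq M / s * hsSq (N * N.conjTranspose)) := by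
  subst h; exact sum_large_eigenvalues_le M S N hMSN hX hs hτ

lemma hsSq_neg (M : Matrix m n ℂ) : hsSq (-M) = hsSq M := by simp [hsSq]

/-- Perturbation of the squared norm by a small summand. -/
lemma hsSq_add_le_of_sq {S N : Matrix m n ℂ} {β : ℝ} (hβ : 0 < β) (hβ1 : β ≤ 1)
    (hN : hsSq N ≤ β ^ 2) : hsSq (S + N) ≤ (1 + β) * hsSq S + 2 * β := by
  have h1 := hsSq_add_le S N hβ
  have h2 : (1 + 1 / β) * hsSq N ≤ (1 + 1 / β) * β ^ 2 :=
    mul_le_mul_of_nonneg_left hN (by positivity)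
  have h3 : (1 + 1 / β) * β ^ 2 = β ^ 2 + β := by field_simp
  nlinarith

end Hermitian

variable {V : Type*} [Fintype V] [DecidableEq V] {G : SimpleGraph V} [DecidableRel G.Adj]
  (φ : LinkState G)

open Classical in
/-- The probability of the labels which are not good. -/
noncomputable def LinkState.badProb (bdry A Γ₁ Γ₂ : Finset V) (θ : ℝ) : ℝ :=
  ∑ a, if φ.IsGood bdry A Γ₁ Γ₂ θ a then 0 else φ.weight a

open Classical in
/-- Outside of an event of small probability, the part of the spectrum of `ρ_A` above `s` has about
the probability that one of the two cut weights is large. The lower bound is of use for `t₁ ≫ s`, the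
upper bound for `t₂ ≪ s`. -/
lemma LinkState.boundary_spectrum_estimate {bdry A Γ₁ Γ₂ : Finset V} (hΓ₁ : IsCut bdry A Γ₁)
    (hΓ₂ : IsCut bdry A Γ₂) (hΓ : Γ₁ ⊂ Γ₂)
    (hdisj : Disjoint (cutEdges G Γ₁) (cutEdges G Γ₂)) {θ β s t₁ t₂ : ℝ} (hθ : 0 ≤ θ)
    (hθ1 : θ ≤ 1) (hβ : 0 < β) (hβ1 : β ≤ 1) (hs : 0 < s) (ht₁ : 0 < t₁) (ht₂ : 0 < t₂) :
    (bulkLaw φ.dim bdry).real {ψ | ¬ (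
      |∑ i, (reducedState_isHermitian (φ.networkVector bdry ψ) A).eigenvalues i - 1| ≤
        φ.badProb bdry A Γ₁ Γ₂ θ + 10 * β ∧
      1 - φ.lowProb Γ₁ t₁ * φ.lowProb Γ₂ t₁ - (φ.badProb bdry A Γ₁ Γ₂ θ + 15 * β + 2 * (s / t₁)) ≤
        ∑ i with s ≤ (reducedState_isHermitian (φ.networkVector bdry ψ) A).eigenvalues i,
          (reducedState_isHermitian (φ.networkVector bdry ψ) A).eigenvalues i ∧
      ∑ i with s ≤ (reducedState_isHermitian (φ.networkVector bdry ψ) A).eigenvalues i,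
          (reducedState_isHermitian (φ.networkVector bdry ψ) A).eigenvalues i ≤
        1 - φ.lowProb Γ₁ t₂ * φ.lowProb Γ₂ t₂ + 17 * β)} ≤
    2 * (φ.badProb bdry A Γ₁ Γ₂ θ / β ^ 2) +
      3 * (numPairings bdry * (θ + ∑ a, φ.weight a * φ.cutWeight Γ₁ a) / β ^ 2) +
      numPairings bdry * t₂ / (s * β ^ 4) := by
  set P := bulkLaw φ.dim bdry with hP
  set δ := φ.badProb bdry A Γ₁ Γ₂ θ with hδ
  set Q := numPairings bdry * (θ + ∑ a, φ.weight a * φ.cutWeight Γ₁ a) with hQ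
  set good : EdgeCfg φ.dim → Prop := φ.IsGood bdry A Γ₁ Γ₂ θ with hgood
  have hA : A ⊆ bdry := by rw [← hΓ₁]; exact Finset.inter_subset_right
  have hw := φ.weight_nonneg
  -- the sets of labels: good, bad, low and bad, low and good, high and good
  set Tg := Finset.univ.filter good with hTg
  set Tb := Finset.univ.filter fun a => ¬ good a with hTb
  set L := Finset.univ.filter (φ.IsLow Γ₁ Γ₂ t₁) with hL
  set B := Finset.univ.filter fun a => ¬ φ.IsLow Γ₁ Γ₂ t₁ a with hB
  set Lb := L.filter fun a => ¬ good a with hLb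
  set Lg := L.filter good with hLg
  set Ng := Tg.filter (φ.IsLow Γ₁ Γ₂ t₂) with hNg
  set Hg := Tg.filter (fun a => ¬ φ.IsLow Γ₁ Γ₂ t₂ a) with hHg
  set R : Finset (EdgeCfg φ.dim) → BulkTensors φ.dim bdry → _ := φ.netMatrix bdry A with hR
  -- the weights of these sets
  have wb : ∑ a ∈ Tb, φ.weight a = δ := by
    rw [hTb, Finset.sum_filter, hδ, LinkState.badProb]
    exact Finset.sum_congr rfl fun a _ => ite_not _ _ _
  have wLb : ∑ a ∈ Lb, φ.weight a ≤ δ := by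
    rw [← wb]
    exact Finset.sum_le_sum_of_subset_of_nonneg
      (Finset.filter_subset_filter _ (Finset.subset_univ _)) fun a _ _ => hw a
  have wg : ∑ a ∈ Tg, φ.weight a = 1 - δ := by
    rw [← wb, ← φ.sum_weight, ← Finset.sum_filter_add_sum_filter_not Finset.univ good]
    ring
  have wlow : ∀ t, ∑ a with φ.IsLow Γ₁ Γ₂ t a, φ.weight a = φ.lowProb Γ₁ t * φ.lowProb Γ₂ t :=
    fun t => by
      rw [← φ.sum_low_low hdisj, Finset.sum_filter]
      exact Finset.sum_congr rfl fun a _ => if_congr Iff.rfl rfl rfl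
  have wLg : ∑ a ∈ Lg, φ.weight a ≤ φ.lowProb Γ₁ t₁ * φ.lowProb Γ₂ t₁ := by
    rw [← wlow]
    exact Finset.sum_le_sum_of_subset_of_nonneg (Finset.filter_subset _ _) fun a _ _ => hw a
  have wHg : ∑ a ∈ Hg, φ.weight a ≤ 1 - φ.lowProb Γ₁ t₂ * φ.lowProb Γ₂ t₂ := by
    rw [← wlow, ← φ.sum_weight,
      ← Finset.sum_filter_add_sum_filter_not Finset.univ (φ.IsLow Γ₁ Γ₂ t₂), add_sub_cancel_left]
    exact Finset.sum_le_sum_of_subset_of_nonneg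
      (Finset.filter_subset_filter _ (Finset.subset_univ _)) fun a _ _ => hw a
  have gLg : ∀ a ∈ Lg, good a := fun a ha => (Finset.mem_filter.1 ha).2
  have gTg : ∀ a ∈ Tg, good a := fun a ha => (Finset.mem_filter.1 ha).2
  have gHg : ∀ a ∈ Hg, good a := fun a ha => gTg a (Finset.mem_filter.1 ha).1
  have gNg : ∀ a ∈ Ng, good a := fun a ha => gTg a (Finset.mem_filter.1 ha).1
  -- the exceptional events
  have p1 : ∀ T : Finset (EdgeCfg φ.dim), ∑ a ∈ T, φ.weight a ≤ δ →
      P.real {ψ | β ^ 2 ≤ hsSq (R T ψ)} ≤ δ / β ^ 2 := fun T hT =>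
    measureReal_le_div (fun ψ => hsSq_nonneg _) ⟨(φ.integral_hsSq_netMatrix hA T).1,
      (φ.integral_hsSq_netMatrix hA T).2.trans_le hT⟩ (by positivity)
  have p2 : ∀ T : Finset (EdgeCfg φ.dim), (∀ a ∈ T, good a) →
      P.real {ψ | β ^ 2 ≤ (hsSq (R T ψ) - ∑ a ∈ T, φ.weight a) ^ 2} ≤ Q / β ^ 2 := fun T hT =>
    measureReal_le_div (fun ψ => sq_nonneg _)
      (LinkState.integral_sq_sub_netMatrix_le hΓ₁ hΓ₂ hΓ hdisj hθ hT) (by positivity)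
  have p3 : P.real {ψ | s * β ^ 4 ≤ hsSq (R Ng ψ * (R Ng ψ).conjTranspose)} ≤
      numPairings bdry * t₂ / (s * β ^ 4) :=
    measureReal_le_div (fun ψ => hsSq_nonneg _)
      ⟨(φ.integral_hsSq_netMatrix_mul_conjTranspose hA Ng).1,
        LinkState.integral_purity_netMatrix_le hΓ₁ hΓ₂ hΓ hθ1 ht₂.le gNg fun a ha =>
          ⟨(Finset.mem_filter.1 ha).2.1.le, (Finset.mem_filter.1 ha).2.2.le⟩⟩ (by positivity)
  refine (measureReal_le_add_six (E₁ := {ψ | β ^ 2 ≤ hsSq (R Tb ψ)})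
    (E₂ := {ψ | β ^ 2 ≤ hsSq (R Lb ψ)})
    (E₃ := {ψ | β ^ 2 ≤ (hsSq (R Tg ψ) - ∑ a ∈ Tg, φ.weight a) ^ 2})
    (E₄ := {ψ | β ^ 2 ≤ (hsSq (R Lg ψ) - ∑ a ∈ Lg, φ.weight a) ^ 2})
    (E₅ := {ψ | β ^ 2 ≤ (hsSq (R Hg ψ) - ∑ a ∈ Hg, φ.weight a) ^ 2})
    (E₆ := {ψ | s * β ^ 4 ≤ hsSq (R Ng ψ * (R Ng ψ).conjTranspose)}) ?_).trans ?_
  · intro ψ n1 n2 n3 n4 n5 n6 hψ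
    refine hψ ?_
    simp only [Set.mem_ofPred_eq, not_le] at n1 n2 n3 n4 n5 n6
    have hab : ∀ {x : ℝ}, x ^ 2 < β ^ 2 → -β ≤ x ∧ x ≤ β := fun h =>
      abs_le.1 (abs_le_of_sq_le_sq h.le hβ.le)
    obtain ⟨n3, n3'⟩ := hab n3
    obtain ⟨n4, n4'⟩ := hab n4
    obtain ⟨n5, n5'⟩ := hab n5
    have hρ := φ.reducedState_networkVector hA ψ
    set hX := reducedState_isHermitian (φ.networkVector bdry ψ) A
    have d1 : R Finset.univ ψ = R Tg ψ + R Tb ψ := φ.netMatrix_filter_add bdry A _ good ψ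
    have d2 : R L ψ = R Lg ψ + R Lb ψ := φ.netMatrix_filter_add bdry A _ good ψ
    have d3 : R Tg ψ = R Ng ψ + R Hg ψ := φ.netMatrix_filter_add bdry A _ _ ψ
    have d4 : R Finset.univ ψ = R L ψ + R B ψ := φ.netMatrix_filter_add bdry A _ _ ψ
    have hδ0 : 0 ≤ δ := by rw [← wb]; exact Finset.sum_nonneg fun a _ => hw a
    have u1 : hsSq (R Finset.univ ψ) ≤ (1 + β) * hsSq (R Tg ψ) + 2 * β := by
      rw [d1]; exact hsSq_add_le_of_sq hβ hβ1 n1.le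
    have u2 : hsSq (R Tg ψ) ≤ (1 + β) * hsSq (R Finset.univ ψ) + 2 * β := by
      have h : R Tg ψ = R Finset.univ ψ + -R Tb ψ := by rw [d1]; abel
      rw [h]
      exact hsSq_add_le_of_sq hβ hβ1 (by rw [hsSq_neg]; exact n1.le)
    have u3 : hsSq (R L ψ) ≤ (1 + β) * hsSq (R Lg ψ) + 2 * β := by
      rw [d2]; exact hsSq_add_le_of_sq hβ hβ1 n2.le
    have u4 : hsSq (R Hg ψ + R Tb ψ) ≤ (1 + β) * hsSq (R Hg ψ) + 2 * β :=
      hsSq_add_le_of_sq hβ hβ1 n1.le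
    have v1 : hsSq (R Finset.univ ψ) ≤ 1 + 5 * β :=
      le_add_of_le_one_add_mul hβ hβ1 u1 (by linarith) le_rfl
    have v2 : 1 - δ - 9 * β ≤ hsSq (R Finset.univ ψ) := by
      have h1 := mul_le_mul_of_nonneg_left v1 hβ.le
      have h2 := mul_le_mul_of_nonneg_left hβ1 hβ.le
      linarith
    have wLg1 : ∑ a ∈ Lg, φ.weight a ≤ 1 := LinkState.sum_weight_le_one _
    have wHg1 : ∑ a ∈ Hg, φ.weight a ≤ 1 := LinkState.sum_weight_le_one _
    have v3 : hsSq (R L ψ) ≤ ∑ a ∈ Lg, φ.weight a + 5 * β :=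
      le_add_of_le_one_add_mul hβ hβ1 u3 (by linarith) wLg1
    have v4 : hsSq (R Hg ψ + R Tb ψ) ≤ ∑ a ∈ Hg, φ.weight a + 5 * β :=
      le_add_of_le_one_add_mul hβ hβ1 u4 (by linarith) wHg1
    refine ⟨?_, ?_, ?_⟩
    · rw [sum_eigenvalues_of_eq hX hρ, abs_le]
      constructor <;> linarith
    · have h1 := hsSq_le_of_eq hX hρ (d4.trans (add_comm _ _)) hs.le
      have h2 : ((R B ψ).rank : ℝ) * s ≤ 2 * (s / t₁) := by
        have h3 := φ.rank_netMatrix_not_isLow_mul_le hΓ₁ hΓ₂ hΓ ht₁.le ψ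
        have h4 : ((R B ψ).rank : ℝ) * s = (R B ψ).rank * t₁ * (s / t₁) := by field_simp
        rw [h4]
        exact mul_le_mul_of_nonneg_right h3 (by positivity)
      linarith
    · have h1 := sum_large_le_of_eq hX hρ (S := R Hg ψ + R Tb ψ) (N := R Ng ψ)
        (by change R Finset.univ ψ = _; rw [d1, d3]; abel) hs hβ
      have h2 : √(hsSq (R Finset.univ ψ) / s * hsSq (R Ng ψ * (R Ng ψ).conjTranspose)) ≤
          3 * β ^ 2 := by
        refine Real.sqrt_le_iff.2 ⟨by positivity, ?_⟩
        calc _ ≤ 6 / s * (s * β ^ 4) := by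
              refine mul_le_mul ?_ n6.le (hsSq_nonneg _) (by positivity)
              gcongr
              linarith
          _ = 6 * β ^ 4 := by field_simp
          _ ≤ (3 * β ^ 2) ^ 2 := by nlinarith [pow_pos hβ 4]
      have h3 : (1 + 1 / β) * √(hsSq (R Finset.univ ψ) / s *
          hsSq (R Ng ψ * (R Ng ψ).conjTranspose)) ≤ 6 * β := by
        calc _ ≤ (1 + 1 / β) * (3 * β ^ 2) := mul_le_mul_of_nonneg_left h2 (by positivity)
          _ = 3 * β ^ 2 + 3 * β := by field_simp
          _ ≤ 6 * β := by linarith [mul_le_mul_of_nonneg_left hβ1 hβ.le, sq β]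
      have h4 : (1 + β) * hsSq (R Hg ψ + R Tb ψ) ≤ ∑ a ∈ Hg, φ.weight a + 11 * β := by
        have h5 := mul_le_mul_of_nonneg_left v4 hβ.le
        have h6 := mul_le_mul_of_nonneg_left wHg1 hβ.le
        have h7 := mul_le_mul_of_nonneg_left hβ1 hβ.le
        linarith
      linarith
  · linarith [p1 Tb wb.le, p1 Lb wLb, p2 Tg gTg, p2 Lg gLg, p2 Hg gHg]

end BoundarySpectrum

/-! ### The limit -/

section Limit

lemma tendsto_two_rpow_zero {ι : Type*} {l : Filter ι} {f : ι → ℝ} (hf : Tendsto f l atTop) {c : ℝ}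
    (hc : 0 < c) : Tendsto (fun k => (2 : ℝ) ^ (-(c * f k))) l (𝓝 0) :=
  (tendsto_rpow_atBot_of_base_gt_one 2 one_lt_two).comp
    (tendsto_neg_atTop_atBot.comp (hf.const_mul_atTop hc))

lemma threshold_eq_mul (n : ℕ) (h x y : ℝ) :
    threshold n h y = threshold n h x * 2 ^ (-((y - x) * √(n : ℝ))) := by
  rw [threshold, threshold, ← Real.rpow_add two_pos]
  congr 1
  ring

variable {V : Type*} [Fintype V] [DecidableEq V] {G : SimpleGraph V} [DecidableRel G.Adj]

lemma LinkState.sum_weight_mul_cutWeight_le (φ : LinkState G) (Γ : Finset V) {t : ℝ} (ht : 0 ≤ t) :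
    ∑ a, φ.weight a * φ.cutWeight Γ a ≤ (1 - φ.lowProb Γ t) + t := by
  have h : (1 - φ.lowProb Γ t) + t =
      ∑ a, (φ.weight a - (if φ.cutWeight Γ a < t then φ.weight a else 0) + φ.weight a * t) := by
    rw [Finset.sum_add_distrib, Finset.sum_sub_distrib, ← Finset.sum_mul, φ.sum_weight, one_mul,
      LinkState.lowProb]
  rw [h]
  refine Finset.sum_le_sum fun a _ => ?_
  have hw := φ.weight_nonneg a
  split_ifs with h1
  · have := mul_le_mul_of_nonneg_left h1.le hw
    linarith
  · have := mul_le_of_le_one_right hw (φ.cutWeight_le_one Γ a)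
    have := mul_nonneg hw ht
    linarith

/-- Since cut weights are at most one, so is a threshold with a part of the spectrum above it. -/
lemma LinkState.threshold_le_one (φ : LinkState G) (Γ : Finset V) {n : ℕ} (hn : 0 < n) {h x : ℝ}
    (hx : 0 < (cutMeasure φ Γ n h).real (Set.Iic x)) : threshold n h x ≤ 1 := by
  by_contra! hlt
  have h1 := φ.lowProb_threshold Γ hn h x
  rw [LinkState.lowProb, Finset.sum_congr rfl fun a _ =>
    if_pos ((φ.cutWeight_le_one Γ a).trans_lt hlt), φ.sum_weight] at h1
  linarith

variable {bdry A Γ₁ Γ₂ : Finset V} {n : ℕ → ℕ}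

/-- With `θ = 2 ^ (-K / 2)` and `η = 2 ^ (-K / 4)`, the error terms of the union bound vanish in the
limit `K → ∞`, `ε → 0`. -/
lemma tendsto_badProb {ψ : ℕ → LinkState G} {ε K : ℕ → ℝ}
    (hmin : ∀ k, IsMinimalCutPair (ψ k) bdry A Γ₁ Γ₂ (ε k) (K k)) (hε : Tendsto ε atTop (𝓝 0))
    (hK : Tendsto K atTop atTop) :
    Tendsto (fun k => (ψ k).badProb bdry A Γ₁ Γ₂ (2 ^ (-(1 / 2 * K k)))) atTop (𝓝 0) := by
  have h1 : ∀ k, (ψ k).badProb bdry A Γ₁ Γ₂ (2 ^ (-(1 / 2 * K k))) ≤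
      3 * Fintype.card (Finset V) * (2 ^ (-(1 / 4 * K k)) + (ε k ^ 2 +
        3 * √(2 * 2 ^ (-(1 / 4 * K k))))) := by
    intro k
    have h2 := (ψ k).sum_not_isGood_le (θ := 2 ^ (-(1 / 2 * K k))) (η := 2 ^ (-(1 / 4 * K k)))
      (by positivity) (by positivity) (hmin k)
    have h3 : (2 : ℝ) ^ (1 - K k) / (2 ^ (-(1 / 2 * K k)) * 2 ^ (-(1 / 4 * K k))) =
        2 * 2 ^ (-(1 / 4 * K k)) := by
      have h4 : (2 : ℝ) * 2 ^ (-(1 / 4 * K k)) = 2 ^ (1 + -(1 / 4 * K k)) := by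
        rw [Real.rpow_add two_pos, Real.rpow_one]
      rw [h4, ← Real.rpow_add two_pos, ← Real.rpow_sub two_pos]
      congr 1
      ring
    rw [h3] at h2
    exact h2
  have h4 := tendsto_two_rpow_zero hK (c := 1 / 4) (by norm_num)
  have h5 : Tendsto (fun k => 3 * (Fintype.card (Finset V) : ℝ) * (2 ^ (-(1 / 4 * K k)) +
      (ε k ^ 2 + 3 * √(2 * 2 ^ (-(1 / 4 * K k)))))) atTop (𝓝 0) := by
    have h6 := (h4.add ((hε.pow 2).add (((h4.const_mul 2).sqrt).const_mul 3))).const_mul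
      (3 * (Fintype.card (Finset V) : ℝ))
    simpa using h6
  refine squeeze_zero (fun k => Finset.sum_nonneg fun a _ => ?_) h1 h5
  split_ifs; exacts [le_rfl, (ψ k).weight_nonneg a]

/-- The mean cut weight tends to zero. Choose `z < y` in the lower tail of the limit law: the threshold
at `z` is at most one, so that the one at `y` tends to zero, and larger cut weights are improbable. -/
lemma tendsto_sum_weight_mul_cutWeight (hn : ∀ k, 0 < n k)
    (hnt : Tendsto (fun k => √(n k : ℝ)) atTop atTop) {Γ : Finset V} {ψ : ℕ → LinkState G}
    {ν : Measure ℝ} [IsProbabilityMeasure ν] (hcdf : Continuous (cdf ν)) {h : ℕ → ℝ}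
    (hν : ∀ x, Tendsto (fun k => (cutMeasure (ψ k) Γ (n k) (h k)).real (Set.Iic x)) atTop
      (𝓝 (cdf ν x))) :
    Tendsto (fun k => ∑ a, (ψ k).weight a * (ψ k).cutWeight Γ a) atTop (𝓝 0) := by
  rw [Metric.tendsto_nhds]
  intro η hη
  have hsurj : ∀ c, 0 < c → c < 1 → ∃ x, cdf ν x = c := by
    intro c hc0 hc1
    obtain ⟨u, hu⟩ := ((tendsto_cdf_atBot ν).eventually (gt_mem_nhds hc0)).exists
    obtain ⟨v, hv⟩ := ((tendsto_cdf_atTop ν).eventually (lt_mem_nhds hc1)).exists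
    exact mem_range_of_exists_le_of_exists_ge hcdf ⟨u, hu.le⟩ ⟨v, hv.le⟩
  obtain ⟨c, hc0, hc1, hcη⟩ : ∃ c : ℝ, 0 < c ∧ c < 1 ∧ c < η / 2 :=
    ⟨min (1 / 2) (η / 4), by positivity, (min_le_left _ _).trans_lt (by norm_num),
      (min_le_right _ _).trans_lt (by linarith)⟩
  obtain ⟨y, hy⟩ := hsurj c hc0 hc1
  obtain ⟨z, hz⟩ := hsurj (c / 2) (by linarith) (by linarith)
  have hzy : z < y := by
    by_contra! hle
    have := (cdf ν).mono hle
    rw [hy, hz] at this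
    linarith
  have ht0 : Tendsto (fun k => (2 : ℝ) ^ (-((y - z) * √(n k : ℝ)))) atTop (𝓝 0) :=
    tendsto_two_rpow_zero hnt (sub_pos.2 hzy)
  filter_upwards [(hν y).eventually (gt_mem_nhds (show cdf ν y < η / 2 by rw [hy]; exact hcη)),
    (hν z).eventually (lt_mem_nhds (show 0 < cdf ν z by rw [hz]; linarith)),
    ht0.eventually (gt_mem_nhds (half_pos hη))] with k h1 h2 h3
  have h4 := (ψ k).sum_weight_mul_cutWeight_le Γ (threshold_pos (n k) (h k) y).le
  rw [(ψ k).lowProb_threshold Γ (hn k)] at h4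
  have h5 : threshold (n k) (h k) y ≤ 2 ^ (-((y - z) * √(n k : ℝ))) := by
    rw [threshold_eq_mul _ _ z y]
    exact mul_le_of_le_one_left (by positivity) ((ψ k).threshold_le_one Γ (hn k) h2)
  rw [Real.dist_eq, sub_zero, abs_of_nonneg (Finset.sum_nonneg fun a _ =>
    mul_nonneg ((ψ k).weight_nonneg a) ((ψ k).cutWeight_nonneg Γ a))]
  linarith

/-- The distribution function and the total mass of the boundary spectrum converge in
probability. -/
lemma tendsto_boundaryMeasure_real (hΓ₁ : IsCut bdry A Γ₁) (hΓ₂ : IsCut bdry A Γ₂) (hΓ : Γ₁ ⊂ Γ₂)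
    (hdisj : Disjoint (cutEdges G Γ₁) (cutEdges G Γ₂)) (hn : ∀ k, 0 < n k)
    (hnt : Tendsto (fun k => √(n k : ℝ)) atTop atTop) {ψ : ℕ → LinkState G} {θ h : ℕ → ℝ}
    (hθ0 : ∀ k, 0 ≤ θ k) (hθ : Tendsto θ atTop (𝓝 0))
    (hbad : Tendsto (fun k => (ψ k).badProb bdry A Γ₁ Γ₂ (θ k)) atTop (𝓝 0))
    {ν₁ ν₂ : Measure ℝ} [IsProbabilityMeasure ν₁] [IsProbabilityMeasure ν₂]
    (hcdf₁ : Continuous (cdf ν₁)) (hcdf₂ : Continuous (cdf ν₂))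
    (hν₁ : ∀ x, Tendsto (fun k => (cutMeasure (ψ k) Γ₁ (n k) (h k)).real (Set.Iic x)) atTop
      (𝓝 (cdf ν₁ x)))
    (hν₂ : ∀ x, Tendsto (fun k => (cutMeasure (ψ k) Γ₂ (n k) (h k)).real (Set.Iic x)) atTop
      (𝓝 (cdf ν₂ x))) (x : ℝ) {η : ℝ} (hη : 0 < η) :
    Tendsto (fun k => (bulkLaw (ψ k).dim bdry).real {ω | ¬ (
      |(boundaryMeasure (ψ k) bdry A (n k) (h k) ω).real (Set.Iic x) -
        (minPushforward ν₁ ν₂).real (Set.Iic x)| < η ∧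
      |(boundaryMeasure (ψ k) bdry A (n k) (h k) ω).real Set.univ - 1| < η)}) atTop (𝓝 0) := by
  set F : ℝ → ℝ := fun x => 1 - (1 - cdf ν₁ x) * (1 - cdf ν₂ x) with hF
  have hFc : Continuous F := by fun_prop
  have hA : A ⊆ bdry := by rw [← hΓ₁]; exact Finset.inter_subset_right
  -- a small shift of the argument of the distribution function
  obtain ⟨κ, hκ, hκF⟩ : ∃ κ, 0 < κ ∧ ∀ y, |y - x| ≤ κ → |F y - F x| < η / 4 := by
    obtain ⟨κ, hκ, h1⟩ := Metric.continuous_iff.1 hFc x (η / 4) (by linarith)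
    exact ⟨κ / 2, half_pos hκ, fun y hy => h1 y (by rw [Real.dist_eq]; linarith)⟩
  obtain ⟨β, hβ, hβ1, hβη⟩ : ∃ β : ℝ, 0 < β ∧ β ≤ 1 ∧ 17 * β < η / 4 :=
    ⟨min 1 (η / 100), by positivity, min_le_left _ _, by
      have := min_le_right 1 (η / 100); linarith⟩
  set r : ℕ → ℝ := fun k => 2 ^ (-(κ * √(n k : ℝ))) with hr
  have hr0 : Tendsto r atTop (𝓝 0) := tendsto_two_rpow_zero hnt hκ
  have hlow : ∀ y, Tendsto (fun k => 1 - (ψ k).lowProb Γ₁ (threshold (n k) (h k) y) *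
      (ψ k).lowProb Γ₂ (threshold (n k) (h k) y)) atTop (𝓝 (F y)) := by
    intro y
    simp only [(ψ _).lowProb_threshold _ (hn _)]
    exact (((hν₁ y).const_sub 1).mul ((hν₂ y).const_sub 1)).const_sub 1
  have hq := tendsto_sum_weight_mul_cutWeight hn hnt hcdf₁ hν₁
  have hlim : Tendsto (fun k => 2 * ((ψ k).badProb bdry A Γ₁ Γ₂ (θ k) / β ^ 2) +
      3 * (numPairings bdry * (θ k + ∑ a, (ψ k).weight a * (ψ k).cutWeight Γ₁ a) / β ^ 2) +
      numPairings bdry * r k / β ^ 4) atTop (𝓝 0) := by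
    have h1 := (((hbad.div_const (β ^ 2)).const_mul 2).add
      ((((hθ.add hq).const_mul (numPairings bdry : ℝ)).div_const (β ^ 2)).const_mul 3)).add
      ((hr0.const_mul (numPairings bdry : ℝ)).div_const (β ^ 4))
    simpa using h1
  refine squeeze_zero' (Eventually.of_forall fun k => measureReal_nonneg) ?_ hlim
  filter_upwards [hθ.eventually (ge_mem_nhds one_pos),
    hbad.eventually (gt_mem_nhds (show 0 < η / 8 by linarith)),
    hr0.eventually (gt_mem_nhds (show 0 < η / 32 by linarith)),
    Metric.tendsto_nhds.1 (hlow (x - κ)) (η / 4) (by linarith),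
    Metric.tendsto_nhds.1 (hlow (x + κ)) (η / 4) (by linarith)] with k h1 h2 h3 h4 h5
  set s := threshold (n k) (h k) x with hs
  set t₁ := threshold (n k) (h k) (x - κ) with ht₁
  set t₂ := threshold (n k) (h k) (x + κ) with ht₂
  have hs0 : 0 < s := threshold_pos _ _ _
  have hst : s / t₁ = r k := by
    rw [div_eq_iff (threshold_pos _ _ _).ne', hs, threshold_eq_mul _ _ (x - κ) x, mul_comm,
      sub_sub_cancel]
  have hts : t₂ = s * r k := by
    rw [ht₂, threshold_eq_mul _ _ x (x + κ), add_sub_cancel_left]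
  have hest := (ψ k).boundary_spectrum_estimate hΓ₁ hΓ₂ hΓ hdisj (hθ0 k) h1 hβ hβ1 hs0
    (threshold_pos (n k) (h k) (x - κ)) (threshold_pos (n k) (h k) (x + κ))
  rw [← ht₁, ← ht₂, hst] at hest
  refine le_trans (measureReal_mono ?_) (hest.trans (le_of_eq ?_))
  · intro ω hω hgood
    refine hω ?_
    obtain ⟨g1, g2, g3⟩ := hgood
    have hpos := eigenvalues_nonneg_of_eq (reducedState_isHermitian ((ψ k).networkVector bdry ω) A)
      ((ψ k).reducedState_networkVector hA ω)
    have hκ1 := abs_lt.1 (hκF (x - κ) (by rw [sub_sub_cancel_left, abs_neg, abs_of_pos hκ]))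
    have hκ2 := abs_lt.1 (hκF (x + κ) (by rw [add_sub_cancel_left, abs_of_pos hκ]))
    rw [Real.dist_eq, abs_lt] at h4 h5
    rw [boundaryMeasure, spectralLogMeasure_real_Iic _ hpos (hn k),
      spectralLogMeasure_real_univ _ hpos, minPushforward_real_Iic]
    change |_ - F x| < η ∧ _
    refine ⟨abs_lt.2 ⟨?_, ?_⟩, lt_of_le_of_lt g1 (by linarith)⟩
    · linarith [h4.1, hκ1.1]
    · linarith [h5.2, hκ2.2]
  · rw [hts]
    congr 1
    field_simp

end Limit

end RTN

theorem mainTheorem2 {V : Type*} [Fintype V] [DecidableEq V]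
    (G : SimpleGraph V) [DecidableRel G.Adj] (hG : G.Connected)
    (bdry A Γ₁ Γ₂ : Finset V)
    (hΓ₁ : RTN.IsCut bdry A Γ₁) (hΓ₂ : RTN.IsCut bdry A Γ₂) (hΓ : Γ₁ ⊂ Γ₂)
    (hdisj : Disjoint (RTN.cutEdges G Γ₁) (RTN.cutEdges G Γ₂))
    (n : ℕ → ℕ) (hn_pos : ∀ k, 0 < n k) (hn : StrictMono n)
    (φ : ℕ → RTN.LinkState G) (ε K H : ℕ → ℝ)
    (hmin : ∀ k, RTN.IsMinimalCutPair (φ (n k)) bdry A Γ₁ Γ₂ (ε (n k)) (K (n k)))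
    (γ : ℝ) (hγ : 4 < γ)
    (hε : (fun k => ε (n k)) =O[atTop] fun k => (n k : ℝ) ^ (-γ))
    (c : ℝ) (hc : 0 < c)
    (hK : ∀ᶠ k in atTop, c * Real.logb 2 (n k) ^ 2 ≤ K (n k))
    (ν₁ ν₂ : Measure ℝ) [IsProbabilityMeasure ν₁] [IsProbabilityMeasure ν₂]
    (hcdf₁ : Continuous (cdf ν₁)) (hcdf₂ : Continuous (cdf ν₂))
    (hν₁ : RTN.WeaklyConverges (fun k => RTN.cutMeasure (φ (n k)) Γ₁ (n k) (H (n k))) ν₁)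
    (hν₂ : RTN.WeaklyConverges (fun k => RTN.cutMeasure (φ (n k)) Γ₂ (n k) (H (n k))) ν₂) :
    RTN.WeaklyConvergesInProbability
      (fun k => RTN.bulkLaw (φ (n k)).dim bdry)
      (fun k => RTN.boundaryMeasure (φ (n k)) bdry A (n k) (H (n k)))
      (RTN.minPushforward ν₁ ν₂) := by
  have hnt : Tendsto (fun k => (n k : ℝ)) atTop atTop :=
    tendsto_natCast_atTop_atTop.comp hn.tendsto_atTop
  have hεt : Tendsto (fun k => ε (n k)) atTop (𝓝 0) :=
    hε.trans_tendsto ((tendsto_rpow_neg_atTop (by linarith)).comp hnt)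
  have hKt : Tendsto (fun k => K (n k)) atTop atTop :=
    tendsto_atTop_mono' _ hK ((tendsto_pow_atTop two_ne_zero).comp
      ((Real.tendsto_logb_atTop one_lt_two).comp hnt) |>.const_mul_atTop hc)
  intro f δ hδ
  obtain ⟨X, η, hη, hX⟩ := RTN.exists_finset_integral_close (RTN.minPushforward ν₁ ν₂) f hδ
  have key := fun x => RTN.tendsto_boundaryMeasure_real hΓ₁ hΓ₂ hΓ hdisj hn_pos
    (Real.tendsto_sqrt_atTop.comp hnt) (ψ := fun k => φ (n k))
    (θ := fun k => 2 ^ (-(1 / 2 * K (n k)))) (h := fun k => H (n k)) (fun k => by positivity)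
    (RTN.tendsto_two_rpow_zero hKt (by norm_num)) (RTN.tendsto_badProb hmin hεt hKt) hcdf₁ hcdf₂
    (hν₁.tendsto_real_Iic hcdf₁) (hν₂.tendsto_real_Iic hcdf₂) x hη
  set bad : (k : ℕ) → ℝ → Set (RTN.BulkTensors (φ (n k)).dim bdry) := fun k x => {ω | ¬ (
    |(RTN.boundaryMeasure (φ (n k)) bdry A (n k) (H (n k)) ω).real (Set.Iic x) -
      (RTN.minPushforward ν₁ ν₂).real (Set.Iic x)| < η ∧
    |(RTN.boundaryMeasure (φ (n k)) bdry A (n k) (H (n k)) ω).real Set.univ - 1| < η)}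
  have hsum : Tendsto (fun k => ∑ x ∈ insert 0 X, RTN.bulkLaw (φ (n k)).dim bdry (bad k x)) atTop
      (𝓝 0) := by
    rw [← Finset.sum_const_zero (s := insert 0 X) (M := ℝ≥0∞)]
    refine tendsto_finsetSum (insert 0 X) fun x _ => ?_
    rw [← ENNReal.tendsto_toReal_iff (fun k => measure_ne_top _ _) ENNReal.zero_ne_top]
    exact key x
  refine tendsto_of_tendsto_of_tendsto_of_le_of_le tendsto_const_nhds hsum (fun k => bot_le)
    fun k => le_trans (measure_mono ?_) (measure_biUnion_finset_le _ _)
  intro ω hω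
  by_contra hn'
  simp only [Set.mem_iUnion, not_exists] at hn'
  have hgood := fun x hx => not_not.1 (hn' x hx)
  have hfin : IsFiniteMeasure (RTN.boundaryMeasure (φ (n k)) bdry A (n k) (H (n k)) ω) := by
    unfold RTN.boundaryMeasure
    infer_instance
  exact absurd (hX _ hfin (fun x hx => (hgood x (Finset.mem_insert_of_mem hx)).1)
    (hgood 0 (Finset.mem_insert_self _ _)).2) (not_lt.2 hω)
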